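/- Let $\theta_1(u|\tau)=-\sum_{n\in\mathbb Z}\exp\bigl(\pi i\tau(n+\tfrac12)^2+2\pi i(n+\tfrac12)(u+\tfrac12)\bigr)$ for $\operatorname{Im}\tau>0$, let $\theta_1'$ be its $u$-derivative, and put $$x(u,z)=\frac{\theta_1(z-u)\,\theta_1'(0)}{\theta_1(z)\,\theta_1(u)},\qquad y(u,z)=\frac{\partial x(u,z)}{\partial u}.$$ Let $\wp$ be the Weierstrass function with primitive periods $1,\tau$. Let $\Delta\subset\mathbb R^\ell$ be a simply laced root system (types $A$, $D$, $E$, and more generally orthogonal unions of these), normalized so that $\alpha\cdot\alpha=2$ for all $\alpha\in\Delta$; the inner product is extended bilinearly to $\mathbb C^\ell$. Let $g\in\mathbb C$, let $U$ be an open subset of the upper half plane and let $(q(\tau),p(\tau))\in\mathbb C^\ell\times\mathbb C^\ell$ be a holomorphic solution on $U$ of the non-autonomous system $$2\pi i\frac{dq}{d\tau}=p,\qquad 2\pi i\frac{dp}{d\tau}=-\frac{g^2}{2}\sum_{\alpha\in\Delta}\wp'(\alpha\cdot q)\,\alpha ,$$ with $\alpha\cdot q(\tau)\notin\mathbb Z+\mathbb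 Z\tau$ for all $\alpha\in\Delta$, $\tau\in U$. Define the $\Delta\times\Delta$ matrices $E(v)_{\beta\gamma}=\delta_{v,\beta-\gamma}$ (for $v=\alpha$ and $v=2\alpha$), $P_{\beta\gamma}=p\cdot\beta\,\delta_{\beta\gamma}$, $Q_{\beta\gamma}=q\cdot\beta\,\delta_{\beta\gamma}$, $D_{\beta\gamma}=\delta_{\beta\gamma}\,ig\bigl(\wp(\beta\cdot q)+\sum_{\gamma'\in\Delta,\ \beta\cdot\gamma'=1}\wp(\gamma'\cdot q)\bigr)$, $$X_1(z)=ig\sum_{\alpha\in\Delta}x(\alpha\cdot q,z)E(\alpha),\quad X_2(z)=2ig\sum_{\alpha\in\Delta}x(\alpha\cdot q,2z)E(2\alpha),$$ $$Y_1(z)=ig\sum_{\alpha\in\Delta}y(\alpha\cdot q,z)E(\alpha),\quad Y_2(z)=ig\sum_{\alpha\in\Delta}y(\alpha\cdot q,2z)E(2\alpha),$$ $$L(z)=P+X_1(z)+X_2(z),\qquad M(z)=D+Y_1(z)+Y_2(z).$$ Call $z$ singular if it is congruent modulo $\mathbb Z+\mathbb Z\tau$ to one of $0$, $\omega_1=\tfrac12$,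 $\omega_2=\tfrac{1+\tau}2$, $\omega_3=\tfrac\tau2$. Then: 1. For $\tau\in U$ and non-singular $z$, $\;2\pi i\,\dfrac{\partial L(z)}{\partial\tau}+\dfrac{\partial M(z)}{\partial z}=[L(z),M(z)]$. 2. For $\tau\in U$ and non-singular $z$, $\;L(z+1)=L(z)$, $M(z+1)=M(z)$, $L(z+\tau)=e^{2\pi iQ}L(z)e^{-2\pi iQ}$, and $M(z+\tau)=e^{2\pi iQ}\bigl(M(z)+2\pi iL(z)\bigr)e^{-2\pi iQ}-2\pi iP$. 3. For each $\tau\in U$ the equation $dY/dz=L(z)Y$ on the torus $\mathbb C/(\mathbb Z+\mathbb Z\tau)$ has regular singularities at the four distinct points $0,\omega_1,\omega_2,\omega_3$ and no others: $L$ is holomorphic at non-singular $z$, its entries have at most simple poles at singular $z$, and if $g\neq0$ and $\Delta\neq\emptyset$ some entry does have a simple pole at each singular $z$. It is isomonodromic in the following sense. For real $(a,b)$ consider points $z=a+b\tau$, and let paths in the $(a,b)$-plane be continuous and such that the corresponding $z$ avoids the singular points. (a) For every convex open $V\subseteq U$, $\tau_0\in V$, base point $(a_0,b_0)$ and invertible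 matrix $Y_0$ there is an initial value $G(\tau)$, $\tau\in V$, with $G(\tau_0)=Y_0$, such that along every path starting at $(a_0,b_0)$ there is an analytic continuation over $V$, invertible everywhere and starting with $G(\tau)$ at $z=a_0+b_0\tau$, of a solution $Y$ of the linear system $$\frac{\partial Y}{\partial z}=L(z)Y,\qquad 2\pi i\frac{\partial Y}{\partial\tau}+M(z)Y=0 .$$ (b) Let $V\subseteq U$ be open and connected, and let $Y$ be an invertible (fundamental) solution of this linear system, continued analytically over $V$ along a path from $(a_0,b_0)$ to $(a_0+m,b_0+n)$ with $m,n\in\mathbb Z$. Then the monodromy matrix $\Gamma$ defined by $$Y(z+m+n\tau)=e^{2\pi inQ}\,Y(z)\,\Gamma\qquad(z=a_0+b_0\tau)$$ is invertible and independent of $\tau\in V$. In particular the local monodromy matrices $\Gamma_0,\dots,\Gamma_3$ (loops around the four singular points, $m=n=0$) and the two global ones ($(m,n)=(1,0)$ and $(0,1)$) are independent of $\tau$. -/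

import Mathlib

open Complex Filter Topology
open scoped Classical

noncomputable section

namespace EllipticCM

/-! ### Theta functions, the Weierstrass function and the kernels `x`, `y` -/

/-- The Jacobi theta function `θ₁(u | τ)`. -/
def theta1 (τ u : ℂ) : ℂ :=
  -∑' n : ℤ, cexp (Real.pi * I * τ * ((n : ℂ) + 1 / 2) ^ 2
      + 2 * Real.pi * I * ((n : ℂ) + 1 / 2) * (u + 1 / 2))

/-- The kernel `x(u,z) = θ₁(z - u) θ₁'(0) / (θ₁(z) θ₁(u))`. -/
def xker (τ u z : ℂ) : ℂ :=
  theta1 τ (z - u) * deriv (theta1 τ) 0 / (theta1 τ z * theta1 τ u)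

/-- The kernel `y(u,z) = ∂x(u,z)/∂u`. -/
def yker (τ u z : ℂ) : ℂ := deriv (fun v => xker τ v z) u

/-- The period lattice `ℤ + ℤτ`. -/
def periods (τ : ℂ) : Set ℂ := {w | ∃ m n : ℤ, w = m + n * τ}

lemma linearIndependent_one_tau {τ : ℂ} (h : 0 < τ.im) :
    LinearIndependent ℝ ![(1 : ℂ), τ] := by
  rw [LinearIndependent.pair_iff]
  intro s t hst
  have him := congrArg Complex.im hst
  have hre := congrArg Complex.re hst
  simp at him hre
  have ht : t = 0 := by
    rcases him with h1 | h1
    · exact h1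
    · exact absurd h1 h.ne'
  subst ht
  simpa using hre

/-- The Weierstrass function `℘(u)` with primitive periods `1` and `τ`, for `Im τ > 0`. -/
def wp (τ u : ℂ) : ℂ :=
  if h : 0 < τ.im then
    PeriodPair.weierstrassP ⟨1, τ, linearIndependent_one_tau h⟩ u
  else 0

/-! ### Simply laced root systems in a Euclidean space -/

/-- `Δ ⊂ ℝ^ℓ` is a simply laced root system, in the normalization in which all roots have
squared length `2`.  The irreducible ones are those of type `A`, `D`, `E`. It is not required
that `Δ` spans `ℝ^ℓ`, so that e.g. `A_{ℓ-1}` may be realized in `ℝ^ℓ`. -/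
structure IsSimplyLacedRootSystem {ℓ : ℕ} (Δ : Finset (EuclideanSpace ℝ (Fin ℓ))) : Prop where
  norm_sq : ∀ α ∈ Δ, inner ℝ α α = 2
  reflection_mem : ∀ α ∈ Δ, ∀ β ∈ Δ, β - (2 * inner ℝ α β / inner ℝ α α) • α ∈ Δ
  integral : ∀ α ∈ Δ, ∀ β ∈ Δ, ∃ k : ℤ, 2 * inner ℝ α β / inner ℝ α α = (k : ℝ)

variable {ℓ : ℕ}

/-- The complex bilinear extension of the Euclidean inner product: `α · v` for a real vector
`α` and a complex vector `v`. -/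
def cdot (α : EuclideanSpace ℝ (Fin ℓ)) (v : Fin ℓ → ℂ) : ℂ := ∑ j, (α j : ℂ) * v j

/-! ### The non-autonomous flow -/

/-- `(q, p)` is a holomorphic solution on `U` of the non-autonomous system
`2πi dq/dτ = p`, `2πi dp/dτ = -(g²/2) ∑_{α ∈ Δ} ℘'(α·q) α`, which stays away from the
singularities `α · q ∈ ℤ + ℤτ` of the potential. -/
structure IsFlow (Δ : Finset (EuclideanSpace ℝ (Fin ℓ))) (g : ℂ) (U : Set ℂ)
    (q p : ℂ → Fin ℓ → ℂ) : Prop where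
  regular : ∀ τ ∈ U, ∀ α ∈ Δ, cdot α (q τ) ∉ periods τ
  eq_q : ∀ τ ∈ U, ∀ j, HasDerivAt (fun t => 2 * Real.pi * I * q t j) (p τ j) τ
  eq_p : ∀ τ ∈ U, ∀ j, HasDerivAt (fun t => 2 * Real.pi * I * p t j)
    (-(g ^ 2 / 2) * ∑ α ∈ Δ, deriv (wp τ) (cdot α (q τ)) * (α j : ℂ)) τ

/-! ### The root type Lax pair -/

section LaxPair

variable (Δ : Finset (EuclideanSpace ℝ (Fin ℓ)))

/-- The `Δ × Δ` matrix `E(v)_{βγ} = δ_{v, β - γ}`, used for `v = α` and `v = 2α`. -/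
def Emat (v : EuclideanSpace ℝ (Fin ℓ)) : Matrix Δ Δ ℂ :=
  Matrix.of fun β γ => if v = (β : EuclideanSpace ℝ (Fin ℓ)) - γ then 1 else 0

/-- The diagonal matrix with entries `v · β`; `P` and `Q` are `dotMat Δ p` and `dotMat Δ q`. -/
def dotMat (v : Fin ℓ → ℂ) : Matrix Δ Δ ℂ :=
  Matrix.diagonal fun β => cdot (β : EuclideanSpace ℝ (Fin ℓ)) v

/-- The diagonal matrix `D`. -/
def Dmat (g τ : ℂ) (q : Fin ℓ → ℂ) : Matrix Δ Δ ℂ :=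
  Matrix.diagonal fun β => I * g * wp τ (cdot (β : EuclideanSpace ℝ (Fin ℓ)) q)
    + I * g * ∑ γ ∈ Δ with inner ℝ (β : EuclideanSpace ℝ (Fin ℓ)) γ = 1, wp τ (cdot γ q)

def X1 (g τ : ℂ) (q : Fin ℓ → ℂ) (z : ℂ) : Matrix Δ Δ ℂ :=
  (I * g) • ∑ α ∈ Δ, xker τ (cdot α q) z • Emat Δ α

def X2 (g τ : ℂ) (q : Fin ℓ → ℂ) (z : ℂ) : Matrix Δ Δ ℂ :=
  (2 * I * g) • ∑ α ∈ Δ, xker τ (cdot α q) (2 * z) • Emat Δ ((2 : ℝ) • α)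

def Y1 (g τ : ℂ) (q : Fin ℓ → ℂ) (z : ℂ) : Matrix Δ Δ ℂ :=
  (I * g) • ∑ α ∈ Δ, yker τ (cdot α q) z • Emat Δ α

def Y2 (g τ : ℂ) (q : Fin ℓ → ℂ) (z : ℂ) : Matrix Δ Δ ℂ :=
  (I * g) • ∑ α ∈ Δ, yker τ (cdot α q) (2 * z) • Emat Δ ((2 : ℝ) • α)

/-- `L(z) = P + X₁(z) + X₂(z)` along the curve `(q(τ), p(τ))`. -/
def Lmat (g : ℂ) (q p : ℂ → Fin ℓ → ℂ) (τ z : ℂ) : Matrix Δ Δ ℂ :=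
  dotMat Δ (p τ) + X1 Δ g τ (q τ) z + X2 Δ g τ (q τ) z

/-- `M(z) = D + Y₁(z) + Y₂(z)` along the curve `q(τ)`. -/
def Mmat (g : ℂ) (q : ℂ → Fin ℓ → ℂ) (τ z : ℂ) : Matrix Δ Δ ℂ :=
  Dmat Δ g τ (q τ) + Y1 Δ g τ (q τ) z + Y2 Δ g τ (q τ) z

/-- `e^{2πi k Q}` for `k ∈ ℂ`, as a matrix exponential. -/
def expQ (k : ℂ) (q : Fin ℓ → ℂ) : Matrix Δ Δ ℂ :=
  NormedSpace.exp ((2 * Real.pi * I * k) • dotMat Δ q)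

end LaxPair

/-! ### Singular points on the torus and monodromy -/

/-- The four points `0`, `ω₁`, `ω₂`, `ω₃` (modulo periods), where `2ω₁ = 1`, `2ω₃ = τ`,
`ω₂ = ω₁ + ω₃`. -/
def singularPoint (τ : ℂ) : Fin 4 → ℂ := ![0, 1 / 2, (1 + τ) / 2, τ / 2]

/-- `z` represents one of the four points `0, ω₁, ω₂, ω₃` of the torus `ℂ / (ℤ + ℤτ)`. -/
def IsSingular (τ z : ℂ) : Prop := ∃ a, z - singularPoint τ a ∈ periods τ

variable {ι : Type*} [Fintype ι]

/-- `F(τ, z)` is holomorphic at `(τ, z)` and satisfies there the linear system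
`∂F/∂z = L F`, `2πi ∂F/∂τ + M F = 0`. -/
def SolvesAt (L M F : ℂ → ℂ → Matrix ι ι ℂ) (τ z : ℂ) : Prop :=
  ∀ β γ, DifferentiableAt ℂ (fun w : ℂ × ℂ => F w.1 w.2 β γ) (τ, z) ∧
    deriv (fun w => F τ w β γ) z = (L τ z * F τ z) β γ ∧
    2 * Real.pi * I * deriv (fun t => F t z β γ) τ + (M τ z * F τ z) β γ = 0

/-- The point of `ℂ` with real coordinates `c` with respect to the basis `1, τ`. A path in
these coordinates gives a path in `ℂ` for each `τ`, moving with the lattice `ℤ + ℤτ`. -/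
def torusPoint (c : ℝ × ℝ) (τ : ℂ) : ℂ := c.1 + c.2 * τ

/-- For `τ ∈ V`, the path `s ↦ torusPoint (c s) τ` avoids the singular points. -/
def AvoidsSingular (V : Set ℂ) {b e : ℝ × ℝ} (c : Path b e) : Prop :=
  ∀ s, ∀ τ ∈ V, ¬ IsSingular τ (torusPoint (c s) τ)

/-- `Φ s τ` is the value at the point `torusPoint (c s) τ` of a (multivalued) solution `Y` of the
linear system `∂Y/∂z = L Y`, `2πi ∂Y/∂τ + M Y = 0`, continued analytically along
the path `c`, for `τ` in the open set `V`: near each point, `Φ` is given by a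
single holomorphic local solution `F(τ, z)`. -/
def IsContinuationAlong (L M : ℂ → ℂ → Matrix ι ι ℂ) (V : Set ℂ) {b e : ℝ × ℝ} (c : Path b e)
    (Φ : unitInterval → ℂ → Matrix ι ι ℂ) : Prop :=
  ∀ s, ∀ τ ∈ V, ∃ F : ℂ → ℂ → Matrix ι ι ℂ,
    (∀ᶠ w in 𝓝 (τ, torusPoint (c s) τ), SolvesAt L M F w.1 w.2) ∧
    ∀ᶠ r in 𝓝 (s, τ), Φ r.1 r.2 = F r.2 (torusPoint (c r.1) r.2)

end EllipticCM

end

open EllipticCM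

open Complex Filter Topology
open scoped Classical

noncomputable section

/-! The Lax equation is the zero-curvature condition for the connection dY = L Y dz - (2πi)⁻¹ M Y
dτ, so everything rests on identities for the kernels x and y.

Identities. The zeros of θ₁ are exactly the lattice points: by Liouville's theorem θ₁ is a nonzero
multiple of an explicit infinite product whose zeros are visible. Liouville's theorem again
expresses ℘ through θ₁ (`theta1_sub_mul_theta1_add`, `wp_eq_theta`). The first of these turns
Weierstrass's three-term identity into polynomial algebra in values of ℘. Its derivatives yield the
functional equations of x and y (`xker_yker_sub`, `xker_yker_neg_sub`, `xker_yker_two_mul`). The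
heat equation for θ₁, with a degenerate addition formula, gives 2πi ∂x/∂τ + ∂y/∂z = 0
(`hasDerivAt_xker_tau`).

Lax equation. Along the flow, 2πi dx/dτ = (α·p) y - ∂y/∂z. The last term cancels ∂M/∂z, and the
first one is the commutator of P with Y₁ + Y₂. It remains to see that the commutator of X₁ + X₂ with
D + Y₁ + Y₂ is diagonal and reproduces the force (`kerMat_commutator`). This is checked on the entry
(β,γ) according to β·γ = 2, 1, 0, -1, -2: the sum rule for x and y is needed for 1, the equation
coupling z with 2z for -1, and the oddness relation for the diagonal.

Isomonodromy. In the coordinates z = a + bτ the singular points are the half-integer pairs (a,b),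
whatever τ is. A path avoiding them therefore avoids them for all τ at once, and flatness lets a
solution prescribed over V at one (a,b) be extended over all of V to any convex neighbourhood free
of singular points, hence step by step along a path (`exists_extension`, `exists_transport`). The
extension solves a Volterra equation along segments with holomorphic dependence on parameters
(`exists_parallel_transport`). Finally, the translation rules of L and M say that e^{-2πinQ} carries
solutions along the line (a+m, b+n) to solutions along (a,b). Thus e^{-2πinQ} Y(z+m+nτ) and Y(z)
solve the same linear equation in τ and differ by a constant right factor Γ (`exists_monodromy`). -/

namespace EllipticCM

/-! ### Holomorphic functions of several variables are smooth. -/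

section Smoothness

set_option linter.unusedSectionVars false
variable {E F : Type*} [NormedAddCommGroup E] [NormedSpace ℂ E] [FiniteDimensional ℂ E]
  [NormedAddCommGroup F] [NormedSpace ℂ F] [CompleteSpace F] [SecondCountableTopology F]

/-- Cauchy's formula for a directional derivative. -/
lemma fderiv_apply_eq_circleIntegral {f : E → F} {Ω : Set E} (hΩ : IsOpen Ω)
    (hf : DifferentiableOn ℂ f Ω) {x v : E} {r : ℝ} (hr : 0 < r)
    (hx : ∀ s ∈ Metric.closedBall (0 : ℂ) r, x + s • v ∈ Ω) :
    fderiv ℂ f x v =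
      (2 * Real.pi * I : ℂ)⁻¹ • ∮ s in C(0, r), ((s - 0) ^ 2)⁻¹ • f (x + s • v) := by
  have hU : IsOpen ((fun s : ℂ => x + s • v) ⁻¹' Ω) := hΩ.preimage (by fun_prop)
  have hd : DifferentiableOn ℂ (fun s : ℂ => f (x + s • v)) ((fun s : ℂ => x + s • v) ⁻¹' Ω) :=
    hf.comp (by fun_prop) (fun s hs => hs)
  rw [two_pi_I_inv_smul_circleIntegral_sub_sq_inv_smul_of_differentiable hU hx hd
    (Metric.mem_ball_self hr)]
  have hx0 : x ∈ Ω := by simpa using hx 0 (by simp [hr.le])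
  have h1 : HasFDerivAt f (fderiv ℂ f x) (x + (0 : ℂ) • v) := by
    simpa using (hf.differentiableAt (hΩ.mem_nhds hx0)).hasFDerivAt
  have h2 : HasDerivAt (fun s : ℂ => x + s • v) v 0 := by
    simpa using ((hasDerivAt_id (0 : ℂ)).smul_const v).const_add x
  exact (h1.comp_hasDerivAt (0 : ℂ) h2).deriv.symm

/-- Cauchy's estimate on the complex line through x in the direction v. -/
lemma norm_fderiv_apply_le {f : E → F} {Ω : Set E} (hΩ : IsOpen Ω)
    (hf : DifferentiableOn ℂ f Ω) {x v : E} {r C : ℝ} (hr : 0 < r)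
    (hx : ∀ s ∈ Metric.closedBall (0 : ℂ) r, x + s • v ∈ Ω)
    (hC : ∀ s ∈ Metric.sphere (0 : ℂ) r, ‖f (x + s • v)‖ ≤ C) :
    ‖fderiv ℂ f x v‖ ≤ C / r := by
  have hU : IsOpen ((fun s : ℂ => x + s • v) ⁻¹' Ω) := hΩ.preimage (by fun_prop)
  have hd : DifferentiableOn ℂ (fun s : ℂ => f (x + s • v)) ((fun s : ℂ => x + s • v) ⁻¹' Ω) :=
    hf.comp (by fun_prop) (fun s hs => hs)
  have hx0 : x ∈ Ω := by simpa using hx 0 (by simp [hr.le])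
  have h1 : HasFDerivAt f (fderiv ℂ f x) (x + (0 : ℂ) • v) := by
    simpa using (hf.differentiableAt (hΩ.mem_nhds hx0)).hasFDerivAt
  have h2 : HasDerivAt (fun s : ℂ => x + s • v) v 0 := by
    simpa using ((hasDerivAt_id (0 : ℂ)).smul_const v).const_add x
  rw [← (h1.comp_hasDerivAt (0 : ℂ) h2).deriv]
  refine Complex.norm_deriv_le_of_forall_mem_sphere_norm_le hr ?_ hC
  refine (hd.mono ?_).diffContOnCl
  rw [closure_ball _ hr.ne']
  exact hx

/-- The derivative of a holomorphic function of several variables is holomorphic. -/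
lemma differentiableOn_fderiv {f : E → F} {Ω : Set E} (hΩ : IsOpen Ω)
    (hf : DifferentiableOn ℂ f Ω) : DifferentiableOn ℂ (fderiv ℂ f) Ω := by
  -- In finite dimension a family of linear maps is differentiable once its values on each fixed
  -- vector are.
  suffices h : ∀ v, DifferentiableOn ℂ (fun x => fderiv ℂ f x v) Ω by
    let d := Module.finrank ℂ E
    have hd : d = Module.finrank ℂ (Fin d → ℂ) := (Module.finrank_fin_fun ℂ).symm
    let e₁ := ContinuousLinearEquiv.ofFinrankEq hd
    let e₂ := (e₁.arrowCongr (1 : F ≃L[ℂ] F)).trans (ContinuousLinearEquiv.piRing (Fin d))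
    rw [← Function.id_comp (fderiv ℂ f), ← e₂.symm_comp_self]
    exact e₂.symm.differentiable.comp_differentiableOn (differentiableOn_pi.mpr fun i => h _)
  intro v x₀ hx₀
  refine DifferentiableAt.differentiableWithinAt ?_
  -- a ball on which `f` is bounded
  have hcont : ContinuousAt f x₀ := (hf.differentiableAt (hΩ.mem_nhds hx₀)).continuousAt
  obtain ⟨R, hR, hRΩ, hRC⟩ : ∃ R > 0, Metric.ball x₀ R ⊆ Ω ∧
      ∀ x ∈ Metric.ball x₀ R, ‖f x‖ ≤ ‖f x₀‖ + 1 := by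
    have h1 : ∀ᶠ x in 𝓝 x₀, ‖f x‖ < ‖f x₀‖ + 1 :=
      hcont.norm.eventually_lt_const (by linarith)
    obtain ⟨R, hR, h⟩ := Metric.eventually_nhds_iff_ball.1 (h1.and (hΩ.mem_nhds hx₀))
    exact ⟨R, hR, fun x hx => (h x hx).2, fun x hx => (h x hx).1.le⟩
  set C := ‖f x₀‖ + 1
  have hC0 : 0 ≤ C := by positivity
  -- derivative bound on the half ball
  have hbound : ∀ x ∈ Metric.ball x₀ (R / 2), ‖fderiv ℂ f x‖ ≤ C / (R / 4) := by
    intro x hx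
    refine ContinuousLinearMap.opNorm_le_of_unit_norm (by positivity) fun w hw => ?_
    have hball : ∀ s ∈ Metric.closedBall (0 : ℂ) (R / 4), x + s • w ∈ Metric.ball x₀ R := by
      intro s hs
      rw [Metric.mem_ball, dist_eq_norm] at hx ⊢
      rw [mem_closedBall_zero_iff] at hs
      calc ‖x + s • w - x₀‖ = ‖(x - x₀) + s • w‖ := by congr 1; abel
        _ ≤ ‖x - x₀‖ + ‖s • w‖ := norm_add_le _ _
        _ < R := by rw [norm_smul, hw]; linarith
    exact norm_fderiv_apply_le hΩ hf (by positivity) (fun s hs => hRΩ (hball s hs))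
      fun s hs => hRC _ (hball s (Metric.sphere_subset_closedBall hs))
  -- This radius gives ‖s • v‖ ≤ R/4 on the disc; the added 1 covers v = 0.
  set r := R / (4 * (‖v‖ + 1)) with hr
  have hv : 0 < ‖v‖ + 1 := by positivity
  have hr0 : 0 < r := by positivity
  have hmem : ∀ x ∈ Metric.ball x₀ (R / 4), ∀ s ∈ Metric.closedBall (0 : ℂ) r,
      x + s • v ∈ Metric.ball x₀ (R / 2) := by
    intro x hx s hs
    rw [Metric.mem_ball, dist_eq_norm] at hx ⊢
    rw [mem_closedBall_zero_iff] at hs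
    have h1 : ‖s • v‖ ≤ R / 4 := by
      rw [norm_smul]
      calc ‖s‖ * ‖v‖ ≤ r * (‖v‖ + 1) := by gcongr; linarith
        _ = R / 4 := by rw [hr]; field_simp
    calc ‖x + s • v - x₀‖ = ‖(x - x₀) + s • v‖ := by congr 1; abel
      _ ≤ ‖x - x₀‖ + ‖s • v‖ := norm_add_le _ _
      _ < R / 2 := by linarith
  have hsub : Metric.ball x₀ (R / 2) ⊆ Metric.ball x₀ R := Metric.ball_subset_ball (by linarith)
  have hcirc : ∀ x ∈ Metric.ball x₀ (R / 4), ∀ θ : ℝ,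
      x + circleMap 0 r θ • v ∈ Metric.ball x₀ (R / 2) := fun x hx θ =>
    hmem x hx _ (Metric.sphere_subset_closedBall (circleMap_mem_sphere 0 hr0.le θ))
  let k : ℝ → ℂ := fun θ => deriv (circleMap 0 r) θ * ((circleMap 0 r θ - 0) ^ 2)⁻¹
  have hk : Continuous k := by
    have hd : deriv (circleMap 0 r) = fun θ => circleMap 0 r θ * I := funext fun θ => deriv_circleMap 0 r θ
    refine Continuous.mul (by rw [hd]; fun_prop) (Continuous.inv₀ (by fun_prop) ?_)
    intro θ
    simpa using (circleMap_ne_center (c := 0) (θ := θ) hr0.ne')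
  have hfc : ∀ x ∈ Metric.ball x₀ (R / 4),
      Continuous fun θ : ℝ => f (x + circleMap 0 r θ • v) := fun x hx =>
    hf.continuousOn.comp_continuous (by fun_prop) fun θ => hRΩ (hsub (hcirc x hx θ))
  have hev : Metric.ball x₀ (R / 4) ∈ 𝓝 x₀ := Metric.ball_mem_nhds _ (by positivity)
  have hx₀' : x₀ ∈ Metric.ball x₀ (R / 4) := Metric.mem_ball_self (by positivity)
  borelize E
  borelize F
  -- Cauchy's integral is differentiated under the integral sign. Continuity of the derivative is
  -- not yet known, so its measurability and the Cauchy bound take that place.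
  have key := intervalIntegral.hasFDerivAt_integral_of_dominated_of_fderiv_le (𝕜 := ℂ)
    (μ := MeasureTheory.volume) (a := 0) (b := 2 * Real.pi)
    (F := fun x θ => k θ • f (x + circleMap 0 r θ • v))
    (F' := fun x θ => k θ • fderiv ℂ f (x + circleMap 0 r θ • v))
    (bound := fun θ => ‖k θ‖ * (C / (R / 4))) hev
    (by
      filter_upwards [hev] with x hx
      exact (hk.smul (hfc x hx)).aestronglyMeasurable)
    ((hk.smul (hfc x₀ hx₀')).intervalIntegrable _ _)
    (by
      refine hk.aestronglyMeasurable.smul (Measurable.aestronglyMeasurable ?_)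
      exact (measurable_fderiv ℂ f).comp (by fun_prop))
    (by
      refine Eventually.of_forall fun θ _ x hx => ?_
      rw [norm_smul]
      gcongr
      exact hbound _ (hcirc x hx θ))
    ((by fun_prop : Continuous fun θ => ‖k θ‖ * (C / (R / 4))).intervalIntegrable _ _)
    (by
      refine Eventually.of_forall fun θ _ x hx => ?_
      have h1 : HasFDerivAt f (fderiv ℂ f (x + circleMap 0 r θ • v)) (x + circleMap 0 r θ • v) :=
        (hf.differentiableAt (hΩ.mem_nhds (hRΩ (hsub (hcirc x hx θ))))).hasFDerivAt
      exact (h1.comp x ((hasFDerivAt_id x).add_const _)).const_smul (k θ))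
  refine (key.differentiableAt.const_smul (2 * Real.pi * I : ℂ)⁻¹).congr_of_eventuallyEq ?_
  filter_upwards [hev] with x hx
  rw [fderiv_apply_eq_circleIntegral hΩ hf hr0 fun s hs => hRΩ (hsub (hmem x hx s hs))]
  simp only [circleIntegral, k, smul_smul]
  rfl

lemma contDiffOn_two_of_differentiableOn {f : E → F} {Ω : Set E} (hΩ : IsOpen Ω)
    (hf : DifferentiableOn ℂ f Ω) : ContDiffOn ℂ 2 f Ω := by
  have h := differentiableOn_fderiv hΩ hf
  have h1 : ContDiffOn ℂ (1 + 1) f Ω := by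
    rw [contDiffOn_succ_iff_fderiv_of_isOpen hΩ, ← zero_add 1,
      contDiffOn_succ_iff_fderiv_of_isOpen hΩ]
    exact ⟨hf, by simp, h, by simp, contDiffOn_zero.2 (differentiableOn_fderiv hΩ h).continuousOn⟩
  simpa [one_add_one_eq_two] using h1

end Smoothness

/-! ### Partial derivatives in two complex variables. -/

section TwoVariables

variable {f : ℂ → ℂ → ℂ} {Ω : Set (ℂ × ℂ)}

lemma hasDerivAt_snd_of_differentiableOn (hΩ : IsOpen Ω)
    (hf : DifferentiableOn ℂ (fun p : ℂ × ℂ => f p.1 p.2) Ω) {p : ℂ × ℂ} (hp : p ∈ Ω) :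
    HasDerivAt (f p.1) (fderiv ℂ (fun p : ℂ × ℂ => f p.1 p.2) p (0, 1)) p.2 := by
  have h1 := (hf.differentiableAt (hΩ.mem_nhds hp)).hasFDerivAt
  exact h1.comp_hasDerivAt p.2 ((hasDerivAt_const p.2 p.1).prodMk (hasDerivAt_id p.2))

lemma hasDerivAt_fst_of_differentiableOn (hΩ : IsOpen Ω)
    (hf : DifferentiableOn ℂ (fun p : ℂ × ℂ => f p.1 p.2) Ω) {p : ℂ × ℂ} (hp : p ∈ Ω) :
    HasDerivAt (fun t => f t p.2) (fderiv ℂ (fun p : ℂ × ℂ => f p.1 p.2) p (1, 0)) p.1 := by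
  have h1 := (hf.differentiableAt (hΩ.mem_nhds hp)).hasFDerivAt
  exact h1.comp_hasDerivAt p.1 ((hasDerivAt_id p.1).prodMk (hasDerivAt_const p.1 p.2))

lemma differentiableOn_deriv_snd (hΩ : IsOpen Ω)
    (hf : DifferentiableOn ℂ (fun p : ℂ × ℂ => f p.1 p.2) Ω) :
    DifferentiableOn ℂ (fun p : ℂ × ℂ => deriv (f p.1) p.2) Ω :=
  ((differentiableOn_fderiv hΩ hf).clm_apply (differentiableOn_const (0, 1))).congr fun _ hp =>
    (hasDerivAt_snd_of_differentiableOn hΩ hf hp).deriv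

/-- Symmetry of the mixed second derivatives of a holomorphic function of two variables. -/
lemma deriv_deriv_comm (hΩ : IsOpen Ω)
    (hf : DifferentiableOn ℂ (fun p : ℂ × ℂ => f p.1 p.2) Ω) {p : ℂ × ℂ} (hp : p ∈ Ω) :
    deriv (fun w => deriv (fun t => f t w) p.1) p.2 =
      deriv (fun t => deriv (f t) p.2) p.1 := by
  set g : ℂ × ℂ → ℂ := fun p => f p.1 p.2 with hg
  have hd := differentiableOn_fderiv hΩ hf
  have hdp := (hd.differentiableAt (hΩ.mem_nhds hp)).hasFDerivAt
  have hsymm : IsSymmSndFDerivAt ℂ g p :=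
    ((contDiffOn_two_of_differentiableOn hΩ hf).contDiffAt (hΩ.mem_nhds hp)).isSymmSndFDerivAt
      (by simp)
  have e1 : (fun w => deriv (fun t => f t w) p.1) =ᶠ[𝓝 p.2] fun w => fderiv ℂ g (p.1, w) (1, 0) := by
    have : ∀ᶠ w in 𝓝 p.2, (p.1, w) ∈ Ω :=
      (by fun_prop : Continuous fun w => (p.1, w)).continuousAt.eventually_mem (hΩ.mem_nhds hp)
    filter_upwards [this] with w hw
    exact (hasDerivAt_fst_of_differentiableOn hΩ hf hw).deriv
  have e2 : (fun t => deriv (f t) p.2) =ᶠ[𝓝 p.1] fun t => fderiv ℂ g (t, p.2) (0, 1) := by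
    have : ∀ᶠ t in 𝓝 p.1, (t, p.2) ∈ Ω :=
      (by fun_prop : Continuous fun t => (t, p.2)).continuousAt.eventually_mem (hΩ.mem_nhds hp)
    filter_upwards [this] with t ht
    exact (hasDerivAt_snd_of_differentiableOn hΩ hf ht).deriv
  have d1 : HasDerivAt (fun w => fderiv ℂ g (p.1, w)) (fderiv ℂ (fderiv ℂ g) p (0, 1)) p.2 :=
    hdp.comp_hasDerivAt p.2 ((hasDerivAt_const p.2 p.1).prodMk (hasDerivAt_id p.2))
  have d2 : HasDerivAt (fun t => fderiv ℂ g (t, p.2)) (fderiv ℂ (fderiv ℂ g) p (1, 0)) p.1 :=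
    hdp.comp_hasDerivAt p.1 ((hasDerivAt_id p.1).prodMk (hasDerivAt_const p.1 p.2))
  rw [e1.deriv_eq, e2.deriv_eq,
    ((d1.clm_apply (hasDerivAt_const p.2 ((1 : ℂ), (0 : ℂ)))).deriv),
    ((d2.clm_apply (hasDerivAt_const p.1 ((0 : ℂ), (1 : ℂ)))).deriv)]
  simpa using hsymm.eq (0, 1) (1, 0)

end TwoVariables

/-! ### The period lattice and Liouville's theorem for elliptic functions. -/

section Lattice

variable {τ : ℂ}

/-- The pair of periods `1`, `τ`. -/
def latticePair (h : 0 < τ.im) : PeriodPair := ⟨1, τ, linearIndependent_one_tau h⟩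

lemma mem_periods_iff (h : 0 < τ.im) {w : ℂ} : w ∈ periods τ ↔ w ∈ (latticePair h).lattice := by
  rw [PeriodPair.mem_lattice]
  simp [periods, latticePair, eq_comm]

lemma zero_mem_periods : (0 : ℂ) ∈ periods τ := ⟨0, 0, by simp⟩

lemma add_mem_periods {a b : ℂ} (ha : a ∈ periods τ) (hb : b ∈ periods τ) :
    a + b ∈ periods τ := by
  obtain ⟨m, n, rfl⟩ := ha
  obtain ⟨k, l, rfl⟩ := hb
  exact ⟨m + k, n + l, by push_cast; ring⟩

lemma neg_mem_periods {a : ℂ} (ha : a ∈ periods τ) : -a ∈ periods τ := by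
  obtain ⟨m, n, rfl⟩ := ha
  exact ⟨-m, -n, by push_cast; ring⟩

lemma neg_mem_periods_iff {a : ℂ} : -a ∈ periods τ ↔ a ∈ periods τ :=
  ⟨fun h => by simpa using neg_mem_periods h, neg_mem_periods⟩

lemma sub_mem_periods_comm {a b : ℂ} : a - b ∈ periods τ ↔ b - a ∈ periods τ := by
  rw [← neg_mem_periods_iff, neg_sub]

lemma add_mem_periods_iff {a l : ℂ} (hl : l ∈ periods τ) : a + l ∈ periods τ ↔ a ∈ periods τ :=
  ⟨fun h => by simpa using add_mem_periods h (neg_mem_periods hl), fun h => add_mem_periods h hl⟩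

lemma one_mem_periods : (1 : ℂ) ∈ periods τ := ⟨1, 0, by simp⟩

lemma tau_mem_periods : τ ∈ periods τ := ⟨0, 1, by simp⟩

lemma isClosed_periods (h : 0 < τ.im) : IsClosed (periods τ) := by
  convert (latticePair h).isClosed_lattice using 1
  ext w
  exact mem_periods_iff h

lemma eventually_notMem_periods (h : 0 < τ.im) {u : ℂ} (hu : u ∉ periods τ) :
    ∀ᶠ w in 𝓝 u, w ∉ periods τ :=
  (isClosed_periods h).isOpen_compl.mem_nhds hu

lemma eventually_ne_notMem_periods (h : 0 < τ.im) (u : ℂ) : ∀ᶠ w in 𝓝[≠] u, w ∉ periods τ := by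
  rw [eventually_nhdsWithin_iff]
  filter_upwards [(latticePair h).compl_lattice_sdiff_singleton_mem_nhds u] with w hw hne hmem
  exact hw ⟨(mem_periods_iff h).1 hmem, hne⟩

/-- Every point is congruent to a point of the closed fundamental parallelogram. -/
lemma exists_periods_fundamental (h : 0 < τ.im) (u : ℂ) :
    ∃ l ∈ periods τ, ∃ c ∈ Set.Icc (0 : ℝ × ℝ) 1, u = torusPoint c τ + l := by
  set b := u.im / τ.im with hb
  set a := u.re - b * τ.re with ha
  refine ⟨⌊a⌋ + ⌊b⌋ * τ, ⟨_, _, rfl⟩, (Int.fract a, Int.fract b), ?_, ?_⟩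
  · exact ⟨⟨Int.fract_nonneg a, Int.fract_nonneg b⟩,
      ⟨(Int.fract_lt_one a).le, (Int.fract_lt_one b).le⟩⟩
  · have h1 : u = a + b * τ := by
      apply Complex.ext
      · simp [ha]
      · simp [hb, h.ne']
    have h2 : (a : ℂ) = (Int.fract a : ℝ) + (⌊a⌋ : ℂ) := by
      conv_lhs => rw [← Int.fract_add_floor a]
      push_cast; rfl
    have h3 : (b : ℂ) = (Int.fract b : ℝ) + (⌊b⌋ : ℂ) := by
      conv_lhs => rw [← Int.fract_add_floor b]
      push_cast; rfl
    rw [h1, h2, h3, torusPoint]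
    ring

/-- Periodicity is assumed only off the lattice, so the intermediate points of both inductions must
be kept off it. -/
lemma eq_add_of_mem_periods {f : ℂ → ℂ} (h1 : ∀ u ∉ periods τ, f (u + 1) = f u)
    (h2 : ∀ u ∉ periods τ, f (u + τ) = f u) {u l : ℂ} (hu : u ∉ periods τ) (hl : l ∈ periods τ) :
    f (u + l) = f u := by
  have key : ∀ w ∈ periods τ, (∀ u ∉ periods τ, f (u + w) = f u) →
      ∀ k : ℤ, ∀ u ∉ periods τ, f (u + k * w) = f u := by
    intro w hw hf k
    induction k using Int.induction_on with
    | zero => simp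
    | succ k ih =>
      intro u hu
      rw [← ih u hu, ← hf (u + ((k : ℤ) : ℂ) * w)]
      · push_cast; ring_nf
      · intro h
        obtain ⟨m, n, hmn⟩ := hw
        exact hu ((add_mem_periods_iff ⟨k * m, k * n, by rw [hmn]; push_cast; ring⟩).1 h)
    | pred k ih =>
      intro u hu
      have hu' : u + ((-(k : ℤ) - 1 : ℤ) : ℂ) * w ∉ periods τ := by
        intro h
        obtain ⟨m, n, hmn⟩ := hw
        exact hu ((add_mem_periods_iff ⟨(-k - 1) * m, (-k - 1) * n, by
          rw [hmn]; push_cast; ring⟩).1 h)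
      rw [← ih u hu, ← hf _ hu']
      push_cast; ring_nf
  obtain ⟨m, n, rfl⟩ := hl
  have e1 := key 1 one_mem_periods h1 m
  have e2 := key τ tau_mem_periods h2 n
  rw [← add_assoc, e2 _ _]
  · simpa using e1 u hu
  · rwa [add_mem_periods_iff ⟨m, 0, by simp⟩]

/-- A doubly periodic function that is holomorphic off the lattice and bounded near `0` is
constant off the lattice. -/
lemma exists_eq_const_of_doublyPeriodic (h : 0 < τ.im) {f : ℂ → ℂ}
    (hd : ∀ u ∉ periods τ, DifferentiableAt ℂ f u)
    (h1 : ∀ u ∉ periods τ, f (u + 1) = f u) (h2 : ∀ u ∉ periods τ, f (u + τ) = f u)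
    (hb : ∃ C, ∀ᶠ u in 𝓝[≠] 0, ‖f u‖ ≤ C) : ∃ c, ∀ u ∉ periods τ, f u = c := by
  -- The singularity at 0 is removable, and by periodicity the same limit serves at every lattice
  -- point; F becomes entire and bounded.
  set F : ℂ → ℂ := fun u => if u ∈ periods τ then limUnder (𝓝[≠] 0) f else f u with hF
  have hper : ∀ u, ∀ l ∈ periods τ, F (u + l) = F u := by
    intro u l hl
    by_cases hu : u ∈ periods τ
    · simp [hF, hu, add_mem_periods hu hl]
    · simp [hF, hu, add_mem_periods_iff hl, eq_add_of_mem_periods h1 h2 hu hl]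
  have hd0 : DifferentiableAt ℂ F 0 := by
    obtain ⟨C, hC⟩ := hb
    rw [eventually_nhdsWithin_iff] at hC
    have hns := eventually_ne_notMem_periods h 0
    rw [eventually_nhdsWithin_iff] at hns
    have hs := hC.and hns
    have key := differentiableOn_update_limUnder_of_bddAbove (f := f) (c := 0) hs
      (fun u hu => (hd u (hu.1.2 hu.2)).differentiableWithinAt)
      ⟨C, by rintro _ ⟨u, hu, rfl⟩; exact hu.1.1 hu.2⟩
    refine (key.differentiableAt hs).congr_of_eventuallyEq ?_
    filter_upwards [hns] with u hu
    by_cases h0 : u = 0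
    · subst h0; simp [hF, zero_mem_periods]
    · simp [hF, hu h0, h0]
  have hdF : Differentiable ℂ F := by
    intro u
    by_cases hu : u ∈ periods τ
    · have e : F = fun w => F (w - u) := by
        funext w
        rw [sub_eq_add_neg, hper _ _ (neg_mem_periods hu)]
      rw [e]
      have hd0' : DifferentiableAt ℂ F (u - u) := by simpa using hd0
      exact DifferentiableAt.comp (f := fun w => w - u) u hd0' (by fun_prop)
    · refine (hd u hu).congr_of_eventuallyEq ?_
      filter_upwards [eventually_notMem_periods h hu] with w hw
      simp [hF, hw]
  have hbd : Bornology.IsBounded (Set.range F) := by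
    have hK : IsCompact ((fun c : ℝ × ℝ => F (torusPoint c τ)) '' Set.Icc 0 1) := by
      refine isCompact_Icc.image (hdF.continuous.comp ?_)
      unfold torusPoint
      fun_prop
    refine hK.isBounded.subset ?_
    rintro _ ⟨u, rfl⟩
    obtain ⟨l, hl, c, hc, rfl⟩ := exists_periods_fundamental h u
    exact ⟨c, hc, (hper _ _ hl).symm⟩
  obtain ⟨c, hc⟩ := hdF.exists_const_forall_eq_of_bounded hbd
  exact ⟨c, fun u hu => by simpa [hF, hu] using hc u⟩

end Lattice

/-! ### Quasi-periodicity, parity and the heat equation for θ₁. -/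

section Theta

/-- Expanding (n + 1/2)² splits off an exponential prefactor and shifts the argument by 1/2 + τ/2,
which transfers the theory of `jacobiTheta₂` to θ₁. -/
lemma theta1_eq (τ u : ℂ) : theta1 τ u =
    -(cexp (Real.pi * I * τ / 4 + Real.pi * I * (u + 1 / 2)) *
      jacobiTheta₂ (u + 1 / 2 + τ / 2) τ) := by
  rw [theta1, jacobiTheta₂, ← tsum_mul_left]
  congr 1
  refine tsum_congr fun n => ?_
  rw [jacobiTheta₂_term, ← Complex.exp_add]
  ring_nf

lemma theta1_add_one (τ u : ℂ) : theta1 τ (u + 1) = -theta1 τ u := by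
  rw [theta1_eq, theta1_eq, show u + 1 + 1 / 2 + τ / 2 = u + 1 / 2 + τ / 2 + 1 by ring,
    jacobiTheta₂_add_left, show Real.pi * I * τ / 4 + Real.pi * I * (u + 1 + 1 / 2) =
      Real.pi * I * τ / 4 + Real.pi * I * (u + 1 / 2) + Real.pi * I by ring,
    Complex.exp_add _ (Real.pi * I), Complex.exp_pi_mul_I]
  ring

lemma theta1_add_tau (τ u : ℂ) :
    theta1 τ (u + τ) = -(cexp (-(Real.pi * I * τ) - 2 * Real.pi * I * u) * theta1 τ u) := by
  have e : cexp (-(Real.pi * I)) = -1 := by rw [Complex.exp_neg, Complex.exp_pi_mul_I]; norm_num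
  rw [theta1_eq, theta1_eq, show u + τ + 1 / 2 + τ / 2 = u + 1 / 2 + τ / 2 + τ by ring,
    jacobiTheta₂_add_left', ← mul_assoc, ← Complex.exp_add,
    show Real.pi * I * τ / 4 + Real.pi * I * (u + τ + 1 / 2) +
      -Real.pi * I * (τ + 2 * (u + 1 / 2 + τ / 2)) =
      (-(Real.pi * I * τ) - 2 * Real.pi * I * u) +
        (Real.pi * I * τ / 4 + Real.pi * I * (u + 1 / 2)) + -(Real.pi * I) by ring,
    Complex.exp_add _ (-(Real.pi * I)), e, Complex.exp_add (-(Real.pi * I * τ) - _)]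
  ring

lemma theta1_neg (τ u : ℂ) : theta1 τ (-u) = -theta1 τ u := by
  have e : cexp (-(Real.pi * I)) = -1 := by rw [Complex.exp_neg, Complex.exp_pi_mul_I]; norm_num
  rw [theta1_eq, theta1_eq, show u + 1 / 2 + τ / 2 = (u - 1 / 2 - τ / 2 + 1) + τ by ring,
    jacobiTheta₂_add_left', jacobiTheta₂_add_left, ← jacobiTheta₂_neg_left (u - 1 / 2 - τ / 2),
    show -(u - 1 / 2 - τ / 2) = -u + 1 / 2 + τ / 2 by ring, ← mul_assoc, ← Complex.exp_add,
    show Real.pi * I * τ / 4 + Real.pi * I * (u + 1 / 2) +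
        -Real.pi * I * (τ + 2 * (u - 1 / 2 - τ / 2 + 1)) =
      (Real.pi * I * τ / 4 + Real.pi * I * (-u + 1 / 2)) + -(Real.pi * I) by ring,
    Complex.exp_add _ (-(Real.pi * I)), e]
  ring

lemma theta1_zero (τ : ℂ) : theta1 τ 0 = 0 := by
  have h := theta1_neg τ 0
  rw [neg_zero] at h
  linear_combination h / 2

/-- The domain of holomorphy of the theta function. -/
def upperHalf : Set (ℂ × ℂ) := {p | 0 < p.1.im}

lemma isOpen_upperHalf : IsOpen upperHalf :=
  isOpen_lt continuous_const (Complex.continuous_im.comp continuous_fst)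

lemma differentiableOn_theta1 :
    DifferentiableOn ℂ (fun p : ℂ × ℂ => theta1 p.1 p.2) upperHalf := by
  intro p hp
  refine DifferentiableAt.differentiableWithinAt ?_
  have e : (fun p : ℂ × ℂ => theta1 p.1 p.2) = fun p : ℂ × ℂ =>
      -(cexp (Real.pi * I * p.1 / 4 + Real.pi * I * (p.2 + 1 / 2)) *
        (fun r : ℂ × ℂ => jacobiTheta₂ r.1 r.2) (p.2 + 1 / 2 + p.1 / 2, p.1)) :=
    funext fun p => theta1_eq p.1 p.2
  rw [e]
  have h1 : DifferentiableAt ℂ (fun p : ℂ × ℂ =>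
      (fun r : ℂ × ℂ => jacobiTheta₂ r.1 r.2) (p.2 + 1 / 2 + p.1 / 2, p.1)) p :=
    DifferentiableAt.comp (f := fun p : ℂ × ℂ => (p.2 + 1 / 2 + p.1 / 2, p.1)) p
      (hasFDerivAt_jacobiTheta₂ _ hp).differentiableAt (by fun_prop)
  fun_prop

/-- The iterated `u`-derivatives of the theta function. -/
def thetaD (k : ℕ) (τ u : ℂ) : ℂ := iteratedDeriv k (theta1 τ) u

lemma thetaD_zero (τ u : ℂ) : thetaD 0 τ u = theta1 τ u := by simp [thetaD]

lemma differentiableOn_thetaD (k : ℕ) :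
    DifferentiableOn ℂ (fun p : ℂ × ℂ => thetaD k p.1 p.2) upperHalf := by
  induction k with
  | zero => simpa [thetaD] using differentiableOn_theta1
  | succ k ih =>
    simp only [thetaD, iteratedDeriv_succ]
    exact differentiableOn_deriv_snd isOpen_upperHalf ih

lemma hasDerivAt_thetaD (k : ℕ) {τ : ℂ} (h : 0 < τ.im) (u : ℂ) :
    HasDerivAt (thetaD k τ) (thetaD (k + 1) τ u) u := by
  have := hasDerivAt_snd_of_differentiableOn isOpen_upperHalf (differentiableOn_thetaD k)
    (p := (τ, u)) h
  rw [show thetaD (k + 1) τ u = deriv (thetaD k τ) u by simp only [thetaD, iteratedDeriv_succ]; rfl]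
  exact this.differentiableAt.hasDerivAt

lemma hasDerivAt_theta1 {τ : ℂ} (h : 0 < τ.im) (u : ℂ) :
    HasDerivAt (theta1 τ) (thetaD 1 τ u) u := by
  have := hasDerivAt_thetaD 0 h u
  simpa only [show thetaD 0 τ = theta1 τ from funext (thetaD_zero τ)] using this

/-- The heat equation term by term: two z-derivatives contribute (2πin)², one τ-derivative πin², and
the ratio is 4πi. The series may be differentiated termwise on a strip |Im w| < S. -/
lemma hasDerivAt_jacobiTheta₂' (z : ℂ) {τ : ℂ} (hτ : 0 < τ.im) :
    HasDerivAt (fun w => jacobiTheta₂' w τ) (4 * Real.pi * I * jacobiTheta₂_fderiv z τ (0, 1)) z := by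
  obtain ⟨S, hz⟩ := exists_gt |z.im|
  have hV : IsOpen {w : ℂ | |w.im| < S} :=
    isOpen_lt (by fun_prop) continuous_const
  have hdiff : ∀ n : ℤ, ∀ w : ℂ, HasDerivAt (fun w => jacobiTheta₂'_term n w τ)
      ((2 * Real.pi * I * n) ^ 2 * jacobiTheta₂_term n w τ) w := by
    intro n w
    unfold jacobiTheta₂'_term jacobiTheta₂_term
    have h1 : HasDerivAt (fun w : ℂ => 2 * Real.pi * I * n * w + Real.pi * I * n ^ 2 * τ)
        (2 * Real.pi * I * n) w := by
      simpa using ((hasDerivAt_id w).const_mul (2 * Real.pi * I * n)).add_const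
        (Real.pi * I * n ^ 2 * τ)
    exact ((h1.cexp).const_mul (2 * Real.pi * I * n)).congr_deriv (by ring)
  have hu : Summable fun n : ℤ =>
      2 * Real.pi * |n| * Real.exp (-Real.pi * (τ.im * n ^ 2 - 2 * S * |n|)) := by
    simpa only [mul_assoc, pow_one]
      using (summable_pow_mul_jacobiTheta₂_term_bound S hτ 1).mul_left (2 * Real.pi)
  have hle : ∀ (n : ℤ) (w : ℂ), w ∈ {w : ℂ | |w.im| < S} → ‖jacobiTheta₂'_term n w τ‖ ≤
      2 * Real.pi * |n| * Real.exp (-Real.pi * (τ.im * n ^ 2 - 2 * S * |n|)) :=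
    fun n w hw => norm_jacobiTheta₂'_term_le hτ (le_of_lt hw) le_rfl n
  have hdo : ∀ n : ℤ, DifferentiableOn ℂ (fun w => jacobiTheta₂'_term n w τ) {w : ℂ | |w.im| < S} :=
    fun n w _ => (hdiff n w).differentiableAt.differentiableWithinAt
  have key := Complex.hasSum_deriv_of_summable_norm hu hdo hV hle hz
  have hd : DifferentiableAt ℂ (fun w => ∑' n : ℤ, jacobiTheta₂'_term n w τ) z :=
    (Complex.differentiableOn_tsum_of_summable_norm hu hdo hV hle).differentiableAt
      (hV.mem_nhds hz)
  let ev : (ℂ × ℂ →L[ℂ] ℂ) →L[ℂ] ℂ :=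
  { toFun := fun f => f (0, 1)
    map_add' := by simp
    map_smul' := by simp }
  have h2 : HasSum (fun n : ℤ => jacobiTheta₂_term_fderiv n z τ (0, 1))
      (jacobiTheta₂_fderiv z τ (0, 1)) := by
    apply ev.hasSum (hasSum_jacobiTheta₂_term_fderiv z hτ)
  have h3 := h2.mul_left (4 * Real.pi * I)
  have e : (fun n : ℤ => deriv (fun w => jacobiTheta₂'_term n w τ) z) =
      fun n : ℤ => 4 * Real.pi * I * jacobiTheta₂_term_fderiv n z τ (0, 1) := by
    funext n
    rw [(hdiff n z).deriv]
    simp [jacobiTheta₂_term_fderiv, jacobiTheta₂_term]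
    ring
  rw [e] at key
  have h4 := hd.hasDerivAt
  rw [key.unique h3] at h4
  exact h4

/-- The heat equation `4πi ∂θ₁/∂τ = ∂²θ₁/∂u²`. -/
lemma hasDerivAt_theta1_tau {τ : ℂ} (h : 0 < τ.im) (u : ℂ) :
    HasDerivAt (fun t => theta1 t u) (thetaD 2 τ u / (4 * Real.pi * I)) τ := by
  set E : ℂ → ℂ → ℂ := fun t w => cexp (Real.pi * I * t / 4 + Real.pi * I * (w + 1 / 2)) with hE
  set z := u + 1 / 2 + τ / 2 with hz
  set J := jacobiTheta₂ z τ with hJ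
  set J1 := jacobiTheta₂' z τ with hJ1
  set Jt := jacobiTheta₂_fderiv z τ (0, 1) with hJt
  have hpi : (Real.pi : ℂ) ≠ 0 := by exact_mod_cast Real.pi_ne_zero
  have hEt : HasDerivAt (fun t => E t u) (E τ u * (Real.pi * I / 4)) τ := by
    have h1 : HasDerivAt (fun t : ℂ => Real.pi * I * t / 4 + Real.pi * I * (u + 1 / 2))
        (Real.pi * I / 4) τ := by
      simpa using (((hasDerivAt_id τ).const_mul (Real.pi * I : ℂ)).div_const 4).add_const
        (Real.pi * I * (u + 1 / 2))
    exact h1.cexp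
  have hEu : ∀ w, HasDerivAt (fun w => E τ w) (E τ w * (Real.pi * I)) w := by
    intro w
    have h1 : HasDerivAt (fun w : ℂ => Real.pi * I * τ / 4 + Real.pi * I * (w + 1 / 2))
        (Real.pi * I) w := by
      simpa using (((hasDerivAt_id w).add_const (1 / 2 : ℂ)).const_mul (Real.pi * I : ℂ)).const_add
        (Real.pi * I * τ / 4)
    exact h1.cexp
  have hshift : ∀ w, HasDerivAt (fun w : ℂ => w + 1 / 2 + τ / 2) 1 w := fun w =>
    ((hasDerivAt_id w).add_const _).add_const _
  have hJu : ∀ w, HasDerivAt (fun w => jacobiTheta₂ (w + 1 / 2 + τ / 2) τ)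
      (jacobiTheta₂' (w + 1 / 2 + τ / 2) τ) w := fun w => by
    have := (hasDerivAt_jacobiTheta₂_fst (w + 1 / 2 + τ / 2) h).comp w (hshift w)
    rwa [mul_one] at this
  have hJuu : HasDerivAt (fun w => jacobiTheta₂' (w + 1 / 2 + τ / 2) τ)
      (4 * Real.pi * I * Jt) u := by
    have := (hasDerivAt_jacobiTheta₂' z h).comp u (hshift u)
    rwa [mul_one] at this
  -- The variable τ enters twice, through the shift τ/2 of the argument and as the modular
  -- parameter; the shift produces the term J1 / 2.
  have hJτ : HasDerivAt (fun t => jacobiTheta₂ (u + 1 / 2 + t / 2) t) (J1 / 2 + Jt) τ := by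
    have h1 : HasDerivAt (fun t : ℂ => (u + 1 / 2 + t / 2, t)) ((1 / 2 : ℂ), (1 : ℂ)) τ :=
      (((hasDerivAt_id τ).div_const 2).const_add _).prodMk (hasDerivAt_id τ)
    have h2 := HasFDerivAt.comp_hasDerivAt (f := fun t : ℂ => (u + 1 / 2 + t / 2, t)) τ
      (hasFDerivAt_jacobiTheta₂ z h) h1
    have h3 : jacobiTheta₂_fderiv z τ (1, 0) = J1 := by
      have h4 := (hasFDerivAt_jacobiTheta₂ z h).comp_hasDerivAt z
        ((hasDerivAt_id z).prodMk (hasDerivAt_const z τ))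
      exact h4.unique (hasDerivAt_jacobiTheta₂_fst z h)
    have e : ((1 / 2 : ℂ), (1 : ℂ)) = (1 / 2 : ℂ) • ((1 : ℂ), (0 : ℂ)) + ((0 : ℂ), (1 : ℂ)) := by
      simp
    rw [e, map_add, map_smul, h3, smul_eq_mul] at h2
    exact h2.congr_deriv (by ring)
  have hθ1 : ∀ w, thetaD 1 τ w = -(E τ w * (Real.pi * I) * jacobiTheta₂ (w + 1 / 2 + τ / 2) τ +
      E τ w * jacobiTheta₂' (w + 1 / 2 + τ / 2) τ) := fun w => by
    refine (hasDerivAt_theta1 h w).unique ?_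
    rw [show theta1 τ = fun w => -(E τ w * jacobiTheta₂ (w + 1 / 2 + τ / 2) τ) from
      funext fun w => theta1_eq τ w]
    exact ((hEu w).mul (hJu w)).neg
  have hθ2 : thetaD 2 τ u = -(E τ u * (Real.pi * I) * (Real.pi * I) * J + E τ u * (Real.pi * I) * J1 +
      (E τ u * (Real.pi * I) * J1 + E τ u * (4 * Real.pi * I * Jt))) := by
    refine (hasDerivAt_thetaD 1 h u).unique ?_
    rw [show thetaD 1 τ = _ from funext hθ1]
    exact ((((hEu u).mul_const _).mul (hJu u)).add ((hEu u).mul hJuu)).neg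
  rw [show (fun t => theta1 t u) = fun t => -(E t u * jacobiTheta₂ (u + 1 / 2 + t / 2) t) from
    funext fun t => theta1_eq t u]
  refine (hEt.mul hJτ).neg.congr_deriv ?_
  rw [hθ2, ← hz, ← hJ]
  field_simp
  ring

end Theta

/-! ### The product ∏ (1 - aⁿw). -/

section InfiniteProduct

/-- The infinite product `∏ (1 - a ^ n w)`. -/
def qProd (a w : ℂ) : ℂ := ∏' n : ℕ, (1 + -(a ^ n * w))

variable {a : ℂ}

lemma summable_norm_qProd (ha : ‖a‖ < 1) (w : ℂ) : Summable fun n : ℕ => ‖-(a ^ n * w)‖ := by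
  simpa using (summable_geometric_of_lt_one (norm_nonneg a) ha).mul_right ‖w‖

lemma qProd_ne_zero (ha : ‖a‖ < 1) {w : ℂ} (hw : ∀ n : ℕ, a ^ n * w ≠ 1) : qProd a w ≠ 0 := by
  refine tprod_one_add_ne_zero_of_summable (fun n h => hw n ?_) (summable_norm_qProd ha w)
  linear_combination -h

/-- Splitting off the first factor. This is the source of both the quasi-periodicity under τ and the
simple zero of `thetaProd` at 0. -/
lemma qProd_eq (ha : ‖a‖ < 1) (w : ℂ) : qProd a w = (1 - w) * qProd a (a * w) := by
  have e : (fun n : ℕ => 1 + -(a ^ n * (a * w))) = fun n : ℕ => 1 + -(a ^ (n + 1) * w) := by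
    funext n; ring
  have hm : Multipliable fun n : ℕ => 1 + -(a ^ (n + 1) * w) := by
    rw [← e]
    exact multipliable_one_add_of_summable (summable_norm_qProd ha (a * w))
  have key : ∏' n : ℕ, (1 + -(a ^ n * w)) =
      (1 + -(a ^ 0 * w)) * ∏' n : ℕ, (1 + -(a ^ (n + 1) * w)) :=
    tprod_eq_zero_mul' (f := fun n : ℕ => 1 + -(a ^ n * w)) hm
  unfold qProd
  rw [e, key, pow_zero, one_mul, sub_eq_add_neg]

lemma differentiable_qProd (ha : ‖a‖ < 1) : Differentiable ℂ (qProd a) := by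
  intro w
  have hu : Summable fun n : ℕ => ‖a‖ ^ n * (‖w‖ + 1) :=
    (summable_geometric_of_lt_one (norm_nonneg a) ha).mul_right _
  have hp := hu.hasProdLocallyUniformlyOn_nat_one_add (K := Metric.ball 0 (‖w‖ + 1))
    (f := fun n v => -(a ^ n * v)) Metric.isOpen_ball
    (Eventually.of_forall fun n v hv => by
      rw [mem_ball_zero_iff] at hv
      rw [norm_neg, norm_mul, norm_pow]
      gcongr)
    (fun n => by fun_prop)
  have hd : DifferentiableOn ℂ (qProd a) (Metric.ball 0 (‖w‖ + 1)) :=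
    hp.differentiableOn (.of_forall fun _ => by
      simpa [Finset.prod_fn] using DifferentiableOn.finsetProd (fun _ _ => by fun_prop))
      Metric.isOpen_ball
  exact hd.differentiableAt (Metric.isOpen_ball.mem_nhds (by simp))

end InfiniteProduct

/-! ### The zeros of θ₁ via the triple product up to a constant. -/

section ThetaZeros

variable {τ : ℂ}

lemma norm_exp_tau_lt_one (h : 0 < τ.im) : ‖cexp (2 * Real.pi * I * τ)‖ < 1 := by
  rw [Complex.norm_exp, Real.exp_lt_one_iff]
  simp
  positivity

lemma exp_eq_one_mem_periods {u : ℂ} {n : ℤ}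
    (h : cexp (2 * Real.pi * I * (n * τ + u)) = 1) : u ∈ periods τ := by
  obtain ⟨m, hm⟩ := Complex.exp_eq_one_iff.1 h
  refine ⟨m, -n, ?_⟩
  have h2 : 2 * Real.pi * I * (n * τ + u - m) = 0 := by linear_combination hm
  have h3 := (mul_eq_zero.1 h2).resolve_left Complex.two_pi_I_ne_zero
  push_cast
  linear_combination h3

/-- The product side of the Jacobi triple product. -/
def thetaProd (τ u : ℂ) : ℂ :=
  cexp (-(Real.pi * I * u)) * qProd (cexp (2 * Real.pi * I * τ)) (cexp (2 * Real.pi * I * u)) *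
    qProd (cexp (2 * Real.pi * I * τ)) (cexp (2 * Real.pi * I * (τ - u)))

/-- An absolutely convergent product vanishes only if a factor does, which here means that nτ + u or
(n+1)τ - u is an integer for some n ≥ 0. -/
lemma thetaProd_ne_zero (h : 0 < τ.im) {u : ℂ} (hu : u ∉ periods τ) : thetaProd τ u ≠ 0 := by
  refine mul_ne_zero (mul_ne_zero (Complex.exp_ne_zero _) ?_) ?_
  · refine qProd_ne_zero (norm_exp_tau_lt_one h) fun n hn => hu ?_
    rw [← Complex.exp_nat_mul, ← Complex.exp_add] at hn
    refine exp_eq_one_mem_periods (n := n) ?_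
    rw [← hn]
    push_cast; ring_nf
  · refine qProd_ne_zero (norm_exp_tau_lt_one h) fun n hn => hu (neg_mem_periods_iff.1 ?_)
    rw [← Complex.exp_nat_mul, ← Complex.exp_add] at hn
    refine exp_eq_one_mem_periods (n := n + 1) ?_
    rw [← hn]
    push_cast; ring_nf

lemma differentiable_thetaProd (h : 0 < τ.im) : Differentiable ℂ (thetaProd τ) := by
  have hd := differentiable_qProd (norm_exp_tau_lt_one h)
  have h1 : Differentiable ℂ fun u =>
      qProd (cexp (2 * Real.pi * I * τ)) (cexp (2 * Real.pi * I * u)) :=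
    hd.comp (by fun_prop)
  have h2 : Differentiable ℂ fun u =>
      qProd (cexp (2 * Real.pi * I * τ)) (cexp (2 * Real.pi * I * (τ - u))) :=
    hd.comp (by fun_prop)
  unfold thetaProd
  fun_prop

lemma thetaProd_add_one (u : ℂ) : thetaProd τ (u + 1) = -thetaProd τ u := by
  have e1 : cexp (-(Real.pi * I * (u + 1))) = -cexp (-(Real.pi * I * u)) := by
    rw [mul_add, neg_add, Complex.exp_add, mul_one, Complex.exp_neg (Real.pi * I),
      Complex.exp_pi_mul_I]
    norm_num
  have e2 : cexp (2 * Real.pi * I * (u + 1)) = cexp (2 * Real.pi * I * u) := by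
    rw [mul_add, mul_one, Complex.exp_add, Complex.exp_two_pi_mul_I, mul_one]
  have e3 : cexp (2 * Real.pi * I * (τ - (u + 1))) = cexp (2 * Real.pi * I * (τ - u)) := by
    rw [show 2 * Real.pi * I * (τ - u) = 2 * Real.pi * I * (τ - (u + 1)) + 2 * Real.pi * I by ring,
      Complex.exp_add, Complex.exp_two_pi_mul_I, mul_one]
  rw [thetaProd, e1, e2, e3, thetaProd]
  ring

lemma thetaProd_add_tau (h : 0 < τ.im) (u : ℂ) : thetaProd τ (u + τ) =
    -(cexp (-(Real.pi * I * τ) - 2 * Real.pi * I * u) * thetaProd τ u) := by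
  have ha := norm_exp_tau_lt_one h
  have e1 : cexp (-(Real.pi * I * (u + τ))) =
      cexp (-(Real.pi * I * τ)) * cexp (-(Real.pi * I * u)) := by
    rw [← Complex.exp_add]; ring_nf
  have e2 : cexp (2 * Real.pi * I * (u + τ)) =
      cexp (2 * Real.pi * I * τ) * cexp (2 * Real.pi * I * u) := by
    rw [← Complex.exp_add]; ring_nf
  have e3 : cexp (2 * Real.pi * I * (τ - u)) =
      cexp (2 * Real.pi * I * τ) * cexp (-(2 * Real.pi * I * u)) := by
    rw [← Complex.exp_add]; ring_nf
  have e5 : cexp (2 * Real.pi * I * u) * cexp (-(2 * Real.pi * I * u)) = 1 := by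
    rw [← Complex.exp_add]; simp
  rw [thetaProd, thetaProd, e1, e2, e3, show τ - (u + τ) = -u by ring, mul_neg (2 * Real.pi * I),
    qProd_eq ha (cexp (2 * Real.pi * I * u)), qProd_eq ha (cexp (-(2 * Real.pi * I * u))),
    sub_eq_add_neg (-(Real.pi * I * τ)), Complex.exp_add (-(Real.pi * I * τ))]
  linear_combination cexp (-(Real.pi * I * τ)) * cexp (-(Real.pi * I * u)) *
    qProd (cexp (2 * Real.pi * I * τ)) (cexp (2 * Real.pi * I * τ) * cexp (2 * Real.pi * I * u)) *
    qProd (cexp (2 * Real.pi * I * τ)) (cexp (2 * Real.pi * I * τ) * cexp (-(2 * Real.pi * I * u)))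
    * (-1) * e5

/-- The zero at 0 comes from the single factor 1 - e^{2πiu}; what remains is continuous and nonzero
there. The limit bounds θ₁ / `thetaProd` near 0 and later shows θ₁'(0) ≠ 0. -/
lemma tendsto_thetaProd_div (h : 0 < τ.im) :
    ∃ b ≠ 0, Tendsto (fun u => u⁻¹ * thetaProd τ u) (𝓝[≠] 0) (𝓝 b) := by
  have ha := norm_exp_tau_lt_one h
  have hnz : qProd (cexp (2 * Real.pi * I * τ)) (cexp (2 * Real.pi * I * τ)) ≠ 0 := by
    refine qProd_ne_zero ha fun n hn => ?_
    rw [← pow_succ] at hn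
    have := pow_lt_one₀ (norm_nonneg _) ha (Nat.succ_ne_zero n)
    rw [← norm_pow, hn] at this
    simp at this
  have hd := differentiable_qProd ha
  set B : ℂ → ℂ := fun u => cexp (-(Real.pi * I * u)) *
    qProd (cexp (2 * Real.pi * I * τ)) (cexp (2 * Real.pi * I * τ) * cexp (2 * Real.pi * I * u)) *
    qProd (cexp (2 * Real.pi * I * τ)) (cexp (2 * Real.pi * I * (τ - u))) with hB
  have hBc : Continuous B := by
    have h1 := hd.continuous
    fun_prop
  have hs : HasDerivAt (fun u : ℂ => 1 - cexp (2 * Real.pi * I * u)) (-(2 * Real.pi * I)) 0 := by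
    have h1 : HasDerivAt (fun u : ℂ => 2 * Real.pi * I * u) (2 * Real.pi * I) 0 := by
      simpa using (hasDerivAt_id (0 : ℂ)).const_mul (2 * Real.pi * I)
    simpa using h1.cexp.const_sub 1
  refine ⟨-(2 * Real.pi * I) * B 0, mul_ne_zero (neg_ne_zero.2 Complex.two_pi_I_ne_zero) ?_, ?_⟩
  · simp [hB, hnz]
  · refine (hs.tendsto_slope_zero.mul (hBc.continuousAt.tendsto.mono_left
      nhdsWithin_le_nhds)).congr fun u => ?_
    simp only [hB, thetaProd, zero_add, mul_zero, Complex.exp_zero, sub_self, sub_zero, smul_eq_mul]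
    rw [qProd_eq ha (cexp (2 * Real.pi * I * u))]
    ring

/-- Only the non-vanishing of the multiplier is recorded: it is enough to move the zero at 0 to all
lattice points. -/
lemma exists_theta1_add (τ : ℂ) {l : ℂ} (hl : l ∈ periods τ) (u : ℂ) :
    ∃ e : ℂ, e ≠ 0 ∧ theta1 τ (u + l) = e * theta1 τ u := by
  have step1 : ∀ m : ℤ, ∀ u, ∃ e : ℂ, e ≠ 0 ∧ theta1 τ (u + m) = e * theta1 τ u := by
    intro m
    induction m using Int.induction_on with
    | zero => exact fun u => ⟨1, one_ne_zero, by simp⟩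
    | succ m ih =>
      intro u
      obtain ⟨e, he, h⟩ := ih u
      refine ⟨-e, neg_ne_zero.2 he, ?_⟩
      push_cast at h ⊢
      rw [← add_assoc, theta1_add_one, h]
      ring
    | pred m ih =>
      intro u
      obtain ⟨e, he, h⟩ := ih u
      refine ⟨-e, neg_ne_zero.2 he, ?_⟩
      have := theta1_add_one τ (u + ((-(m : ℤ) - 1 : ℤ) : ℂ))
      push_cast at h this ⊢
      rw [show u + (-(m : ℂ) - 1) + 1 = u + -(m : ℂ) by ring, h] at this
      linear_combination this
  have step2 : ∀ n : ℤ, ∀ u, ∃ e : ℂ, e ≠ 0 ∧ theta1 τ (u + n * τ) = e * theta1 τ u := by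
    intro n
    induction n using Int.induction_on with
    | zero => exact fun u => ⟨1, one_ne_zero, by simp⟩
    | succ n ih =>
      intro u
      obtain ⟨e, he, h⟩ := ih u
      refine ⟨-cexp (-(Real.pi * I * τ) - 2 * Real.pi * I * (u + ((n : ℤ) : ℂ) * τ)) * e,
        mul_ne_zero (neg_ne_zero.2 (Complex.exp_ne_zero _)) he, ?_⟩
      have := theta1_add_tau τ (u + ((n : ℤ) : ℂ) * τ)
      rw [h] at this
      push_cast at this ⊢
      rw [show u + ((n : ℂ) + 1) * τ = u + n * τ + τ by ring, this]
      ring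
    | pred n ih =>
      intro u
      obtain ⟨e, he, h⟩ := ih u
      have := theta1_add_tau τ (u + ((-(n : ℤ) - 1 : ℤ) : ℂ) * τ)
      push_cast at h this ⊢
      rw [show u + (-(n : ℂ) - 1) * τ + τ = u + -(n : ℂ) * τ by ring, h] at this
      refine ⟨-(cexp (-(Real.pi * I * τ) - 2 * Real.pi * I * (u + (-(n : ℂ) - 1) * τ)))⁻¹ * e,
        mul_ne_zero (neg_ne_zero.2 (inv_ne_zero (Complex.exp_ne_zero _))) he, ?_⟩
      have hne := Complex.exp_ne_zero (-(Real.pi * I * τ) - 2 * Real.pi * I * (u + (-(n : ℂ) - 1) * τ))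
      rw [neg_mul, neg_mul, mul_assoc, this, mul_neg, neg_neg, inv_mul_cancel_left₀ hne]
  obtain ⟨m, n, rfl⟩ := hl
  obtain ⟨e, he, h⟩ := step1 m u
  obtain ⟨e', he', h'⟩ := step2 n (u + m)
  exact ⟨e' * e, mul_ne_zero he' he, by rw [← add_assoc, h', h]; ring⟩

lemma theta1_eq_zero_of_mem (τ : ℂ) {l : ℂ} (hl : l ∈ periods τ) : theta1 τ l = 0 := by
  obtain ⟨e, _, h⟩ := exists_theta1_add τ hl 0
  simpa [theta1_zero] using h

/-- The zeroth Fourier coefficient on [0,1] is 1. This excludes the constant 0 in the comparison of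
θ₁ with the product. -/
lemma exists_jacobiTheta₂_ne_zero (h : 0 < τ.im) : ∃ z, jacobiTheta₂ z τ ≠ 0 := by
  by_contra! hz
  let f : ℤ → C(ℝ, ℂ) := fun n => ⟨fun x : ℝ => jacobiTheta₂_term n x τ, by
    unfold jacobiTheta₂_term; fun_prop⟩
  have hsum : Summable fun n : ℤ =>
      ‖(f n).restrict (⟨Set.uIcc (0 : ℝ) 1, isCompact_uIcc⟩ : TopologicalSpace.Compacts ℝ)‖ := by
    have hb := summable_pow_mul_jacobiTheta₂_term_bound 0 h 0
    simp only [pow_zero, one_mul] at hb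
    refine hb.of_nonneg_of_le (fun n => norm_nonneg _) fun n => ?_
    refine (ContinuousMap.norm_le _ (Real.exp_pos _).le).2 fun x => ?_
    exact norm_jacobiTheta₂_term_le h (by simp) le_rfl n
  have key := intervalIntegral.hasSum_intervalIntegral_of_summable_norm hsum
  have h0 : (∫ x in (0 : ℝ)..1, ∑' n, f n x) = 0 := by
    have : ∀ x : ℝ, ∑' n, f n x = 0 := fun x => hz x
    simp [this]
  have hn : ∀ n : ℤ, n ≠ 0 → (∫ x in (0 : ℝ)..1, f n x) = 0 := by
    intro n hn
    have hc : 2 * Real.pi * I * (n : ℂ) ≠ 0 :=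
      mul_ne_zero Complex.two_pi_I_ne_zero (by exact_mod_cast hn)
    have e : ∀ x : ℝ, f n x = cexp (2 * Real.pi * I * n * x) * cexp (Real.pi * I * n ^ 2 * τ) :=
      fun x => by simp only [f, jacobiTheta₂_term, ContinuousMap.coe_mk, Complex.exp_add]
    simp_rw [e]
    rw [intervalIntegral.integral_mul_const, integral_exp_mul_complex hc]
    have : cexp (2 * Real.pi * I * n * (1 : ℝ)) = 1 := by
      rw [Complex.exp_eq_one_iff]; exact ⟨n, by push_cast; ring⟩
    rw [this]
    simp
  have h1 : (∫ x in (0 : ℝ)..1, f 0 x) = 1 := by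
    simp [f, jacobiTheta₂_term]
  rw [h0] at key
  have h2 := hasSum_single (f := fun n => ∫ x in (0 : ℝ)..1, f n x) 0 hn
  have h3 := key.unique h2
  rw [h1] at h3
  exact zero_ne_one h3

lemma exists_theta1_ne_zero (h : 0 < τ.im) : ∃ u ∉ periods τ, theta1 τ u ≠ 0 := by
  obtain ⟨z, hz⟩ := exists_jacobiTheta₂_ne_zero h
  have h1 : theta1 τ (z - 1 / 2 - τ / 2) ≠ 0 := by
    rw [theta1_eq, show z - 1 / 2 - τ / 2 + 1 / 2 + τ / 2 = z by ring]
    exact neg_ne_zero.2 (mul_ne_zero (Complex.exp_ne_zero _) hz)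
  exact ⟨_, fun hm => h1 (theta1_eq_zero_of_mem τ hm), h1⟩

/-- The triple product identity up to a constant. -/
lemma exists_theta1_eq_mul_thetaProd (h : 0 < τ.im) :
    ∃ c ≠ 0, ∀ u ∉ periods τ, theta1 τ u = c * thetaProd τ u := by
  have hθ : HasDerivAt (theta1 τ) (thetaD 1 τ 0) 0 := hasDerivAt_theta1 h 0
  obtain ⟨b, hb, hlim⟩ := tendsto_thetaProd_div h
  have hlim2 : Tendsto (fun u => theta1 τ u / thetaProd τ u) (𝓝[≠] 0) (𝓝 (thetaD 1 τ 0 / b)) := by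
    refine (hθ.tendsto_slope_zero.div hlim hb).congr' ?_
    filter_upwards [self_mem_nhdsWithin] with u hu
    have hu' : u ≠ 0 := hu
    simp only [zero_add, theta1_zero, sub_zero, smul_eq_mul, Pi.div_apply]
    field_simp
  obtain ⟨c, hc⟩ := exists_eq_const_of_doublyPeriodic h (f := fun u => theta1 τ u / thetaProd τ u)
    (fun u hu => (hasDerivAt_theta1 h u).differentiableAt.div (differentiable_thetaProd h u)
      (thetaProd_ne_zero h hu))
    (fun u _ => by rw [theta1_add_one, thetaProd_add_one, neg_div_neg_eq])
    (fun u _ => by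
      rw [theta1_add_tau, thetaProd_add_tau h, neg_div_neg_eq,
        mul_div_mul_left _ _ (Complex.exp_ne_zero _)])
    ⟨‖thetaD 1 τ 0 / b‖ + 1, (hlim2.norm.eventually_lt_const (by linarith)).mono fun _ => le_of_lt⟩
  have hc' : ∀ u ∉ periods τ, theta1 τ u = c * thetaProd τ u := fun u hu =>
    (div_eq_iff (thetaProd_ne_zero h hu)).1 (hc u hu)
  refine ⟨c, ?_, hc'⟩
  rintro rfl
  obtain ⟨u, hu, hne⟩ := exists_theta1_ne_zero h
  exact hne (by simpa using hc' u hu)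

/-- The zeros of the theta function are exactly the lattice points. -/
lemma theta1_eq_zero_iff (h : 0 < τ.im) {u : ℂ} : theta1 τ u = 0 ↔ u ∈ periods τ := by
  refine ⟨fun hu => ?_, theta1_eq_zero_of_mem τ⟩
  by_contra hm
  obtain ⟨c, hc, hcu⟩ := exists_theta1_eq_mul_thetaProd h
  exact mul_ne_zero hc (thetaProd_ne_zero h hm) ((hcu u hm).symm.trans hu)

lemma theta1_ne_zero (h : 0 < τ.im) {u : ℂ} (hu : u ∉ periods τ) : theta1 τ u ≠ 0 :=
  fun h0 => hu ((theta1_eq_zero_iff h).1 h0)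

lemma thetaD_one_zero_ne_zero (h : 0 < τ.im) : thetaD 1 τ 0 ≠ 0 := by
  obtain ⟨c, hc, hcu⟩ := exists_theta1_eq_mul_thetaProd h
  obtain ⟨b, hb, hlim⟩ := tendsto_thetaProd_div h
  have h1 := (hasDerivAt_theta1 h 0).tendsto_slope_zero
  have h2 : Tendsto (fun t => t⁻¹ • (theta1 τ (0 + t) - theta1 τ 0)) (𝓝[≠] 0) (𝓝 (c * b)) := by
    refine (hlim.const_mul c).congr' ?_
    filter_upwards [eventually_ne_notMem_periods h 0] with u hu
    rw [zero_add, theta1_zero, sub_zero, smul_eq_mul, hcu u hu]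
    ring
  rw [tendsto_nhds_unique h1 h2]
  exact mul_ne_zero hc hb

end ThetaZeros

/-! ### ℘ in terms of θ₁. -/

section Weierstrass

variable {τ : ℂ}

lemma wp_eq (h : 0 < τ.im) (u : ℂ) : wp τ u = (latticePair h).weierstrassP u := by
  rw [wp, dif_pos h]; rfl

lemma wp_neg (h : 0 < τ.im) (u : ℂ) : wp τ (-u) = wp τ u := by
  rw [wp_eq h, wp_eq h, PeriodPair.weierstrassP_neg]

lemma wp_add_of_mem (h : 0 < τ.im) {l : ℂ} (hl : l ∈ periods τ) (u : ℂ) :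
    wp τ (u + l) = wp τ u := by
  rw [wp_eq h, wp_eq h]
  exact (latticePair h).weierstrassP_add_coe u ⟨l, (mem_periods_iff h).1 hl⟩

lemma differentiableAt_wp (h : 0 < τ.im) {u : ℂ} (hu : u ∉ periods τ) :
    DifferentiableAt ℂ (wp τ) u := by
  rw [show wp τ = (latticePair h).weierstrassP from funext (wp_eq h)]
  exact (latticePair h).differentiableOn_weierstrassP.differentiableAt
    ((latticePair h).isClosed_lattice.isOpen_compl.mem_nhds fun hm => hu ((mem_periods_iff h).2 hm))

/-- The principal part of ℘ at 0. The vanishing of the regular part at 0 pins down the additive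
constant in `wp_eq_theta`. -/
lemma exists_wp_eq_add (h : 0 < τ.im) :
    ∃ E : ℂ → ℂ, E 0 = 0 ∧ ContinuousAt E 0 ∧ ∀ u, wp τ u = E u + 1 / u ^ 2 := by
  refine ⟨(latticePair h).weierstrassPExcept 0, (latticePair h).weierstrassPExcept_zero 0,
    ((latticePair h).analyticAt_weierstrassPExcept 0).continuousAt, fun u => ?_⟩
  have := (latticePair h).weierstrassPExcept_add 0 u
  rw [wp_eq h, ← this]
  simp

lemma differentiable_dslope {f : ℂ → ℂ} (hf : Differentiable ℂ f) (c : ℂ) :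
    Differentiable ℂ (dslope f c) := by
  rw [← differentiableOn_univ] at hf ⊢
  exact (differentiableOn_dslope univ_mem).2 hf

/-- An even entire function vanishing at `0` is divisible by `u ^ 2`. -/
lemma exists_eq_sq_mul_of_even {n : ℂ → ℂ} (hn : Differentiable ℂ n) (he : ∀ u, n (-u) = n u)
    (h0 : n 0 = 0) : ∃ g : ℂ → ℂ, Differentiable ℂ g ∧ ∀ u, n u = u ^ 2 * g u := by
  refine ⟨dslope (dslope n 0) 0, differentiable_dslope (differentiable_dslope hn 0) 0, fun u => ?_⟩
  have h1 : ∀ u, n u = u * dslope n 0 u := fun u => by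
    simpa [h0] using (sub_smul_dslope n 0 u).symm
  have hd : deriv n 0 = 0 := by
    have h2 : deriv (fun u => n (-u)) 0 = -deriv n (-0) := deriv_comp_neg n 0
    rw [funext he, neg_zero] at h2
    linear_combination h2 / 2
  have h2 : ∀ u, dslope n 0 u = u * dslope (dslope n 0) 0 u := fun u => by
    have := (sub_smul_dslope (dslope n 0) 0 u).symm
    rw [dslope_same, hd] at this
    simpa using this
  rw [h1, h2]
  ring

lemma differentiable_theta1 (h : 0 < τ.im) : Differentiable ℂ (theta1 τ) :=
  fun u => (hasDerivAt_theta1 h u).differentiableAt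

lemma deriv_theta1 (h : 0 < τ.im) (u : ℂ) : deriv (theta1 τ) u = thetaD 1 τ u :=
  (hasDerivAt_theta1 h u).deriv

lemma thetaD_neg (k : ℕ) (τ u : ℂ) : thetaD k τ (-u) = (-1) ^ (k + 1) * thetaD k τ u := by
  have h1 := iteratedDeriv_comp_neg k (theta1 τ) u
  have h2 : (fun v => theta1 τ (-v)) = fun v => -theta1 τ v := funext (theta1_neg τ)
  rw [h2, iteratedDeriv_fun_neg, smul_eq_mul] at h1
  have h3 : ((-1 : ℂ) ^ k) * (-1) ^ k = 1 := by rw [← mul_pow]; simp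
  simp only [thetaD]
  rw [pow_succ]
  linear_combination (-iteratedDeriv k (theta1 τ) (-u)) * h3 - (-1) ^ k * h1

lemma thetaD_two_zero (τ : ℂ) : thetaD 2 τ 0 = 0 := by
  have := thetaD_neg 2 τ 0
  rw [neg_zero] at this
  linear_combination this / 2

/-- The quotient `θ₁(u) / u`. -/
lemma exists_theta1_eq_mul (h : 0 < τ.im) : ∃ A : ℂ → ℂ, Differentiable ℂ A ∧
    (∀ u, theta1 τ u = u * A u) ∧ A 0 = thetaD 1 τ 0 ∧ (∀ u, A (-u) = A u) := by
  have hA : ∀ u, theta1 τ u = u * dslope (theta1 τ) 0 u := fun u => by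
    simpa [theta1_zero] using (sub_smul_dslope (theta1 τ) 0 u).symm
  refine ⟨dslope (theta1 τ) 0, differentiable_dslope (differentiable_theta1 h) 0, hA,
    by rw [dslope_same, deriv_theta1 h], fun u => ?_⟩
  by_cases hu : u = 0
  · simp [hu]
  · have h1 := hA (-u)
    rw [theta1_neg, hA u] at h1
    exact (mul_left_cancel₀ hu (by linear_combination -h1)).symm

/-- The addition formula `θ₁(u - v) θ₁(u + v) θ₁'(0)² = -(℘(u) - ℘(v)) θ₁(u)² θ₁(v)²`. -/
lemma theta1_sub_mul_theta1_add (h : 0 < τ.im) {u v : ℂ} (hu : u ∉ periods τ)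
    (hv : v ∉ periods τ) : theta1 τ (u - v) * theta1 τ (u + v) * thetaD 1 τ 0 ^ 2 =
      -((wp τ u - wp τ v) * theta1 τ u ^ 2 * theta1 τ v ^ 2) := by
  have hD := thetaD_one_zero_ne_zero h
  have hθd := differentiable_theta1 h
  obtain ⟨A, hAd, hA, hA0, hAe⟩ := exists_theta1_eq_mul h
  obtain ⟨E, hE0, hEc, hE⟩ := exists_wp_eq_add h
  -- Near u = 0 the quotient θ₁(u-v)θ₁(u+v)/θ₁(u)² behaves like -k/u², so adding k℘(u) removes the
  -- double pole. The combined numerator n below is even and vanishes at 0, which also excludes a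
  -- simple pole.
  set k := theta1 τ v ^ 2 / thetaD 1 τ 0 ^ 2 with hk
  obtain ⟨g, hgd, hg⟩ := exists_eq_sq_mul_of_even
    (n := fun u => theta1 τ (u - v) * theta1 τ (u + v) + k * A u ^ 2)
    (by fun_prop)
    (fun u => by
      rw [show -u - v = -(u + v) by ring, show -u + v = -(u - v) by ring, theta1_neg, theta1_neg, hAe]
      ring)
    (by
      rw [zero_sub, zero_add, theta1_neg, hA0, hk]
      field_simp
      ring)
  have hlim : Tendsto (fun u => g u / A u ^ 2 + k * E u) (𝓝[≠] 0)
      (𝓝 (g 0 / A 0 ^ 2 + k * E 0)) := by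
    refine Tendsto.mono_left ?_ nhdsWithin_le_nhds
    have h1 : ContinuousAt (fun u => g u / A u ^ 2) 0 :=
      hgd.continuous.continuousAt.div (hAd.continuous.continuousAt.pow 2)
        (by rw [hA0]; exact pow_ne_zero 2 hD)
    exact h1.add (continuousAt_const.mul hEc)
  have hlim2 : Tendsto (fun u => theta1 τ (u - v) * theta1 τ (u + v) / theta1 τ u ^ 2 + k * wp τ u)
      (𝓝[≠] 0) (𝓝 (g 0 / A 0 ^ 2 + k * E 0)) := by
    refine hlim.congr' ?_
    filter_upwards [eventually_ne_notMem_periods h 0] with u hu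
    have hu0 : u ≠ 0 := fun h0 => hu (h0 ▸ zero_mem_periods)
    have hAu : A u ≠ 0 := fun h0 => theta1_ne_zero h hu (by rw [hA, h0, mul_zero])
    have := hg u
    rw [hE, hA u]
    field_simp
    linear_combination -this
  obtain ⟨c, hc⟩ := exists_eq_const_of_doublyPeriodic h
    (f := fun u => theta1 τ (u - v) * theta1 τ (u + v) / theta1 τ u ^ 2 + k * wp τ u)
    (fun u hu => by
      have h1 := differentiableAt_wp h hu
      have h2 : theta1 τ u ^ 2 ≠ 0 := pow_ne_zero 2 (theta1_ne_zero h hu)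
      have h3 : DifferentiableAt ℂ (fun u => theta1 τ (u - v) * theta1 τ (u + v)) u := by fun_prop
      have h4 : DifferentiableAt ℂ (fun u => theta1 τ u ^ 2) u := by fun_prop
      exact (h3.div h4 h2).add (h1.const_mul k))
    (fun u _ => by
      rw [wp_add_of_mem h one_mem_periods, show u + 1 - v = u - v + 1 by ring,
        show u + 1 + v = u + v + 1 by ring, theta1_add_one, theta1_add_one, theta1_add_one]
      ring)
    (fun u _ => by
      rw [wp_add_of_mem h tau_mem_periods, show u + τ - v = u - v + τ by ring,
        show u + τ + v = u + v + τ by ring, theta1_add_tau, theta1_add_tau, theta1_add_tau]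
      have e : cexp (-(Real.pi * I * τ) - 2 * Real.pi * I * (u - v)) *
          cexp (-(Real.pi * I * τ) - 2 * Real.pi * I * (u + v)) =
          cexp (-(Real.pi * I * τ) - 2 * Real.pi * I * u) ^ 2 := by
        rw [← Complex.exp_add, ← Complex.exp_nat_mul]
        push_cast; ring_nf
      rw [neg_mul_neg, mul_mul_mul_comm, e, neg_sq, mul_pow, mul_div_mul_left _ _
        (pow_ne_zero 2 (Complex.exp_ne_zero _))])
    ⟨‖g 0 / A 0 ^ 2 + k * E 0‖ + 1,
      (hlim2.norm.eventually_lt_const (by linarith)).mono fun _ => le_of_lt⟩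
  have e1 := hc u hu
  -- Evaluating at u = v, where the theta quotient vanishes, identifies the constant as k℘(v).
  have e2 := hc v hv
  rw [sub_self, theta1_zero, zero_mul, zero_div, zero_add] at e2
  have hθu := theta1_ne_zero h hu
  rw [← e2, hk] at e1
  field_simp at e1
  linear_combination e1

lemma thetaD_one_add_one (h : 0 < τ.im) (u : ℂ) : thetaD 1 τ (u + 1) = -thetaD 1 τ u := by
  have h1 : HasDerivAt (fun u => theta1 τ (u + 1)) (thetaD 1 τ (u + 1)) u :=
    (hasDerivAt_theta1 h (u + 1)).comp_add_const u 1
  rw [funext (theta1_add_one τ)] at h1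
  exact h1.unique (hasDerivAt_theta1 h u).neg

lemma thetaD_one_add_tau (h : 0 < τ.im) (u : ℂ) : thetaD 1 τ (u + τ) =
    -(cexp (-(Real.pi * I * τ) - 2 * Real.pi * I * u) *
      (thetaD 1 τ u - 2 * Real.pi * I * theta1 τ u)) := by
  have h1 : HasDerivAt (fun u => theta1 τ (u + τ)) (thetaD 1 τ (u + τ)) u :=
    (hasDerivAt_theta1 h (u + τ)).comp_add_const u τ
  rw [funext (theta1_add_tau τ)] at h1
  have h2 : HasDerivAt (fun u : ℂ => -(Real.pi * I * τ) - 2 * Real.pi * I * u)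
      (-(2 * Real.pi * I)) u := by
    simpa using ((hasDerivAt_id u).const_mul (2 * Real.pi * I : ℂ)).const_sub
      (-(Real.pi * I * τ : ℂ))
  rw [h1.unique (h2.cexp.mul (hasDerivAt_theta1 h u)).neg]
  ring

/-- `℘` as the second logarithmic derivative of the theta function. -/
lemma wp_eq_theta (h : 0 < τ.im) {u : ℂ} (hu : u ∉ periods τ) :
    wp τ u = thetaD 3 τ 0 / (3 * thetaD 1 τ 0) -
      (thetaD 2 τ u * theta1 τ u - thetaD 1 τ u ^ 2) / theta1 τ u ^ 2 := by
  have hD := thetaD_one_zero_ne_zero h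
  obtain ⟨A, hAd, hA, hA0, hAe⟩ := exists_theta1_eq_mul h
  obtain ⟨E, hE0, hEc, hE⟩ := exists_wp_eq_add h
  have hA1d : Differentiable ℂ (deriv A) := fun u => (hAd.analyticAt u).deriv.differentiableAt
  have hA2d : Differentiable ℂ (deriv (deriv A)) :=
    fun u => (hA1d.analyticAt u).deriv.differentiableAt
  have e1 : ∀ u, thetaD 1 τ u = A u + u * deriv A u := fun u => by
    refine (hasDerivAt_theta1 h u).unique ?_
    rw [funext hA]
    exact ((hasDerivAt_id' u).mul (hAd u).hasDerivAt).congr_deriv (by simp)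
  have e2 : ∀ u, thetaD 2 τ u = deriv A u + (deriv A u + u * deriv (deriv A) u) := fun u => by
    refine (hasDerivAt_thetaD 1 h u).unique ?_
    rw [funext e1]
    exact ((hAd u).hasDerivAt.add ((hasDerivAt_id' u).mul (hA1d u).hasDerivAt)).congr_deriv (by simp)
  have e3 : thetaD 3 τ 0 = 3 * deriv (deriv A) 0 := by
    have h3 : HasDerivAt (thetaD 2 τ) (deriv (deriv A) 0 + (deriv (deriv A) 0 +
        (1 * deriv (deriv A) 0 + 0 * deriv (deriv (deriv A)) 0))) 0 := by
      rw [funext e2]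
      exact (hA1d 0).hasDerivAt.add ((hA1d 0).hasDerivAt.add
        ((hasDerivAt_id (0 : ℂ)).mul (hA2d 0).hasDerivAt))
    rw [(hasDerivAt_thetaD 2 h 0).unique h3]
    ring
  have hA1 : deriv A 0 = 0 := by
    have := e2 0
    rw [thetaD_two_zero] at this
    linear_combination -this / 2
  have hlog : ∀ u ∉ periods τ, HasDerivAt (fun u => thetaD 1 τ u / theta1 τ u)
      ((thetaD 2 τ u * theta1 τ u - thetaD 1 τ u * thetaD 1 τ u) / theta1 τ u ^ 2) u :=
    fun u hu => (hasDerivAt_thetaD 1 h u).div (hasDerivAt_theta1 h u) (theta1_ne_zero h hu)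
  -- With θ₁ = uA the pole of ℘ cancels (log u)'' = -1/u². The rest is E + (log A)'', and since
  -- A'(0) = 0 its value at 0 is A''(0)/A(0) = θ₁'''(0)/(3θ₁'(0)).
  have hlim : Tendsto (fun u => E u + (A u * deriv (deriv A) u - deriv A u ^ 2) / A u ^ 2) (𝓝[≠] 0)
      (𝓝 (thetaD 3 τ 0 / (3 * thetaD 1 τ 0))) := by
    refine Tendsto.mono_left ?_ nhdsWithin_le_nhds
    have h1 : ContinuousAt (fun u => E u + (A u * deriv (deriv A) u - deriv A u ^ 2) / A u ^ 2) 0 := by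
      refine hEc.add (ContinuousAt.div ?_ (hAd.continuous.continuousAt.pow 2)
        (by rw [hA0]; exact pow_ne_zero 2 hD))
      have := hAd.continuous
      have := hA1d.continuous
      have := hA2d.continuous
      fun_prop
    convert h1.tendsto using 2
    rw [hE0, hA1, e3, hA0]
    field_simp
    ring
  have hlim2 : Tendsto (fun u => wp τ u + deriv (fun u => thetaD 1 τ u / theta1 τ u) u) (𝓝[≠] 0)
      (𝓝 (thetaD 3 τ 0 / (3 * thetaD 1 τ 0))) := by
    refine hlim.congr' ?_
    filter_upwards [eventually_ne_notMem_periods h 0] with u hu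
    have hu0 : u ≠ 0 := fun h0 => hu (h0 ▸ zero_mem_periods)
    have hAu : A u ≠ 0 := fun h0 => theta1_ne_zero h hu (by rw [hA, h0, mul_zero])
    rw [(hlog u hu).deriv, hE, e2, e1, hA]
    field_simp
    ring
  obtain ⟨c, hc⟩ := exists_eq_const_of_doublyPeriodic h
    (f := fun u => wp τ u + deriv (fun u => thetaD 1 τ u / theta1 τ u) u)
    (fun u hu => by
      refine (differentiableAt_wp h hu).add (AnalyticAt.differentiableAt ?_)
      refine AnalyticAt.deriv ?_
      have ha : ∀ k, AnalyticAt ℂ (thetaD k τ) u := fun k =>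
        (show Differentiable ℂ (thetaD k τ) from
          fun v => (hasDerivAt_thetaD k h v).differentiableAt).analyticAt u
      exact (ha 1).div ((differentiable_theta1 h).analyticAt u) (theta1_ne_zero h hu))
    (fun u hu => by
      rw [wp_add_of_mem h one_mem_periods, ← deriv_comp_add_const]
      congr 2
      funext v
      rw [thetaD_one_add_one h, theta1_add_one, neg_div_neg_eq])
    (fun u hu => by
      rw [wp_add_of_mem h tau_mem_periods, ← deriv_comp_add_const]
      congr 1
      have hev : (fun v => thetaD 1 τ (v + τ) / theta1 τ (v + τ)) =ᶠ[𝓝 u]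
          fun v => thetaD 1 τ v / theta1 τ v - 2 * Real.pi * I := by
        filter_upwards [eventually_notMem_periods h hu] with v hv
        have := theta1_ne_zero h hv
        have hexp := Complex.exp_ne_zero (-(Real.pi * I * τ) - 2 * Real.pi * I * v)
        rw [thetaD_one_add_tau h, theta1_add_tau, neg_div_neg_eq, mul_div_mul_left _ _ hexp]
        field_simp
      rw [hev.deriv_eq, deriv_sub_const])
    ⟨‖thetaD 3 τ 0 / (3 * thetaD 1 τ 0)‖ + 1,
      (hlim2.norm.eventually_lt_const (by linarith)).mono fun _ => le_of_lt⟩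
  have hcc : c = thetaD 3 τ 0 / (3 * thetaD 1 τ 0) := by
    refine tendsto_nhds_unique (Tendsto.congr' ?_ tendsto_const_nhds) hlim2
    filter_upwards [eventually_ne_notMem_periods h 0] with u hu
    exact (hc u hu).symm
  have := hc u hu
  rw [(hlog u hu).deriv, hcc] at this
  rw [← this]
  ring

end Weierstrass

/-! ### The three-term identity and its derivatives. -/

section ThetaIdentities

variable {τ : ℂ}

/-- The complement of the lattice is dense, so identities between entire functions may be proved off
the lattice. -/
lemma eq_zero_of_forall_notMem_periods (h : 0 < τ.im) {f : ℂ → ℂ} (hf : Continuous f)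
    (h0 : ∀ u ∉ periods τ, f u = 0) (u : ℂ) : f u = 0 := by
  refine tendsto_nhds_unique (hf.continuousAt.tendsto.mono_left
    (nhdsWithin_le_nhds (s := {u}ᶜ))) (Tendsto.congr' ?_ tendsto_const_nhds)
  filter_upwards [eventually_ne_notMem_periods h u] with v hv
  exact (h0 v hv).symm

/-- The three-term identity of Weierstrass. -/
lemma theta1_three_term (h : 0 < τ.im) (a b c d : ℂ) :
    theta1 τ (a - b) * theta1 τ (a + b) * (theta1 τ (c - d) * theta1 τ (c + d)) -
      theta1 τ (a - c) * theta1 τ (a + c) * (theta1 τ (b - d) * theta1 τ (b + d)) +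
      theta1 τ (a - d) * theta1 τ (a + d) * (theta1 τ (b - c) * theta1 τ (b + c)) = 0 := by
  have hc := (differentiable_theta1 h).continuous
  refine eq_zero_of_forall_notMem_periods h (f := fun a =>
    theta1 τ (a - b) * theta1 τ (a + b) * (theta1 τ (c - d) * theta1 τ (c + d)) -
      theta1 τ (a - c) * theta1 τ (a + c) * (theta1 τ (b - d) * theta1 τ (b + d)) +
      theta1 τ (a - d) * theta1 τ (a + d) * (theta1 τ (b - c) * theta1 τ (b + c)))
    (by fun_prop) (fun a ha => ?_) a
  refine eq_zero_of_forall_notMem_periods h (f := fun b =>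
    theta1 τ (a - b) * theta1 τ (a + b) * (theta1 τ (c - d) * theta1 τ (c + d)) -
      theta1 τ (a - c) * theta1 τ (a + c) * (theta1 τ (b - d) * theta1 τ (b + d)) +
      theta1 τ (a - d) * theta1 τ (a + d) * (theta1 τ (b - c) * theta1 τ (b + c)))
    (by fun_prop) (fun b hb => ?_) b
  refine eq_zero_of_forall_notMem_periods h (f := fun c =>
    theta1 τ (a - b) * theta1 τ (a + b) * (theta1 τ (c - d) * theta1 τ (c + d)) -
      theta1 τ (a - c) * theta1 τ (a + c) * (theta1 τ (b - d) * theta1 τ (b + d)) +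
      theta1 τ (a - d) * theta1 τ (a + d) * (theta1 τ (b - c) * theta1 τ (b + c)))
    (by fun_prop) (fun c hc' => ?_) c
  refine eq_zero_of_forall_notMem_periods h (f := fun d =>
    theta1 τ (a - b) * theta1 τ (a + b) * (theta1 τ (c - d) * theta1 τ (c + d)) -
      theta1 τ (a - c) * theta1 τ (a + c) * (theta1 τ (b - d) * theta1 τ (b + d)) +
      theta1 τ (a - d) * theta1 τ (a + d) * (theta1 τ (b - c) * theta1 τ (b + c)))
    (by fun_prop) (fun d hd => ?_) d
  have hD : thetaD 1 τ 0 ^ 2 ≠ 0 := pow_ne_zero 2 (thetaD_one_zero_ne_zero h)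
  -- With each pair θ₁(u-v)θ₁(u+v) written through ℘, the identity reduces to (A-B)(C-D) -
  -- (A-C)(B-D) + (A-D)(B-C) = 0 for the four values of ℘.
  have key : ∀ {u v : ℂ}, u ∉ periods τ → v ∉ periods τ → theta1 τ (u - v) * theta1 τ (u + v) =
      -((wp τ u - wp τ v) * theta1 τ u ^ 2 * theta1 τ v ^ 2) / thetaD 1 τ 0 ^ 2 := fun hu hv => by
    rw [eq_div_iff hD, theta1_sub_mul_theta1_add h hu hv]
  simp only [key ha hb, key hc' hd, key ha hc', key hb hd, key ha hd, key hb hc']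
  ring

/-- The addition formula for the logarithmic derivative of the theta function. -/
lemma thetaD_addition (h : 0 < τ.im) (x y w : ℂ) :
    thetaD 1 τ x * theta1 τ y * theta1 τ w * theta1 τ (x + y + w) +
      theta1 τ x * thetaD 1 τ y * theta1 τ w * theta1 τ (x + y + w) +
      theta1 τ x * theta1 τ y * thetaD 1 τ w * theta1 τ (x + y + w) -
      theta1 τ x * theta1 τ y * theta1 τ w * thetaD 1 τ (x + y + w) =
    thetaD 1 τ 0 * theta1 τ (x + y) * theta1 τ (y + w) * theta1 τ (w + x) := by
  set a := (x - w) / 2 with ha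
  set c := (x + w) / 2 with hc
  set b := y + c with hb
  have hm : ∀ k v : ℂ, HasDerivAt (fun d => theta1 τ (k - d)) (-thetaD 1 τ (k - v)) v := fun k v =>
    (hasDerivAt_theta1 h (k - v)).comp_const_sub k v
  have hp : ∀ k v : ℂ, HasDerivAt (fun d => theta1 τ (k + d)) (thetaD 1 τ (k + v)) v := fun k v =>
    (hasDerivAt_theta1 h (k + v)).comp_const_add k v
  -- The three-term identity is differentiated in d at d = c. There θ₁(c-d) vanishes, so the first
  -- term contributes only through θ₁'(0).
  have h1 := ((((hm c c).mul (hp c c)).const_mul (theta1 τ (a - b) * theta1 τ (a + b))).sub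
    (((hm b c).mul (hp b c)).const_mul (theta1 τ (a - c) * theta1 τ (a + c)))).add
    (((hm a c).mul (hp a c)).mul_const (theta1 τ (b - c) * theta1 τ (b + c)))
  have h2 := h1.unique ((hasDerivAt_const c (0 : ℂ)).congr_of_eventuallyEq
    (Eventually.of_forall fun d => theta1_three_term h a b c d))
  simp only [sub_self, theta1_zero] at h2
  have e1 : a - c = -w := by rw [ha, hc]; ring
  have e2 : a + c = x := by rw [ha, hc]; ring
  have e3 : b - c = y := by rw [hb]; ring
  have e4 : b + c = x + y + w := by rw [hb, hc]; ring
  have e5 : a - b = -(y + w) := by rw [ha, hb, hc]; ring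
  have e6 : a + b = x + y := by rw [ha, hb, hc]; ring
  have e7 : c + c = w + x := by rw [hc]; ring
  rw [e1, e2, e3, e4, e5, e6, e7, theta1_neg, theta1_neg, thetaD_neg 1 τ w] at h2
  linear_combination -h2

/-- The degenerate addition formula
`(ρ(x) + ρ(y) - ρ(x + y))² = -ρ'(x) - ρ'(y) - ρ'(x + y) + θ₁'''(0) / θ₁'(0)`, `ρ = θ₁' / θ₁`. -/
lemma thetaD_addition_degenerate (h : 0 < τ.im) (x y : ℂ) :
    2 * thetaD 1 τ 0 * (thetaD 1 τ x * theta1 τ y + theta1 τ x * thetaD 1 τ y) * thetaD 1 τ (x + y) +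
      theta1 τ x * theta1 τ y *
        (thetaD 3 τ 0 * theta1 τ (x + y) - thetaD 1 τ 0 * thetaD 2 τ (x + y)) =
    thetaD 1 τ 0 * theta1 τ (x + y) * (thetaD 2 τ y * theta1 τ x +
      2 * thetaD 1 τ x * thetaD 1 τ y + theta1 τ y * thetaD 2 τ x) := by
  have hq : ∀ (n : ℕ) (k v : ℂ),
      HasDerivAt (fun w => thetaD n τ (k + w)) (thetaD (n + 1) τ (k + v)) v :=
    fun n k v => (hasDerivAt_thetaD n h (k + v)).comp_const_add k v
  set K := thetaD 1 τ x * theta1 τ y + theta1 τ x * thetaD 1 τ y with hK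
  set N := theta1 τ x * theta1 τ y with hN
  set R := thetaD 1 τ 0 * theta1 τ (x + y) with hR
  -- The addition formula is read as a function of w near 0. Its terms of order 0 and 1 are trivial;
  -- the second derivative at w = 0 is the claim.
  have hf : ∀ w : ℂ, K * (thetaD 0 τ (0 + w) * thetaD 0 τ (x + y + w)) +
      N * (thetaD 1 τ (0 + w) * thetaD 0 τ (x + y + w) - thetaD 0 τ (0 + w) * thetaD 1 τ (x + y + w)) -
      R * (thetaD 0 τ (y + w) * thetaD 0 τ (x + w)) = 0 := fun w => by
    have := thetaD_addition h x y w
    rw [add_comm w x] at this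
    simp only [thetaD_zero, zero_add, hK, hN, hR]
    linear_combination this
  have hd1 : ∀ v : ℂ, K * (thetaD 1 τ (0 + v) * thetaD 0 τ (x + y + v) +
        thetaD 0 τ (0 + v) * thetaD 1 τ (x + y + v)) +
      N * ((thetaD 2 τ (0 + v) * thetaD 0 τ (x + y + v) + thetaD 1 τ (0 + v) * thetaD 1 τ (x + y + v)) -
        (thetaD 1 τ (0 + v) * thetaD 1 τ (x + y + v) + thetaD 0 τ (0 + v) * thetaD 2 τ (x + y + v))) -
      R * (thetaD 1 τ (y + v) * thetaD 0 τ (x + v) + thetaD 0 τ (y + v) * thetaD 1 τ (x + v)) = 0 :=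
    fun v => by
    have h1 := ((((hq 0 0 v).mul (hq 0 (x + y) v)).const_mul K).add
      ((((hq 1 0 v).mul (hq 0 (x + y) v)).sub ((hq 0 0 v).mul (hq 1 (x + y) v))).const_mul N)).sub
      (((hq 0 y v).mul (hq 0 x v)).const_mul R)
    exact h1.unique ((hasDerivAt_const v (0 : ℂ)).congr_of_eventuallyEq (Eventually.of_forall hf))
  have h2 := ((((hq 1 0 0).mul (hq 0 (x + y) 0)).add ((hq 0 0 0).mul (hq 1 (x + y) 0))).const_mul K).add
      (((((hq 2 0 0).mul (hq 0 (x + y) 0)).add ((hq 1 0 0).mul (hq 1 (x + y) 0))).sub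
        (((hq 1 0 0).mul (hq 1 (x + y) 0)).add ((hq 0 0 0).mul (hq 2 (x + y) 0)))).const_mul N) |>.sub
      ((((hq 1 y 0).mul (hq 0 x 0)).add ((hq 0 y 0).mul (hq 1 x 0))).const_mul R)
  have h3 := h2.unique ((hasDerivAt_const 0 (0 : ℂ)).congr_of_eventuallyEq (Eventually.of_forall hd1))
  simp only [add_zero, zero_add, thetaD_zero, theta1_zero, Nat.reduceAdd, thetaD_two_zero] at h3
  linear_combination h3

end ThetaIdentities

/-! ### Functional equations and the heat equation for x and y. -/

section Kernels

variable {τ : ℂ}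

lemma xker_eq (h : 0 < τ.im) (u z : ℂ) :
    xker τ u z = theta1 τ (z - u) * thetaD 1 τ 0 / (theta1 τ z * theta1 τ u) := by
  rw [xker, deriv_theta1 h]

/-- The formula for `y(u, z)` in terms of theta functions. -/
lemma hasDerivAt_xker_left (h : 0 < τ.im) {u : ℂ} (hu : u ∉ periods τ) (z : ℂ) :
    HasDerivAt (fun v => xker τ v z)
      (-(thetaD 1 τ 0 * (thetaD 1 τ (z - u) * theta1 τ u + theta1 τ (z - u) * thetaD 1 τ u)) /
        (theta1 τ z * theta1 τ u ^ 2)) u := by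
  have hθ := theta1_ne_zero h hu
  rw [funext fun v => xker_eq h v z]
  -- At a lattice point z division by zero makes x(·,z) identically 0 and the claimed derivative 0
  -- too. Hence the formula, and with it the translation rules, needs no condition on z.
  by_cases hz : theta1 τ z = 0
  · simpa [hz] using hasDerivAt_const u (0 : ℂ)
  have hm : HasDerivAt (fun v => theta1 τ (z - v)) (-thetaD 1 τ (z - u)) u :=
    (hasDerivAt_theta1 h (z - u)).comp_const_sub z u
  refine ((hm.mul_const (thetaD 1 τ 0)).div ((hasDerivAt_theta1 h u).const_mul (theta1 τ z))
    (mul_ne_zero hz hθ)).congr_deriv ?_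
  field_simp
  ring

lemma yker_eq (h : 0 < τ.im) {u : ℂ} (hu : u ∉ periods τ) (z : ℂ) : yker τ u z =
    -(thetaD 1 τ 0 * (thetaD 1 τ (z - u) * theta1 τ u + theta1 τ (z - u) * thetaD 1 τ u)) /
      (theta1 τ z * theta1 τ u ^ 2) :=
  (hasDerivAt_xker_left h hu z).deriv

lemma hasDerivAt_xker (h : 0 < τ.im) {u : ℂ} (hu : u ∉ periods τ) (z : ℂ) :
    HasDerivAt (fun v => xker τ v z) (yker τ u z) u := by
  rw [yker_eq h hu]
  exact hasDerivAt_xker_left h hu z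

/-- `x(u,z) y(v,z) - y(u,z) x(v,z) = x(u+v,z) (℘(u) - ℘(v))`. -/
lemma xker_yker_sub (h : 0 < τ.im) {u v z : ℂ} (hu : u ∉ periods τ) (hv : v ∉ periods τ)
    (huv : u + v ∉ periods τ) (hz : z ∉ periods τ) :
    xker τ u z * yker τ v z - yker τ u z * xker τ v z =
      xker τ (u + v) z * (wp τ u - wp τ v) := by
  -- The arguments u, z-u, -v have sum z-v and pairwise sums z, z-(u+v), u-v: the theta values that
  -- remain once ℘(u) - ℘(v) is factored.
  have h1 := thetaD_addition h u (z - u) (-v)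
  rw [show u + (z - u) + -v = z - v by ring, show u + (z - u) = z by ring,
    show z - u + -v = z - (u + v) by ring, show -v + u = u - v by ring, theta1_neg,
    thetaD_neg] at h1
  have h2 := theta1_sub_mul_theta1_add h hu hv
  have := theta1_ne_zero h hu
  have := theta1_ne_zero h hv
  have := theta1_ne_zero h huv
  have := theta1_ne_zero h hz
  have h3 : wp τ u - wp τ v = -(theta1 τ (u - v) * theta1 τ (u + v) * thetaD 1 τ 0 ^ 2) /
      (theta1 τ u ^ 2 * theta1 τ v ^ 2) := by
    rw [h2]; field_simp
  rw [h3, yker_eq h hu, yker_eq h hv, xker_eq h, xker_eq h, xker_eq h]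
  field_simp
  linear_combination (-thetaD 1 τ 0 ^ 2) * h1

/-- `x(u,z) x(-u,z) = ℘(z) - ℘(u)`. -/
lemma xker_mul_xker_neg (h : 0 < τ.im) {u z : ℂ} (hu : u ∉ periods τ) (hz : z ∉ periods τ) :
    xker τ u z * xker τ (-u) z = wp τ z - wp τ u := by
  have h2 := theta1_sub_mul_theta1_add h hz hu
  have := theta1_ne_zero h hu
  have := theta1_ne_zero h hz
  rw [xker_eq h, xker_eq h, theta1_neg, sub_neg_eq_add]
  field_simp
  linear_combination -h2

/-- `x(u,z) y(-u,z) - y(u,z) x(-u,z) = ℘'(u)`. -/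
lemma xker_yker_neg_sub (h : 0 < τ.im) {u z : ℂ} (hu : u ∉ periods τ) (hz : z ∉ periods τ) :
    xker τ u z * yker τ (-u) z - yker τ u z * xker τ (-u) z = deriv (wp τ) u := by
  have hn : -u ∉ periods τ := fun hm => hu (neg_mem_periods_iff.1 hm)
  have h1 : HasDerivAt (fun v => xker τ (-v) z) (-yker τ (-u) z) u := by
    exact ((hasDerivAt_xker h hn z).scomp u (hasDerivAt_neg u)).congr_deriv (by simp)
  -- The claim is, up to sign, the derivative of x(v,z) x(-v,z) = ℘(z) - ℘(v) at v = u.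
  have h2 := (hasDerivAt_xker h hu z).mul h1
  have h3 : HasDerivAt (fun v => wp τ z - wp τ v) (-deriv (wp τ) u) u :=
    (differentiableAt_wp h hu).hasDerivAt.const_sub _
  have h4 := h2.unique (h3.congr_of_eventuallyEq (by
    filter_upwards [eventually_notMem_periods h hu] with v hv
    exact xker_mul_xker_neg h hv hz))
  linear_combination -h4

/-- `x(u,2z) x(v-u,z) + x(v,2z) x(u-v,z) = x(u,z) x(v,z)`. -/
lemma xker_two_mul (h : 0 < τ.im) {u v z : ℂ} (hu : u ∉ periods τ) (hv : v ∉ periods τ)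
    (huv : u - v ∉ periods τ) (hz : 2 * z ∉ periods τ) :
    xker τ u (2 * z) * xker τ (v - u) z + xker τ v (2 * z) * xker τ (u - v) z =
      xker τ u z * xker τ v z := by
  have hz1 : z ∉ periods τ := fun hm => hz (by rw [two_mul]; exact add_mem_periods hm hm)
  -- The parameters solve for the half sums and differences that make the twelve theta arguments
  -- those of the six kernels.
  have h1 := theta1_three_term h ((3 * z - u) / 2) ((z - u) / 2) ((z + u) / 2) ((z + u) / 2 - v)
  rw [show (3 * z - u) / 2 - (z - u) / 2 = z by ring,
    show (3 * z - u) / 2 + (z - u) / 2 = 2 * z - u by ring,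
    show (z + u) / 2 - ((z + u) / 2 - v) = v by ring,
    show (z + u) / 2 + ((z + u) / 2 - v) = z - (v - u) by ring,
    show (3 * z - u) / 2 - (z + u) / 2 = z - u by ring,
    show (3 * z - u) / 2 + (z + u) / 2 = 2 * z by ring,
    show (z - u) / 2 - ((z + u) / 2 - v) = -(u - v) by ring,
    show (z - u) / 2 + ((z + u) / 2 - v) = z - v by ring,
    show (3 * z - u) / 2 - ((z + u) / 2 - v) = z - (u - v) by ring,
    show (3 * z - u) / 2 + ((z + u) / 2 - v) = 2 * z - v by ring,
    show (z - u) / 2 - (z + u) / 2 = -u by ring,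
    show (z - u) / 2 + (z + u) / 2 = z by ring, theta1_neg, theta1_neg] at h1
  have := theta1_ne_zero h hu
  have := theta1_ne_zero h hv
  have := theta1_ne_zero h huv
  have := theta1_ne_zero h hz
  have := theta1_ne_zero h hz1
  rw [xker_eq h, xker_eq h, xker_eq h, xker_eq h, xker_eq h, xker_eq h,
    show theta1 τ (v - u) = -theta1 τ (u - v) by rw [← theta1_neg, neg_sub]]
  field_simp
  linear_combination (-thetaD 1 τ 0 ^ 2) * h1

/-- The functional equation that couples the kernels at `z` and `2z`. -/
lemma xker_yker_two_mul (h : 0 < τ.im) {u v z : ℂ} (hu : u ∉ periods τ) (hv : v ∉ periods τ)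
    (huv : u - v ∉ periods τ) (hz : 2 * z ∉ periods τ) :
    xker τ v z * yker τ u z - yker τ v z * xker τ u z +
      (2 * xker τ u (2 * z) * yker τ (v - u) z - yker τ u (2 * z) * xker τ (v - u) z) +
      (xker τ (u - v) z * yker τ v (2 * z) - 2 * yker τ (u - v) z * xker τ v (2 * z)) = 0 := by
  have hvu : v - u ∉ periods τ := fun hm => huv (sub_mem_periods_comm.1 hm)
  have d1 : HasDerivAt (fun w => xker τ (v - w) z) (-yker τ (v - u) z) u :=
    (hasDerivAt_xker h hvu z).comp_const_sub v u
  have d2 : HasDerivAt (fun w => xker τ (w - v) z) (yker τ (u - v) z) u :=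
    (hasDerivAt_xker h huv z).comp_sub_const u v
  have d3 : HasDerivAt (fun w => xker τ (u - w) z) (-yker τ (u - v) z) v :=
    (hasDerivAt_xker h huv z).comp_const_sub u v
  have d4 : HasDerivAt (fun w => xker τ (w - u) z) (yker τ (v - u) z) v :=
    (hasDerivAt_xker h hvu z).comp_sub_const v u
  have ev1 : ∀ᶠ w in 𝓝 u, w ∉ periods τ ∧ w - v ∉ periods τ :=
    (eventually_notMem_periods h hu).and
      ((by fun_prop : Continuous fun w => w - v).continuousAt.eventually
        (eventually_notMem_periods h huv))
  have ev2 : ∀ᶠ w in 𝓝 v, w ∉ periods τ ∧ u - w ∉ periods τ :=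
    (eventually_notMem_periods h hv).and
      ((by fun_prop : Continuous fun w => u - w).continuousAt.eventually
        (eventually_notMem_periods h huv))
  -- The claim is the v-derivative minus the u-derivative of `xker_two_mul`; the arguments ±(u-v)
  -- make both derivatives hit the same factor, whence the coefficients 2.
  have e1 := (((hasDerivAt_xker h hu (2 * z)).mul d1).add (d2.const_mul (xker τ v (2 * z)))).unique
    (((hasDerivAt_xker h hu z).mul_const (xker τ v z)).congr_of_eventuallyEq
      (by filter_upwards [ev1] with w hw; exact xker_two_mul h hw.1 hv hw.2 hz))
  have e2 := ((d4.const_mul (xker τ u (2 * z))).add ((hasDerivAt_xker h hv (2 * z)).mul d3)).unique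
    (((hasDerivAt_xker h hv z).const_mul (xker τ u z)).congr_of_eventuallyEq
      (by filter_upwards [ev2] with w hw; exact xker_two_mul h hu hw.1 hw.2 hz))
  linear_combination e2 - e1

lemma xker_add_one (h : 0 < τ.im) (u z : ℂ) : xker τ u (z + 1) = xker τ u z := by
  rw [xker_eq h, xker_eq h, show z + 1 - u = z - u + 1 by ring, theta1_add_one, theta1_add_one,
    neg_mul, neg_mul, neg_div_neg_eq]

lemma xker_add_tau (h : 0 < τ.im) (u z : ℂ) :
    xker τ u (z + τ) = cexp (2 * Real.pi * I * u) * xker τ u z := by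
  rw [xker_eq h, xker_eq h, show z + τ - u = z - u + τ by ring, theta1_add_tau, theta1_add_tau,
    show -(Real.pi * I * τ) - 2 * Real.pi * I * (z - u) =
      (-(Real.pi * I * τ) - 2 * Real.pi * I * z) + 2 * Real.pi * I * u by ring, Complex.exp_add]
  have := Complex.exp_ne_zero (-(Real.pi * I * τ) - 2 * Real.pi * I * z)
  rw [neg_mul, neg_mul, neg_div_neg_eq, mul_assoc (cexp (-(Real.pi * I * τ) - 2 * Real.pi * I * z)),
    mul_assoc (cexp (-(Real.pi * I * τ) - 2 * Real.pi * I * z)), mul_assoc (cexp (-(Real.pi * I * τ) - 2 * Real.pi * I * z)),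
    mul_div_mul_left _ _ this]
  ring

lemma yker_add_one (h : 0 < τ.im) (u z : ℂ) : yker τ u (z + 1) = yker τ u z := by
  simp only [yker, xker_add_one h]

lemma yker_add_tau (h : 0 < τ.im) {u : ℂ} (hu : u ∉ periods τ) (z : ℂ) : yker τ u (z + τ) =
    cexp (2 * Real.pi * I * u) * (yker τ u z + 2 * Real.pi * I * xker τ u z) := by
  have h1 : HasDerivAt (fun u : ℂ => 2 * Real.pi * I * u) (2 * Real.pi * I) u := by
    simpa using (hasDerivAt_id u).const_mul (2 * Real.pi * I : ℂ)
  rw [yker, funext fun v => xker_add_tau h v z]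
  rw [(h1.cexp.fun_mul (hasDerivAt_xker h hu z)).deriv]
  ring

/-- The `z`-derivative of `y(u, z)`. -/
lemma hasDerivAt_yker_right (h : 0 < τ.im) {u z : ℂ} (hu : u ∉ periods τ) (hz : z ∉ periods τ) :
    HasDerivAt (fun w => yker τ u w)
      (-(thetaD 1 τ 0 * ((thetaD 2 τ (z - u) * theta1 τ u + thetaD 1 τ (z - u) * thetaD 1 τ u) *
        theta1 τ z - (thetaD 1 τ (z - u) * theta1 τ u + theta1 τ (z - u) * thetaD 1 τ u) *
        thetaD 1 τ z)) / (theta1 τ z ^ 2 * theta1 τ u ^ 2)) z := by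
  have hθ := theta1_ne_zero h hu
  have hθz := theta1_ne_zero h hz
  rw [funext fun w => yker_eq h hu w]
  have d1 : HasDerivAt (fun w => theta1 τ (w - u)) (thetaD 1 τ (z - u)) z :=
    (hasDerivAt_theta1 h (z - u)).comp_sub_const z u
  have d2 : HasDerivAt (fun w => thetaD 1 τ (w - u)) (thetaD 2 τ (z - u)) z :=
    (hasDerivAt_thetaD 1 h (z - u)).comp_sub_const z u
  refine ((((d2.mul_const (theta1 τ u)).add (d1.mul_const (thetaD 1 τ u))).const_mul
    (thetaD 1 τ 0)).neg.div ((hasDerivAt_theta1 h z).mul_const (theta1 τ u ^ 2))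
    (mul_ne_zero hθz (pow_ne_zero 2 hθ))).congr_deriv ?_
  simp only [Pi.add_apply, Pi.neg_apply]
  field_simp
  ring

/-- The u-derivative of the heat equation at 0, after interchanging ∂/∂u and ∂/∂τ. -/
lemma hasDerivAt_thetaD_one_zero_tau (h : 0 < τ.im) :
    HasDerivAt (fun t => thetaD 1 t 0) (thetaD 3 τ 0 / (4 * Real.pi * I)) τ := by
  have hd := hasDerivAt_fst_of_differentiableOn isOpen_upperHalf (differentiableOn_thetaD 1)
    (p := (τ, 0)) h
  have h1 := deriv_deriv_comm isOpen_upperHalf differentiableOn_theta1 (p := (τ, 0)) h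
  have h2 : (fun t => deriv (theta1 t) 0) =ᶠ[𝓝 τ] fun t => thetaD 1 t 0 := by
    filter_upwards [(isOpen_lt continuous_const Complex.continuous_im).mem_nhds h] with t ht
    exact deriv_theta1 ht 0
  have h3 : (fun w => deriv (fun t => theta1 t w) τ) = fun w => thetaD 2 τ w / (4 * Real.pi * I) :=
    funext fun w => (hasDerivAt_theta1_tau h w).deriv
  simp only [h3, h2.deriv_eq] at h1
  rw [((hasDerivAt_thetaD 2 h 0).div_const _).deriv] at h1
  rw [h1]
  exact hd.differentiableAt.hasDerivAt

/-- The heat equation `2πi ∂x/∂τ + ∂²x/∂u∂z = 0`. -/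
lemma hasDerivAt_xker_tau (h : 0 < τ.im) {u z : ℂ} (hu : u ∉ periods τ) (hz : z ∉ periods τ) :
    HasDerivAt (fun t => xker t u z)
      (-(deriv (fun w => yker τ u w) z) / (2 * Real.pi * I)) τ := by
  have hθ := theta1_ne_zero h hu
  have hθz := theta1_ne_zero h hz
  have hD := thetaD_one_zero_ne_zero h
  have hpi : (Real.pi : ℂ) ≠ 0 := by exact_mod_cast Real.pi_ne_zero
  rw [(hasDerivAt_yker_right h hu hz).deriv]
  have ev : (fun t => xker t u z) =ᶠ[𝓝 τ] fun t =>
      theta1 t (z - u) * thetaD 1 t 0 / (theta1 t z * theta1 t u) := by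
    filter_upwards [(isOpen_lt continuous_const Complex.continuous_im).mem_nhds h] with t ht
    exact xker_eq ht u z
  refine HasDerivAt.congr_of_eventuallyEq ?_ ev
  refine (((hasDerivAt_theta1_tau h (z - u)).mul (hasDerivAt_thetaD_one_zero_tau h)).div
    ((hasDerivAt_theta1_tau h z).mul (hasDerivAt_theta1_tau h u)) (mul_ne_zero hθz hθ)).congr_deriv ?_
  -- Once the heat equation has replaced every τ-derivative, the claim is the degenerate addition
  -- formula at (z-u, u).
  have key := thetaD_addition_degenerate h (z - u) u
  rw [sub_add_cancel] at key
  simp only [Pi.mul_apply]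
  field_simp
  linear_combination (2 : ℂ) * key

end Kernels

/-! ### Combinatorics of simply laced roots. -/

section Roots

variable {ℓ : ℕ} {Δ : Finset (EuclideanSpace ℝ (Fin ℓ))} {β γ κ : EuclideanSpace ℝ (Fin ℓ)}

lemma IsSimplyLacedRootSystem.sub_inner_smul_mem (hΔ : IsSimplyLacedRootSystem Δ) (hβ : β ∈ Δ)
    (hγ : γ ∈ Δ) : γ - (inner ℝ β γ : ℝ) • β ∈ Δ := by
  have := hΔ.reflection_mem β hβ γ hγ
  rwa [hΔ.norm_sq β hβ, mul_div_cancel_left₀ _ two_ne_zero] at this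

lemma IsSimplyLacedRootSystem.neg_mem (hΔ : IsSimplyLacedRootSystem Δ) (hβ : β ∈ Δ) : -β ∈ Δ := by
  have := hΔ.sub_inner_smul_mem hβ hβ
  rwa [hΔ.norm_sq β hβ, show β - (2 : ℝ) • β = -β by module] at this

lemma IsSimplyLacedRootSystem.sub_mem (hΔ : IsSimplyLacedRootSystem Δ) (hβ : β ∈ Δ) (hγ : γ ∈ Δ)
    (h : inner ℝ β γ = (1 : ℝ)) : β - γ ∈ Δ := by
  have := hΔ.sub_inner_smul_mem hγ hβ
  rwa [real_inner_comm, h, one_smul] at this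

lemma IsSimplyLacedRootSystem.add_mem (hΔ : IsSimplyLacedRootSystem Δ) (hβ : β ∈ Δ) (hγ : γ ∈ Δ)
    (h : inner ℝ β γ = (-1 : ℝ)) : β + γ ∈ Δ := by
  have := hΔ.sub_mem hβ (hΔ.neg_mem hγ) (by rw [inner_neg_right, h, neg_neg])
  rwa [sub_neg_eq_add] at this

lemma inner_sub_self_eq (hβ : inner ℝ β β = (2 : ℝ)) (hγ : inner ℝ γ γ = (2 : ℝ)) :
    inner ℝ (β - γ) (β - γ) = 4 - 2 * (inner ℝ β γ : ℝ) := by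
  rw [inner_sub_left, inner_sub_right, inner_sub_right, hβ, hγ, real_inner_comm β γ]
  ring

lemma eq_of_inner_eq_two (hβ : inner ℝ β β = (2 : ℝ)) (hγ : inner ℝ γ γ = (2 : ℝ))
    (h : inner ℝ β γ = (2 : ℝ)) : β = γ := by
  rw [← sub_eq_zero, ← inner_self_eq_zero (𝕜 := ℝ), inner_sub_self_eq hβ hγ, h]
  norm_num

lemma eq_neg_of_inner_eq_neg_two (hβ : inner ℝ β β = (2 : ℝ)) (hγ : inner ℝ γ γ = (2 : ℝ))
    (h : inner ℝ β γ = (-2 : ℝ)) : γ = -β :=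
  (eq_of_inner_eq_two (by rw [inner_neg_neg, hβ]) hγ (by rw [inner_neg_left, h, neg_neg])).symm

lemma IsSimplyLacedRootSystem.sub_mem_iff (hΔ : IsSimplyLacedRootSystem Δ) (hβ : β ∈ Δ)
    (hγ : γ ∈ Δ) : β - γ ∈ Δ ↔ inner ℝ β γ = (1 : ℝ) := by
  refine ⟨fun h => ?_, hΔ.sub_mem hβ hγ⟩
  have := hΔ.norm_sq _ h
  rw [inner_sub_self_eq (hΔ.norm_sq β hβ) (hΔ.norm_sq γ hγ)] at this
  linarith

/-- The possible inner products of two roots. -/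
lemma IsSimplyLacedRootSystem.inner_cases (hΔ : IsSimplyLacedRootSystem Δ) (hβ : β ∈ Δ)
    (hγ : γ ∈ Δ) : γ = β ∨ inner ℝ β γ = (1 : ℝ) ∨ inner ℝ β γ = (0 : ℝ) ∨
      inner ℝ β γ = (-1 : ℝ) ∨ γ = -β := by
  obtain ⟨k, hk⟩ := hΔ.integral β hβ γ hγ
  rw [hΔ.norm_sq β hβ, mul_div_cancel_left₀ _ two_ne_zero] at hk
  have h1 : (0 : ℝ) ≤ inner ℝ (β - γ) (β - γ) := real_inner_self_nonneg
  have h2 : (0 : ℝ) ≤ inner ℝ (β - -γ) (β - -γ) := real_inner_self_nonneg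
  rw [inner_sub_self_eq (hΔ.norm_sq β hβ) (hΔ.norm_sq γ hγ), hk] at h1
  rw [inner_sub_self_eq (hΔ.norm_sq β hβ) (by rw [inner_neg_neg, hΔ.norm_sq γ hγ]),
    inner_neg_right, hk] at h2
  have h3 : k ≤ 2 := by have : (k : ℝ) ≤ 2 := by linarith
                        exact_mod_cast this
  have h4 : -2 ≤ k := by have : (-2 : ℝ) ≤ k := by linarith
                         exact_mod_cast this
  interval_cases k
  · exact .inr <| .inr <| .inr <| .inr <|
      eq_neg_of_inner_eq_neg_two (hΔ.norm_sq β hβ) (hΔ.norm_sq γ hγ) (by rw [hk]; norm_num)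
  · exact .inr <| .inr <| .inr <| .inl (by rw [hk]; norm_num)
  · exact .inr <| .inr <| .inl (by rw [hk]; norm_num)
  · exact .inr <| .inl (by rw [hk]; norm_num)
  · exact .inl (eq_of_inner_eq_two (hΔ.norm_sq β hβ) (hΔ.norm_sq γ hγ) (by rw [hk]; norm_num)).symm

lemma IsSimplyLacedRootSystem.sum_neg (hΔ : IsSimplyLacedRootSystem Δ)
    (f : EuclideanSpace ℝ (Fin ℓ) → ℂ) : ∑ α ∈ Δ, f (-α) = ∑ α ∈ Δ, f α :=
  Finset.sum_nbij' (fun α => -α) (fun α => -α) (fun _ h => hΔ.neg_mem h) (fun _ h => hΔ.neg_mem h)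
    (fun _ _ => neg_neg _) (fun _ _ => neg_neg _) (fun _ _ => rfl)

lemma IsSimplyLacedRootSystem.sum_ite_neg (hΔ : IsSimplyLacedRootSystem Δ) (hβ : β ∈ Δ)
    (f : EuclideanSpace ℝ (Fin ℓ) → ℂ) : (∑ α ∈ Δ, if α = -β then f α else 0) = f (-β) := by
  rw [Finset.sum_ite_eq', if_pos (hΔ.neg_mem hβ)]

/-- The sum over the roots `κ` with `β · κ = 1`, split according to `γ · κ`, for `β · γ = 1`. -/
lemma IsSimplyLacedRootSystem.sum_inner_eq_one (hΔ : IsSimplyLacedRootSystem Δ) (hβ : β ∈ Δ)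
    (hγ : γ ∈ Δ) (h : inner ℝ β γ = (1 : ℝ)) (W : EuclideanSpace ℝ (Fin ℓ) → ℂ) :
    (∑ κ ∈ Δ with inner ℝ β κ = (1 : ℝ), W κ) = W γ + W (β - γ) +
      (∑ κ ∈ Δ with inner ℝ β κ = (1 : ℝ) ∧ inner ℝ κ γ = (1 : ℝ), W κ) +
      ∑ κ ∈ Δ with inner ℝ β κ = (1 : ℝ) ∧ inner ℝ κ γ = (1 : ℝ), W (β - κ) := by
  have hββ := hΔ.norm_sq β hβ
  have hγγ := hΔ.norm_sq γ hγ
  have hsub := hΔ.sub_mem hβ hγ h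
  -- The involution κ ↦ β - κ preserves β·κ = 1 and exchanges κ·γ = 1 with κ·γ = 0.
  have h1 : (∑ κ ∈ Δ with inner ℝ β κ = (1 : ℝ) ∧ inner ℝ κ γ = (1 : ℝ), W (β - κ)) =
      ∑ κ ∈ Δ with inner ℝ β κ = (1 : ℝ) ∧ inner ℝ κ γ = (0 : ℝ), W κ := by
    refine Finset.sum_nbij' (fun κ => β - κ) (fun κ => β - κ) ?_ ?_ (fun _ _ => sub_sub_cancel _ _)
      (fun _ _ => sub_sub_cancel _ _) (fun _ _ => rfl)
    · intro κ hκ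
      rw [Finset.mem_filter] at hκ ⊢
      refine ⟨hΔ.sub_mem hβ hκ.1 hκ.2.1, ?_, ?_⟩
      · rw [inner_sub_right, hββ, hκ.2.1]; norm_num
      · rw [inner_sub_left, h, hκ.2.2]; norm_num
    · intro κ hκ
      rw [Finset.mem_filter] at hκ ⊢
      refine ⟨hΔ.sub_mem hβ hκ.1 hκ.2.1, ?_, ?_⟩
      · rw [inner_sub_right, hββ, hκ.2.1]; norm_num
      · rw [inner_sub_left, h, hκ.2.2]; norm_num
  have h2 : W γ = ∑ κ ∈ Δ, if κ = γ then W κ else 0 := by rw [Finset.sum_ite_eq', if_pos hγ]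
  have h3 : W (β - γ) = ∑ κ ∈ Δ, if κ = β - γ then W κ else 0 := by
    rw [Finset.sum_ite_eq', if_pos hsub]
  rw [h1, h2, h3, Finset.sum_filter, Finset.sum_filter, Finset.sum_filter, ← Finset.sum_add_distrib,
    ← Finset.sum_add_distrib, ← Finset.sum_add_distrib]
  refine Finset.sum_congr rfl fun κ hκ => ?_
  have hne : γ ≠ β - γ := fun he => by
    have := hγγ
    nth_rewrite 1 [he] at this
    rw [inner_sub_left, h, hγγ] at this; norm_num at this
  -- Among the κ with β·κ = 1, γ·κ = 2 means κ = γ, γ·κ = -1 forces κ = β - γ because (β-γ)·κ = 2,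
  -- and γ·κ = -2 is impossible.
  rcases hΔ.inner_cases hγ hκ with rfl | hk | hk | hk | rfl
  · simp only [h, hγγ, hne, if_true, if_false, true_and]
    norm_num
  · have e1 : κ ≠ γ := by rintro rfl; rw [hγγ] at hk; norm_num at hk
    have e2 : κ ≠ β - γ := by
      rintro rfl; rw [inner_sub_right, real_inner_comm, h, hγγ] at hk; norm_num at hk
    simp [real_inner_comm γ κ, hk, e1, e2]
  · have e1 : κ ≠ γ := by rintro rfl; rw [hγγ] at hk; norm_num at hk
    have e2 : κ ≠ β - γ := by
      rintro rfl; rw [inner_sub_right, real_inner_comm, h, hγγ] at hk; norm_num at hk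
    simp [real_inner_comm γ κ, hk, e1, e2]
  · have e1 : κ ≠ γ := by rintro rfl; rw [hγγ] at hk; norm_num at hk
    have e2 : inner ℝ β κ = (1 : ℝ) ↔ κ = β - γ := by
      refine ⟨fun hb => ?_, fun he => by rw [he, inner_sub_right, hββ, h]; norm_num⟩
      exact (eq_of_inner_eq_two (hΔ.norm_sq _ hsub) (hΔ.norm_sq κ hκ)
        (by rw [inner_sub_left, hb, hk]; norm_num)).symm
    simp [real_inner_comm γ κ, hk, e1, e2]
    norm_num
  · have e1 : -γ ≠ γ := fun he => by
      have := hγγ; nth_rewrite 1 [← he] at this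
      rw [inner_neg_left, hγγ] at this; norm_num at this
    have e2 : -γ ≠ β - γ := fun he => by
      have : β = 0 := (sub_add_cancel β γ).symm.trans (by rw [← he, neg_add_cancel])
      rw [this, inner_zero_left] at hββ; norm_num at hββ
    simp only [inner_neg_right, inner_neg_left, h, hγγ, e1, e2, if_false]
    norm_num

end Roots

/-! ### The commutator identity on the root lattice. -/

section Commutator

variable {ℓ : ℕ} {Δ : Finset (EuclideanSpace ℝ (Fin ℓ))} {β γ : EuclideanSpace ℝ (Fin ℓ)}

/-- The matrix `∑ X(α) E(α) + ∑ Xh(α) E(2α)`, described by its entries. -/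
def kerMat (Δ : Finset (EuclideanSpace ℝ (Fin ℓ))) (X Xh : EuclideanSpace ℝ (Fin ℓ) → ℂ) :
    Matrix Δ Δ ℂ :=
  Matrix.of fun β γ => (if inner ℝ (β : EuclideanSpace ℝ (Fin ℓ)) γ = (1 : ℝ) then
    X ((β : EuclideanSpace ℝ (Fin ℓ)) - γ) else 0) +
    if (γ : EuclideanSpace ℝ (Fin ℓ)) = -β then Xh β else 0

/-- The difference β - γ is a root exactly when β·γ = 1. It is twice a root α only if its squared
length is 8, so β·γ = -2, γ = -β and α = β. -/
lemma IsSimplyLacedRootSystem.sum_Emat_eq (hΔ : IsSimplyLacedRootSystem Δ)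
    (X Xh : EuclideanSpace ℝ (Fin ℓ) → ℂ) :
    ∑ α ∈ Δ, X α • Emat Δ α + ∑ α ∈ Δ, Xh α • Emat Δ ((2 : ℝ) • α) = kerMat Δ X Xh := by
  ext ⟨β, hβ⟩ ⟨γ, hγ⟩
  simp only [Matrix.add_apply, Matrix.sum_apply, Matrix.smul_apply, Emat, Matrix.of_apply, kerMat,
    smul_eq_mul, mul_ite, mul_one, mul_zero]
  congr 1
  · rw [Finset.sum_ite_eq']
    simp only [hΔ.sub_mem_iff hβ hγ]
  · have h1 : ∀ α ∈ Δ, ((2 : ℝ) • α = β - γ ↔ γ = -β ∧ α = β) := fun α hα => by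
      constructor
      · intro he
        have h2 : inner ℝ ((2 : ℝ) • α) ((2 : ℝ) • α) = (8 : ℝ) := by
          rw [real_inner_smul_left, real_inner_smul_right, hΔ.norm_sq α hα]; norm_num
        rw [he, inner_sub_self_eq (hΔ.norm_sq β hβ) (hΔ.norm_sq γ hγ)] at h2
        have h3 := eq_neg_of_inner_eq_neg_two (hΔ.norm_sq β hβ) (hΔ.norm_sq γ hγ) (by linarith)
        refine ⟨h3, ?_⟩
        rw [h3, sub_neg_eq_add, ← two_smul ℝ β] at he
        exact smul_right_injective _ (two_ne_zero (α := ℝ)) he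
      · rintro ⟨rfl, rfl⟩; module
    rw [Finset.sum_congr rfl fun α hα => if_congr (h1 α hα) rfl rfl]
    by_cases hg : γ = -β
    · simp [hg, hβ]
    · simp [hg]

/-- The entries of the product of two matrices of the form `kerMat`. -/
lemma IsSimplyLacedRootSystem.kerMat_mul_kerMat_apply (hΔ : IsSimplyLacedRootSystem Δ)
    (X Xh Y Yh : EuclideanSpace ℝ (Fin ℓ) → ℂ) (β γ : Δ) :
    (kerMat Δ X Xh * kerMat Δ Y Yh) β γ =
      (∑ κ ∈ Δ with inner ℝ (β : EuclideanSpace ℝ (Fin ℓ)) κ = (1 : ℝ) ∧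
        inner ℝ κ (γ : EuclideanSpace ℝ (Fin ℓ)) = (1 : ℝ), X (β - κ) * Y (κ - γ)) +
      (if inner ℝ (β : EuclideanSpace ℝ (Fin ℓ)) γ = (-1 : ℝ) then
        X (β + γ) * Yh (-γ) + Xh β * Y (-β - γ) else 0) +
      (if (γ : EuclideanSpace ℝ (Fin ℓ)) = β then Xh β * Yh (-β) else 0) := by
  obtain ⟨β, hβ⟩ := β
  obtain ⟨γ, hγ⟩ := γ
  rw [Matrix.mul_apply]
  simp only [kerMat, Matrix.of_apply]
  rw [Finset.sum_coe_sort Δ fun κ => ((if inner ℝ β κ = (1 : ℝ) then X (β - κ) else 0) +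
    if κ = -β then Xh β else 0) * ((if inner ℝ κ γ = (1 : ℝ) then Y (κ - γ) else 0) +
    if γ = -κ then Yh κ else 0)]
  have e1 : (if inner ℝ β γ = (-1 : ℝ) then X (β + γ) * Yh (-γ) else 0) =
      ∑ κ ∈ Δ, if κ = -γ then (if inner ℝ β κ = (1 : ℝ) then X (β - κ) * Yh κ else 0) else 0 := by
    rw [hΔ.sum_ite_neg hγ fun κ => if inner ℝ β κ = (1 : ℝ) then X (β - κ) * Yh κ else 0]
    simp only [inner_neg_right, sub_neg_eq_add, neg_eq_iff_eq_neg]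
  have e2 : (if inner ℝ β γ = (-1 : ℝ) then Xh β * Y (-β - γ) else 0) =
      ∑ κ ∈ Δ, if κ = -β then (if inner ℝ κ γ = (1 : ℝ) then Xh β * Y (κ - γ) else 0) else 0 := by
    rw [hΔ.sum_ite_neg hβ fun κ => if inner ℝ κ γ = (1 : ℝ) then Xh β * Y (κ - γ) else 0]
    simp only [inner_neg_left, neg_eq_iff_eq_neg]
  have e3 : (if γ = β then Xh β * Yh (-β) else 0) =
      ∑ κ ∈ Δ, if κ = -β then (if γ = -κ then Xh β * Yh κ else 0) else 0 := by
    rw [hΔ.sum_ite_neg hβ fun κ => if γ = -κ then Xh β * Yh κ else 0]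
    simp only [neg_neg]
  have e4 : (if inner ℝ β γ = (-1 : ℝ) then X (β + γ) * Yh (-γ) + Xh β * Y (-β - γ) else 0) =
      (if inner ℝ β γ = (-1 : ℝ) then X (β + γ) * Yh (-γ) else 0) +
      (if inner ℝ β γ = (-1 : ℝ) then Xh β * Y (-β - γ) else 0) := by
    split_ifs <;> simp
  rw [e4, e1, e2, e3, Finset.sum_filter, ← Finset.sum_add_distrib, ← Finset.sum_add_distrib,
    ← Finset.sum_add_distrib]
  refine Finset.sum_congr rfl fun κ _ => ?_
  simp only [show κ = -γ ↔ γ = -κ by rw [eq_neg_iff_add_eq_zero, eq_neg_iff_add_eq_zero, add_comm]]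
  have key : ∀ (a b c d : Prop) [Decidable a] [Decidable b] [Decidable c] [Decidable d]
      (x y v w : ℂ), ((if a then x else 0) + if b then y else 0) *
      ((if c then v else 0) + if d then w else 0) = (if a ∧ c then x * v else 0) +
      ((if d then (if a then x * w else 0) else 0) + if b then (if c then y * v else 0) else 0) +
      if b then (if d then y * w else 0) else 0 := by
    intro a b c d _ _ _ _ x y v w
    by_cases a <;> by_cases b <;> by_cases c <;> by_cases d <;> simp [*] <;> ring
  exact key _ _ _ _ _ _ _ _

/-- The commutator identity behind the root type Lax pair. -/
lemma IsSimplyLacedRootSystem.kerMat_commutator (hΔ : IsSimplyLacedRootSystem Δ)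
    {X Xh Y Yh W W' : EuclideanSpace ℝ (Fin ℓ) → ℂ} (hW : ∀ α, W (-α) = W α)
    (hW' : ∀ α, W' (-α) = -W' α)
    (h1 : ∀ α ∈ Δ, ∀ β ∈ Δ, inner ℝ α β = (-1 : ℝ) →
      X α * Y β - Y α * X β = X (α + β) * (W α - W β))
    (h2 : ∀ α ∈ Δ, X α * Y (-α) - Y α * X (-α) = W' α)
    (h2h : ∀ α ∈ Δ, Xh α * Yh (-α) - Yh α * Xh (-α) = W' α)
    (h3 : ∀ α ∈ Δ, ∀ β ∈ Δ, inner ℝ α β = (1 : ℝ) →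
      X β * Y α - Y β * X α + (2 * Xh α * Y (β - α) - Yh α * X (β - α)) +
        (X (α - β) * Yh β - 2 * Y (α - β) * Xh β) = 0) :
    kerMat Δ X (fun α => 2 * Xh α) * (Matrix.diagonal (fun β : Δ => W β +
        ∑ γ ∈ Δ with inner ℝ (β : EuclideanSpace ℝ (Fin ℓ)) γ = 1, W γ) + kerMat Δ Y Yh) -
      (Matrix.diagonal (fun β : Δ => W β +
        ∑ γ ∈ Δ with inner ℝ (β : EuclideanSpace ℝ (Fin ℓ)) γ = 1, W γ) + kerMat Δ Y Yh) *
        kerMat Δ X (fun α => 2 * Xh α) =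
      Matrix.diagonal fun β : Δ => 1 / 2 * ∑ α ∈ Δ, W' α *
        ((inner ℝ α (β : EuclideanSpace ℝ (Fin ℓ)) : ℝ) : ℂ) := by
  ext ⟨β, hβ⟩ ⟨γ, hγ⟩
  have hββ := hΔ.norm_sq β hβ
  have hγγ := hΔ.norm_sq γ hγ
  set A : EuclideanSpace ℝ (Fin ℓ) → ℂ := fun β => ∑ γ ∈ Δ with inner ℝ β γ = (1 : ℝ), W γ with hA
  rw [mul_add, add_mul, Matrix.sub_apply, Matrix.add_apply, Matrix.add_apply, Matrix.mul_diagonal,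
    Matrix.diagonal_mul, hΔ.kerMat_mul_kerMat_apply, hΔ.kerMat_mul_kerMat_apply]
  change kerMat Δ X (fun α => 2 * Xh α) ⟨β, hβ⟩ ⟨γ, hγ⟩ * (W γ + A γ) + _ -
    ((W β + A β) * kerMat Δ X (fun α => 2 * Xh α) ⟨β, hβ⟩ ⟨γ, hγ⟩ + _) = _
  have hS : (∑ κ ∈ Δ with inner ℝ β κ = (1 : ℝ) ∧ inner ℝ κ γ = (1 : ℝ), X (β - κ) * Y (κ - γ)) -
      (∑ κ ∈ Δ with inner ℝ β κ = (1 : ℝ) ∧ inner ℝ κ γ = (1 : ℝ), Y (β - κ) * X (κ - γ)) =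
      ∑ κ ∈ Δ with inner ℝ β κ = (1 : ℝ) ∧ inner ℝ κ γ = (1 : ℝ),
        (X (β - κ) * Y (κ - γ) - Y (β - κ) * X (κ - γ)) := (Finset.sum_sub_distrib _ _).symm
  have hne : β ≠ -β := fun he => by
    have := hββ; nth_rewrite 1 [he] at this
    rw [inner_neg_left, hββ] at this; norm_num at this
  -- The possibilities for γ are γ = β, β·γ = 1, 0, -1, and γ = -β; each uses a different mechanism.
  rcases hΔ.inner_cases hβ hγ with rfl | hk | hk | hk | rfl
  · have e1 : (∑ κ ∈ Δ with inner ℝ γ κ = (1 : ℝ) ∧ inner ℝ κ γ = (1 : ℝ),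
        (X (γ - κ) * Y (κ - γ) - Y (γ - κ) * X (κ - γ))) =
        ∑ κ ∈ Δ with inner ℝ γ κ = (1 : ℝ), W' κ := by
      refine Finset.sum_nbij' (fun κ => γ - κ) (fun κ => γ - κ) ?_ ?_ (fun _ _ => sub_sub_cancel _ _)
        (fun _ _ => sub_sub_cancel _ _) ?_
      · intro κ hκ
        rw [Finset.mem_filter] at hκ ⊢
        exact ⟨hΔ.sub_mem hβ hκ.1 hκ.2.1, by rw [inner_sub_right, hββ, hκ.2.1]; norm_num⟩
      · intro κ hκ
        rw [Finset.mem_filter] at hκ ⊢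
        have : inner ℝ γ (γ - κ) = (1 : ℝ) := by rw [inner_sub_right, hββ, hκ.2]; norm_num
        exact ⟨hΔ.sub_mem hβ hκ.1 hκ.2, this, by rwa [real_inner_comm]⟩
      · intro κ hκ
        rw [Finset.mem_filter] at hκ
        rw [← h2 _ (hΔ.sub_mem hβ hκ.1 hκ.2.1), neg_sub]
    -- The roots α and -α contribute equally since W' and the inner product are odd: ±γ give 4W'(γ),
    -- and those with γ·α = ±1 give twice the sum over γ·α = 1.
    have e2 : (∑ α ∈ Δ, W' α * ((inner ℝ α γ : ℝ) : ℂ)) =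
        4 * W' γ + 2 * ∑ κ ∈ Δ with inner ℝ γ κ = (1 : ℝ), W' κ := by
      have f1 : (∑ κ ∈ Δ with inner ℝ γ κ = (1 : ℝ), W' κ) =
          ∑ κ ∈ Δ, if inner ℝ γ κ = (-1 : ℝ) then -W' κ else 0 := by
        rw [Finset.sum_filter, ← hΔ.sum_neg]
        simp only [inner_neg_right, hW', neg_eq_iff_eq_neg]
      have f2 : W' γ = ∑ κ ∈ Δ, if κ = γ then W' κ else 0 := by rw [Finset.sum_ite_eq', if_pos hβ]
      have f3 : W' γ = -∑ κ ∈ Δ, if κ = -γ then W' κ else 0 := by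
        rw [hΔ.sum_ite_neg hβ, hW', neg_neg]
      rw [show 4 * W' γ + 2 * ∑ κ ∈ Δ with inner ℝ γ κ = (1 : ℝ), W' κ = 2 * W' γ + 2 * W' γ +
        (∑ κ ∈ Δ with inner ℝ γ κ = (1 : ℝ), W' κ) + ∑ κ ∈ Δ with inner ℝ γ κ = (1 : ℝ), W' κ by ring]
      nth_rewrite 2 [f1]
      nth_rewrite 1 [f2]
      rw [f3, Finset.sum_filter, mul_neg, Finset.mul_sum, Finset.mul_sum, ← sub_eq_add_neg,
        ← Finset.sum_sub_distrib, ← Finset.sum_add_distrib, ← Finset.sum_add_distrib]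
      refine Finset.sum_congr rfl fun κ hκ => ?_
      rw [real_inner_comm]
      rcases hΔ.inner_cases hγ hκ with rfl | hk | hk | hk | rfl
      · simp only [hββ, hne, if_true, if_false]; norm_num; ring
      · have e1 : κ ≠ γ := by rintro rfl; rw [hγγ] at hk; norm_num at hk
        have e2 : κ ≠ -γ := by rintro rfl; rw [inner_neg_right, hγγ] at hk; norm_num at hk
        simp only [hk, e1, e2, if_true, if_false]; norm_num
      · have e1 : κ ≠ γ := by rintro rfl; rw [hγγ] at hk; norm_num at hk
        have e2 : κ ≠ -γ := by rintro rfl; rw [inner_neg_right, hγγ] at hk; norm_num at hk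
        simp only [hk, e1, e2, if_false]; norm_num
      · have e1 : κ ≠ γ := by rintro rfl; rw [hγγ] at hk; norm_num at hk
        have e2 : κ ≠ -γ := by rintro rfl; rw [inner_neg_right, hγγ] at hk; norm_num at hk
        simp only [hk, e1, e2, if_true, if_false]; norm_num
      · simp only [inner_neg_right, hββ, hne.symm, if_true, if_false]; norm_num; ring
    rw [e1] at hS
    rw [Matrix.diagonal_apply_eq, e2, if_pos rfl, if_pos rfl]
    have : ¬ (inner ℝ γ γ = (-1 : ℝ)) := by rw [hγγ]; norm_num
    simp only [this, if_false]
    linear_combination hS + 2 * h2h γ hγ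
  · have hd : (⟨β, hβ⟩ : Δ) ≠ ⟨γ, hγ⟩ := fun he => by
      rw [Subtype.mk.injEq] at he; rw [← he, hββ] at hk; norm_num at hk
    have hd' : γ ≠ β := fun he => hd (Subtype.ext he.symm)
    have hd2 : γ ≠ -β := by rintro rfl; rw [inner_neg_right, hββ] at hk; norm_num at hk
    have hk' : inner ℝ γ β = (1 : ℝ) := by rw [real_inner_comm, hk]
    have e1 : (∑ κ ∈ Δ with inner ℝ β κ = (1 : ℝ) ∧ inner ℝ κ γ = (1 : ℝ),
        (X (β - κ) * Y (κ - γ) - Y (β - κ) * X (κ - γ))) = X (β - γ) *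
        ((∑ κ ∈ Δ with inner ℝ β κ = (1 : ℝ) ∧ inner ℝ κ γ = (1 : ℝ), W (β - κ)) -
          ∑ κ ∈ Δ with inner ℝ β κ = (1 : ℝ) ∧ inner ℝ κ γ = (1 : ℝ), W (γ - κ)) := by
      rw [← Finset.sum_sub_distrib, Finset.mul_sum]
      refine Finset.sum_congr rfl fun κ hκ => ?_
      rw [Finset.mem_filter] at hκ
      obtain ⟨hκ, hb, hc⟩ := hκ
      rw [h1 _ (hΔ.sub_mem hβ hκ hb) _ (hΔ.sub_mem hκ hγ hc) (by
        rw [inner_sub_left, inner_sub_right, inner_sub_right, hb, hk, hc, hΔ.norm_sq κ hκ]; norm_num),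
        sub_add_sub_cancel, ← hW (κ - γ), neg_sub]
    -- In D_β - D_γ the terms W(β), W(γ), W(β-γ) and the sum over the common neighbours κ all drop
    -- out. What is left is the sum of W(β-κ) - W(γ-κ), which matches e1; this dictates the form of
    -- D.
    have e2 := hΔ.sum_inner_eq_one hβ hγ hk W
    have e3 := hΔ.sum_inner_eq_one hγ hβ hk' W
    have e4 : ∀ f : EuclideanSpace ℝ (Fin ℓ) → ℂ,
        (∑ κ ∈ Δ with inner ℝ γ κ = (1 : ℝ) ∧ inner ℝ κ β = (1 : ℝ), f κ) =
        ∑ κ ∈ Δ with inner ℝ β κ = (1 : ℝ) ∧ inner ℝ κ γ = (1 : ℝ), f κ := fun f => by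
      refine Finset.sum_congr (Finset.filter_congr fun κ _ => ?_) fun _ _ => rfl
      rw [real_inner_comm κ γ, real_inner_comm κ β, and_comm]
    rw [e4, e4, ← neg_sub β γ, hW] at e3
    rw [e1] at hS
    have : ¬ ((1 : ℝ) = -1) := by norm_num
    rw [Matrix.diagonal_apply_ne _ hd]
    simp only [kerMat, Matrix.of_apply, hk, hd', hd2, this, if_true, if_false, add_zero]
    change A β = _ at e2
    change A γ = _ at e3
    linear_combination hS - X (β - γ) * e2 + X (β - γ) * e3
  · have hd : (⟨β, hβ⟩ : Δ) ≠ ⟨γ, hγ⟩ := fun he => by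
      rw [Subtype.mk.injEq] at he; rw [← he, hββ] at hk; norm_num at hk
    have hd' : γ ≠ β := fun he => hd (Subtype.ext he.symm)
    have hd2 : γ ≠ -β := by rintro rfl; rw [inner_neg_right, hββ] at hk; norm_num at hk
    have e1 : (∑ κ ∈ Δ with inner ℝ β κ = (1 : ℝ) ∧ inner ℝ κ γ = (1 : ℝ), X (β - κ) * Y (κ - γ)) =
        ∑ κ ∈ Δ with inner ℝ β κ = (1 : ℝ) ∧ inner ℝ κ γ = (1 : ℝ), Y (β - κ) * X (κ - γ) := by
      -- For β·γ = 0 the involution κ ↦ β + γ - κ exchanges the roots β - κ and κ - γ, so both sums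
      -- agree.
      have hmem : ∀ κ ∈ Δ.filter (fun κ => inner ℝ β κ = (1 : ℝ) ∧ inner ℝ κ γ = (1 : ℝ)),
          β - κ + γ ∈ Δ.filter (fun κ => inner ℝ β κ = (1 : ℝ) ∧ inner ℝ κ γ = (1 : ℝ)) := by
        intro κ hκ
        rw [Finset.mem_filter] at hκ ⊢
        obtain ⟨hκ, hb, hc⟩ := hκ
        refine ⟨hΔ.add_mem (hΔ.sub_mem hβ hκ hb) hγ (by rw [inner_sub_left, hk, hc]; norm_num), ?_, ?_⟩
        · rw [inner_add_right, inner_sub_right, hk, hb, hββ]; norm_num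
        · rw [inner_add_left, inner_sub_left, hk, hc, hγγ]; norm_num
      refine Finset.sum_nbij' (fun κ => β - κ + γ) (fun κ => β - κ + γ) hmem hmem
        (fun _ _ => by abel) (fun _ _ => by abel) fun κ _ => ?_
      rw [show β - (β - κ + γ) = κ - γ by abel, show β - κ + γ - γ = β - κ by abel, mul_comm]
    have t1 : ¬ ((0 : ℝ) = 1) := by norm_num
    have t2 : ¬ ((0 : ℝ) = -1) := by norm_num
    rw [Matrix.diagonal_apply_ne _ hd]
    simp only [kerMat, Matrix.of_apply, hk, hd', hd2, t1, t2, if_false, add_zero]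
    linear_combination e1
  · have hd : (⟨β, hβ⟩ : Δ) ≠ ⟨γ, hγ⟩ := fun he => by
      rw [Subtype.mk.injEq] at he; rw [← he, hββ] at hk; norm_num at hk
    have hd' : γ ≠ β := fun he => hd (Subtype.ext he.symm)
    have hd2 : γ ≠ -β := by rintro rfl; rw [inner_neg_right, hββ] at hk; norm_num at hk
    -- For β·γ = -1 only the intermediate root β + γ survives. Its term and those through ±β, ±γ
    -- form the equation `h3` at (β, -γ).
    have e1 : Δ.filter (fun κ => inner ℝ β κ = (1 : ℝ) ∧ inner ℝ κ γ = (1 : ℝ)) = {β + γ} := by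
      ext κ
      rw [Finset.mem_filter, Finset.mem_singleton]
      constructor
      · rintro ⟨hκ, hb, hc⟩
        exact eq_of_inner_eq_two (hΔ.norm_sq κ hκ) (hΔ.norm_sq _ (hΔ.add_mem hβ hγ hk)) (by
          rw [inner_add_right, hc, real_inner_comm, hb]; norm_num)
      · rintro rfl
        exact ⟨hΔ.add_mem hβ hγ hk, by rw [inner_add_right, hββ, hk]; norm_num,
          by rw [inner_add_left, hγγ, hk]; norm_num⟩
    have t1 : ¬ ((-1 : ℝ) = 1) := by norm_num
    have := h3 β hβ (-γ) (hΔ.neg_mem hγ) (by rw [inner_neg_right, hk, neg_neg])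
    rw [Matrix.diagonal_apply_ne _ hd, e1]
    simp only [kerMat, Matrix.of_apply, hk, hd', hd2, t1, if_true, if_false, add_zero,
      Finset.sum_singleton]
    rw [show β - (β + γ) = -γ by abel, show β + γ - γ = β by abel]
    rw [sub_neg_eq_add, show -γ - β = -β - γ by abel] at this
    linear_combination this
  · have hd : (⟨β, hβ⟩ : Δ) ≠ ⟨-β, hγ⟩ := fun he => hne (Subtype.mk.inj he)
    have e1 : Δ.filter (fun κ => inner ℝ β κ = (1 : ℝ) ∧ inner ℝ κ (-β) = (1 : ℝ)) = ∅ := by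
      refine Finset.filter_eq_empty_iff.2 fun κ _ hκ => ?_
      rw [inner_neg_right, real_inner_comm, hκ.1] at hκ
      norm_num at hκ
    -- For γ = -β no intermediate root exists, and the entry is zero because D takes equal values at
    -- β and -β.
    have e2 : A (-β) = A β := by
      simp only [hA]
      rw [Finset.sum_filter, Finset.sum_filter, ← hΔ.sum_neg]
      simp only [inner_neg_neg, hW]
    have t1 : ¬ ((-2 : ℝ) = 1) := by norm_num
    have t2 : ¬ ((-2 : ℝ) = -1) := by norm_num
    rw [Matrix.diagonal_apply_ne _ hd, e1]
    simp only [kerMat, Matrix.of_apply, inner_neg_right, hββ, hne.symm, t1, t2, if_true, if_false,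
      add_zero, Finset.sum_empty, e2, hW]
    ring

end Commutator

/-! ### Joint holomorphy of x, y and ℘ in τ and their arguments. -/

section JointHolomorphy

variable {E : Type*} [NormedAddCommGroup E] [NormedSpace ℂ E] {τ u z : E → ℂ} {x : E}

lemma differentiableAt_div {f g : E → ℂ} (hf : DifferentiableAt ℂ f x) (hg : DifferentiableAt ℂ g x)
    (h : g x ≠ 0) : DifferentiableAt ℂ (fun y => f y / g y) x := by
  simp only [div_eq_mul_inv]
  exact hf.fun_mul (hg.fun_inv h)

lemma differentiableAt_comp_thetaD (k : ℕ) (hτ : DifferentiableAt ℂ τ x) (hu : DifferentiableAt ℂ u x)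
    (h : 0 < (τ x).im) : DifferentiableAt ℂ (fun y => thetaD k (τ y) (u y)) x :=
  ((differentiableOn_thetaD k).differentiableAt
    (isOpen_upperHalf.mem_nhds (x := (τ x, u x)) h)).comp x
    (f := fun y => (τ y, u y)) (hτ.prodMk hu)

lemma differentiableAt_comp_theta1 (hτ : DifferentiableAt ℂ τ x) (hu : DifferentiableAt ℂ u x)
    (h : 0 < (τ x).im) : DifferentiableAt ℂ (fun y => theta1 (τ y) (u y)) x := by
  simpa only [thetaD_zero] using differentiableAt_comp_thetaD 0 hτ hu h

lemma eventually_im_pos (hτ : DifferentiableAt ℂ τ x) (h : 0 < (τ x).im) :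
    ∀ᶠ y in 𝓝 x, 0 < (τ y).im :=
  (Complex.continuous_im.continuousAt.comp hτ.continuousAt).eventually (lt_mem_nhds h)

/-- The lattice moves with τ; openness of its complement is seen through the jointly continuous
condition θ₁ ≠ 0. -/
lemma eventually_comp_notMem_periods (hτ : DifferentiableAt ℂ τ x) (hu : DifferentiableAt ℂ u x)
    (h : 0 < (τ x).im) (hux : u x ∉ periods (τ x)) : ∀ᶠ y in 𝓝 x, u y ∉ periods (τ y) := by
  filter_upwards [eventually_im_pos hτ h,
    (differentiableAt_comp_theta1 hτ hu h).continuousAt.eventually_ne (theta1_ne_zero h hux)] with y hy h0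
  rwa [← theta1_eq_zero_iff hy]

lemma differentiableAt_comp_xker (hτ : DifferentiableAt ℂ τ x) (hu : DifferentiableAt ℂ u x)
    (hz : DifferentiableAt ℂ z x) (h : 0 < (τ x).im) (hux : u x ∉ periods (τ x))
    (hzx : z x ∉ periods (τ x)) : DifferentiableAt ℂ (fun y => xker (τ y) (u y) (z y)) x := by
  have hne := mul_ne_zero (theta1_ne_zero h hzx) (theta1_ne_zero h hux)
  have hD := differentiableAt_comp_thetaD 1 hτ (differentiableAt_const (0 : ℂ)) h
  refine (differentiableAt_div ((differentiableAt_comp_theta1 hτ (hz.fun_sub hu) h).fun_mul hD)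
    ((differentiableAt_comp_theta1 hτ hz h).fun_mul (differentiableAt_comp_theta1 hτ hu h))
    hne).congr_of_eventuallyEq ?_
  filter_upwards [eventually_im_pos hτ h] with y hy
  exact xker_eq hy _ _

lemma differentiableAt_comp_yker (hτ : DifferentiableAt ℂ τ x) (hu : DifferentiableAt ℂ u x)
    (hz : DifferentiableAt ℂ z x) (h : 0 < (τ x).im) (hux : u x ∉ periods (τ x))
    (hzx : z x ∉ periods (τ x)) : DifferentiableAt ℂ (fun y => yker (τ y) (u y) (z y)) x := by
  have hD := differentiableAt_comp_thetaD 1 hτ (differentiableAt_const (0 : ℂ)) h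
  have hzu := differentiableAt_comp_theta1 hτ (hz.fun_sub hu) h
  have hzu' := differentiableAt_comp_thetaD 1 hτ (hz.fun_sub hu) h
  have hu0 := differentiableAt_comp_theta1 hτ hu h
  have hu1 := differentiableAt_comp_thetaD 1 hτ hu h
  have hz0 := differentiableAt_comp_theta1 hτ hz h
  have hne := mul_ne_zero (theta1_ne_zero h hzx) (pow_ne_zero 2 (theta1_ne_zero h hux))
  refine (differentiableAt_div (hD.fun_mul ((hzu'.fun_mul hu0).fun_add (hzu.fun_mul hu1))).fun_neg
    (hz0.fun_mul (hu0.fun_pow 2)) hne).congr_of_eventuallyEq ?_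
  filter_upwards [eventually_im_pos hτ h, eventually_comp_notMem_periods hτ hu h hux] with y hy hy'
  exact yker_eq hy hy' _

/-- Holomorphy of ℘ in τ is read off from its expression through theta functions. -/
lemma differentiableAt_comp_wp (hτ : DifferentiableAt ℂ τ x) (hu : DifferentiableAt ℂ u x)
    (h : 0 < (τ x).im) (hux : u x ∉ periods (τ x)) :
    DifferentiableAt ℂ (fun y => wp (τ y) (u y)) x := by
  have hD := fun k : ℕ => differentiableAt_comp_thetaD k hτ (differentiableAt_const (0 : ℂ)) h
  have hu0 := differentiableAt_comp_theta1 hτ hu h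
  have hu1 := fun k : ℕ => differentiableAt_comp_thetaD k hτ hu h
  have hne := mul_ne_zero three_ne_zero (thetaD_one_zero_ne_zero h)
  have hne' := pow_ne_zero 2 (theta1_ne_zero h hux)
  refine ((differentiableAt_div (hD 3) ((hD 1).const_mul 3) hne).fun_sub
    (differentiableAt_div (((hu1 2).fun_mul hu0).fun_sub ((hu1 1).fun_pow 2)) (hu0.fun_pow 2)
      hne')).congr_of_eventuallyEq ?_
  filter_upwards [eventually_im_pos hτ h, eventually_comp_notMem_periods hτ hu h hux] with y hy hy'
  exact wp_eq_theta hy hy'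

/-- The chain rule along a curve, in terms of partial derivatives. -/
lemma hasDerivAt_comp_graph {F : Type*} [NormedAddCommGroup F] [NormedSpace ℂ F]
    {f : ℂ → ℂ → F} {a : ℂ → ℂ} {t a' : ℂ} {d₁ d₂ : F}
    (hf : DifferentiableAt ℂ (fun p : ℂ × ℂ => f p.1 p.2) (t, a t)) (ha : HasDerivAt a a' t)
    (h₁ : HasDerivAt (fun s => f s (a t)) d₁ t) (h₂ : HasDerivAt (fun w => f t w) d₂ (a t)) :
    HasDerivAt (fun s => f s (a s)) (d₁ + a' • d₂) t := by
  have e1 : HasDerivAt (fun s => f s (a t))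
      (fderiv ℂ (fun p : ℂ × ℂ => f p.1 p.2) (t, a t) (1, 0)) t :=
    HasFDerivAt.comp_hasDerivAt (l := fun p : ℂ × ℂ => f p.1 p.2) t hf.hasFDerivAt (f := fun s => (s, a t)) ((hasDerivAt_id' t).prodMk (hasDerivAt_const t (a t)))
  have e2 : HasDerivAt (fun w => f t w)
      (fderiv ℂ (fun p : ℂ × ℂ => f p.1 p.2) (t, a t) (0, 1)) (a t) :=
    HasFDerivAt.comp_hasDerivAt (l := fun p : ℂ × ℂ => f p.1 p.2) (a t) hf.hasFDerivAt (f := fun w => (t, w)) ((hasDerivAt_const (a t) t).prodMk (hasDerivAt_id' (a t)))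
  have e3 : HasDerivAt (fun s => f s (a s))
      (fderiv ℂ (fun p : ℂ × ℂ => f p.1 p.2) (t, a t) (1, a')) t :=
    HasFDerivAt.comp_hasDerivAt (l := fun p : ℂ × ℂ => f p.1 p.2) t hf.hasFDerivAt (f := fun s => (s, a s)) ((hasDerivAt_id' t).prodMk ha)
  rw [h₁.unique e1, h₂.unique e2, ← map_smul, ← map_add]
  simpa using e3

end JointHolomorphy

/-! ### Entries of the Lax matrices. -/

section LaxMatrices

variable {ℓ : ℕ} {Δ : Finset (EuclideanSpace ℝ (Fin ℓ))}

lemma cdot_neg (α : EuclideanSpace ℝ (Fin ℓ)) (v : Fin ℓ → ℂ) : cdot (-α) v = -cdot α v := by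
  simp [cdot, Finset.sum_neg_distrib]

lemma cdot_add (α β : EuclideanSpace ℝ (Fin ℓ)) (v : Fin ℓ → ℂ) :
    cdot (α + β) v = cdot α v + cdot β v := by
  simp [cdot, add_mul, Finset.sum_add_distrib]

lemma cdot_sub (α β : EuclideanSpace ℝ (Fin ℓ)) (v : Fin ℓ → ℂ) :
    cdot (α - β) v = cdot α v - cdot β v := by
  simp [cdot, sub_mul, Finset.sum_sub_distrib]

lemma cdot_ofReal (α β : EuclideanSpace ℝ (Fin ℓ)) :
    cdot α (fun j => (β j : ℂ)) = ((inner ℝ β α : ℝ) : ℂ) := by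
  simp [cdot, PiLp.inner_apply]

/-- The four singular points are the 2-torsion points: exactly where x(·,z) or x(·,2z) can have a
pole in z. -/
lemma isSingular_iff {τ z : ℂ} : IsSingular τ z ↔ 2 * z ∈ periods τ := by
  constructor
  · rintro ⟨a, m, n, h⟩
    fin_cases a <;> simp [singularPoint] at h
    · exact ⟨2 * m, 2 * n, by push_cast; linear_combination 2 * h⟩
    · exact ⟨2 * m + 1, 2 * n, by push_cast; linear_combination 2 * h⟩
    · exact ⟨2 * m + 1, 2 * n + 1, by push_cast; linear_combination 2 * h⟩
    · exact ⟨2 * m, 2 * n + 1, by push_cast; linear_combination 2 * h⟩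
  · rintro ⟨m, n, h⟩
    obtain ⟨k, rfl | rfl⟩ := Int.even_or_odd' m <;> obtain ⟨l, rfl | rfl⟩ := Int.even_or_odd' n <;>
      push_cast at h
    · exact ⟨0, k, l, by simp [singularPoint]; linear_combination h / 2⟩
    · exact ⟨3, k, l, by simp [singularPoint]; linear_combination h / 2⟩
    · exact ⟨1, k, l, by simp [singularPoint]; linear_combination h / 2⟩
    · exact ⟨2, k, l, by simp [singularPoint]; linear_combination h / 2⟩

lemma notMem_periods_of_not_isSingular {τ z : ℂ} (h : ¬ IsSingular τ z) : z ∉ periods τ := fun hm =>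
  h (isSingular_iff.2 (by rw [two_mul]; exact add_mem_periods hm hm))

lemma expQ_eq (k : ℂ) (q : Fin ℓ → ℂ) : expQ Δ k q = Matrix.diagonal fun β : Δ =>
    cexp (2 * Real.pi * I * k * cdot (β : EuclideanSpace ℝ (Fin ℓ)) q) := by
  rw [expQ, dotMat, ← Matrix.diagonal_smul, Matrix.exp_diagonal]
  congr 1
  ext β
  rw [Pi.coe_exp, Complex.exp_eq_exp_ℂ, Pi.smul_apply, smul_eq_mul]

lemma Lmat_eq (hΔ : IsSimplyLacedRootSystem Δ) (g : ℂ) (q p : ℂ → Fin ℓ → ℂ) (τ z : ℂ) :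
    Lmat Δ g q p τ z = dotMat Δ (p τ) + (I * g) • kerMat Δ (fun α => xker τ (cdot α (q τ)) z)
      (fun α => 2 * xker τ (cdot α (q τ)) (2 * z)) := by
  rw [← hΔ.sum_Emat_eq, Lmat, X1, X2, add_assoc, smul_add]
  congr 2
  rw [Finset.smul_sum, Finset.smul_sum]
  refine Finset.sum_congr rfl fun α _ => ?_
  rw [smul_smul, smul_smul]
  congr 1
  ring

lemma Mmat_eq (hΔ : IsSimplyLacedRootSystem Δ) (g : ℂ) (q : ℂ → Fin ℓ → ℂ) (τ z : ℂ) :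
    Mmat Δ g q τ z = Dmat Δ g τ (q τ) + (I * g) • kerMat Δ (fun α => yker τ (cdot α (q τ)) z)
      (fun α => yker τ (cdot α (q τ)) (2 * z)) := by
  rw [← hΔ.sum_Emat_eq, Mmat, Y1, Y2, add_assoc, smul_add]

lemma Dmat_eq (g τ : ℂ) (q : Fin ℓ → ℂ) :
    Dmat Δ g τ q = (I * g) • Matrix.diagonal fun β : Δ =>
      wp τ (cdot (β : EuclideanSpace ℝ (Fin ℓ)) q) +
      ∑ γ ∈ Δ with inner ℝ (β : EuclideanSpace ℝ (Fin ℓ)) γ = 1, wp τ (cdot γ q) := by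
  rw [Dmat, ← Matrix.diagonal_smul]
  congr 1
  ext β
  rw [Pi.smul_apply, smul_eq_mul, mul_add]

/-- Entrywise properties of functions pass to the entries of `kerMat`. -/
lemma IsSimplyLacedRootSystem.hasDerivAt_kerMat (hΔ : IsSimplyLacedRootSystem Δ)
    {X Xh : ℂ → EuclideanSpace ℝ (Fin ℓ) → ℂ} {X' Xh' : EuclideanSpace ℝ (Fin ℓ) → ℂ} {t : ℂ}
    (h : ∀ α ∈ Δ, HasDerivAt (fun s => X s α) (X' α) t)
    (hh : ∀ α ∈ Δ, HasDerivAt (fun s => Xh s α) (Xh' α) t) (β γ : Δ) :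
    HasDerivAt (fun s => kerMat Δ (X s) (Xh s) β γ) (kerMat Δ X' Xh' β γ) t := by
  obtain ⟨β, hβ⟩ := β
  obtain ⟨γ, hγ⟩ := γ
  simp only [kerMat, Matrix.of_apply]
  refine HasDerivAt.fun_add ?_ ?_
  · split_ifs with hb
    · exact h _ (hΔ.sub_mem hβ hγ hb)
    · exact hasDerivAt_const _ _
  · split_ifs with hb
    · exact hh _ hβ
    · exact hasDerivAt_const _ _

/-- On an antipodal entry the commutator sees β·v - (-β)·v = 2 β·v. This accounts for the
coefficient 2 of X₂, which Y₂ lacks. -/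
lemma diagonal_mul_kerMat_sub (v : Fin ℓ → ℂ) (X Xh : EuclideanSpace ℝ (Fin ℓ) → ℂ) :
    dotMat Δ v * kerMat Δ X Xh - kerMat Δ X Xh * dotMat Δ v =
      kerMat Δ (fun α => cdot α v * X α) (fun α => 2 * cdot α v * Xh α) := by
  ext β γ
  rw [Matrix.sub_apply, dotMat, Matrix.diagonal_mul, Matrix.mul_diagonal]
  simp only [kerMat, Matrix.of_apply]
  have key : (γ : EuclideanSpace ℝ (Fin ℓ)) = -β → cdot (γ : EuclideanSpace ℝ (Fin ℓ)) v =
      -cdot (β : EuclideanSpace ℝ (Fin ℓ)) v := fun h => by rw [h, cdot_neg]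
  rw [cdot_sub]
  split_ifs with h1 h2 h2
  · rw [key h2]; ring
  · ring
  · rw [key h2]; ring
  · ring

end LaxMatrices

/-! ### The Lax equation and the translation rules. -/

section LaxEquation

variable {ℓ : ℕ} {Δ : Finset (EuclideanSpace ℝ (Fin ℓ))} {g : ℂ} {U : Set ℂ}
  {q p : ℂ → Fin ℓ → ℂ} {τ z : ℂ}

lemma IsFlow.hasDerivAt_cdot_q (hflow : IsFlow Δ g U q p) (hτ : τ ∈ U)
    (α : EuclideanSpace ℝ (Fin ℓ)) :
    HasDerivAt (fun t => cdot α (q t)) (cdot α (p τ) / (2 * Real.pi * I)) τ := by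
  have h1 : ∀ j, HasDerivAt (fun t => q t j) (p τ j / (2 * Real.pi * I)) τ := fun j => by
    have := (hflow.eq_q τ hτ j).div_const (2 * Real.pi * I)
    simpa only [mul_div_cancel_left₀ _ Complex.two_pi_I_ne_zero] using this
  have := HasDerivAt.fun_sum fun j (_ : j ∈ Finset.univ) => (h1 j).const_mul (α j : ℂ)
  refine this.congr_deriv ?_
  rw [cdot, Finset.sum_div]
  exact Finset.sum_congr rfl fun j _ => (mul_div_assoc _ _ _).symm

lemma IsFlow.hasDerivAt_cdot_p (hflow : IsFlow Δ g U q p) (hτ : τ ∈ U)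
    (β : EuclideanSpace ℝ (Fin ℓ)) :
    HasDerivAt (fun t => cdot β (p t)) (-(g ^ 2 / 2) * (∑ α ∈ Δ,
      deriv (wp τ) (cdot α (q τ)) * ((inner ℝ α β : ℝ) : ℂ)) / (2 * Real.pi * I)) τ := by
  have h1 : ∀ j, HasDerivAt (fun t => p t j) (-(g ^ 2 / 2) * (∑ α ∈ Δ,
      deriv (wp τ) (cdot α (q τ)) * (α j : ℂ)) / (2 * Real.pi * I)) τ := fun j => by
    have := (hflow.eq_p τ hτ j).div_const (2 * Real.pi * I)
    simpa only [mul_div_cancel_left₀ _ Complex.two_pi_I_ne_zero] using this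
  have := HasDerivAt.fun_sum fun j (_ : j ∈ Finset.univ) => (h1 j).const_mul (β j : ℂ)
  refine this.congr_deriv ?_
  simp only [← cdot_ofReal, cdot, Finset.mul_sum, Finset.sum_div]
  rw [Finset.sum_comm]
  refine Finset.sum_congr rfl fun α _ => Finset.sum_congr rfl fun j _ => ?_
  ring

/-- The chain rule along the flow: 2πi dq/dτ = p gives the term in y, the heat equation the term in
∂y/∂z. -/
lemma IsFlow.hasDerivAt_xker (hflow : IsFlow Δ g U q p) (hτ : τ ∈ U) (h : 0 < τ.im)
    {α : EuclideanSpace ℝ (Fin ℓ)} (hα : α ∈ Δ) (hz : z ∉ periods τ) :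
    HasDerivAt (fun t => xker t (cdot α (q t)) z)
      ((cdot α (p τ) * yker τ (cdot α (q τ)) z - deriv (fun w => yker τ (cdot α (q τ)) w) z) /
        (2 * Real.pi * I)) τ := by
  have hu := hflow.regular τ hτ α hα
  have hd : DifferentiableAt ℂ (fun w : ℂ × ℂ => xker w.1 w.2 z) (τ, cdot α (q τ)) :=
    differentiableAt_comp_xker (τ := fun w : ℂ × ℂ => w.1) (u := fun w => w.2) (z := fun _ => z)
      (by fun_prop) (by fun_prop) (by fun_prop) h hu hz
  refine (hasDerivAt_comp_graph (f := fun t u => xker t u z) hd (hflow.hasDerivAt_cdot_q hτ α)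
    (hasDerivAt_xker_tau h hu hz) (EllipticCM.hasDerivAt_xker h hu z)).congr_deriv ?_
  rw [smul_eq_mul]
  ring

/-- The isomonodromic Lax equation. -/
theorem lax_equation (hΔ : IsSimplyLacedRootSystem Δ) (hflow : IsFlow Δ g U q p) (hτ : τ ∈ U)
    (h : 0 < τ.im) (hz : ¬ IsSingular τ z) : ∃ Lτ Mz : Matrix Δ Δ ℂ,
      (∀ β γ, HasDerivAt (fun t => Lmat Δ g q p t z β γ) (Lτ β γ) τ) ∧
      (∀ β γ, HasDerivAt (fun w => Mmat Δ g q τ w β γ) (Mz β γ) z) ∧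
      (2 * Real.pi * I) • Lτ + Mz
        = Lmat Δ g q p τ z * Mmat Δ g q τ z - Mmat Δ g q τ z * Lmat Δ g q p τ z := by
  have hz1 := notMem_periods_of_not_isSingular hz
  have hz2 : 2 * z ∉ periods τ := fun hm => hz (isSingular_iff.2 hm)
  have hreg := hflow.regular τ hτ
  set W' : EuclideanSpace ℝ (Fin ℓ) → ℂ := fun α => deriv (wp τ) (cdot α (q τ)) with hW'
  set X : EuclideanSpace ℝ (Fin ℓ) → ℂ := fun α => xker τ (cdot α (q τ)) z with hX
  set Xh : EuclideanSpace ℝ (Fin ℓ) → ℂ := fun α => xker τ (cdot α (q τ)) (2 * z) with hXh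
  set Y : EuclideanSpace ℝ (Fin ℓ) → ℂ := fun α => yker τ (cdot α (q τ)) z with hY
  set Yh : EuclideanSpace ℝ (Fin ℓ) → ℂ := fun α => yker τ (cdot α (q τ)) (2 * z) with hYh
  set dY : EuclideanSpace ℝ (Fin ℓ) → ℂ :=
    fun α => deriv (fun w => yker τ (cdot α (q τ)) w) z with hdY
  set dYh : EuclideanSpace ℝ (Fin ℓ) → ℂ :=
    fun α => deriv (fun w => yker τ (cdot α (q τ)) w) (2 * z) with hdYh
  have hodd : ∀ u, deriv (wp τ) (-u) = -deriv (wp τ) u := fun u => by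
    have h1 : deriv (fun v => wp τ (-v)) u = -deriv (wp τ) (-u) := deriv_comp_neg (wp τ) u
    simp only [wp_neg h] at h1
    exact (neg_eq_iff_eq_neg.2 h1).symm
  have hcomm := hΔ.kerMat_commutator (X := X) (Xh := Xh) (Y := Y) (Yh := Yh)
    (W := fun α => wp τ (cdot α (q τ))) (W' := W')
    (fun α => by simp only [cdot_neg, wp_neg h])
    (fun α => by simp only [hW', cdot_neg, hodd])
    (fun α hα β hβ hi => by
      have hs := hreg _ (hΔ.add_mem hα hβ hi)
      rw [cdot_add] at hs
      simp only [hX, hY, cdot_add]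
      exact xker_yker_sub h (hreg α hα) (hreg β hβ) hs hz1)
    (fun α hα => by
      simp only [hX, hY, cdot_neg]
      exact xker_yker_neg_sub h (hreg α hα) hz1)
    (fun α hα => by
      simp only [hXh, hYh, cdot_neg]
      exact xker_yker_neg_sub h (hreg α hα) hz2)
    (fun α hα β hβ hi => by
      have hs := hreg _ (hΔ.sub_mem hα hβ hi)
      rw [cdot_sub] at hs
      simp only [hX, hY, hXh, hYh, cdot_sub]
      exact xker_yker_two_mul h (hreg α hα) (hreg β hβ) hs hz2)
  refine ⟨(2 * Real.pi * I)⁻¹ • (Matrix.diagonal (fun β : Δ => -(g ^ 2 / 2) * (∑ α ∈ Δ,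
      W' α * ((inner ℝ α (β : EuclideanSpace ℝ (Fin ℓ)) : ℝ) : ℂ))) + (I * g) • kerMat Δ
        (fun α => cdot α (p τ) * Y α - dY α) (fun α => 2 * (cdot α (p τ) * Yh α - dYh α))),
    (I * g) • kerMat Δ dY (fun α => 2 * dYh α), fun β γ => ?_, fun β γ => ?_, ?_⟩
  · simp only [Lmat_eq hΔ, Matrix.add_apply, Matrix.smul_apply, smul_eq_mul]
    rw [mul_add]
    refine HasDerivAt.fun_add ?_ ?_
    · by_cases hβ : β = γ
      · subst hβ
        simp only [dotMat, Matrix.diagonal_apply_eq]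
        refine (hflow.hasDerivAt_cdot_p hτ _).congr_deriv ?_
        rw [div_eq_inv_mul]
      · simp only [dotMat, Matrix.diagonal_apply_ne _ hβ, mul_zero]
        exact hasDerivAt_const _ _
    · refine ((hΔ.hasDerivAt_kerMat
        (X' := fun α => (2 * Real.pi * I)⁻¹ * (cdot α (p τ) * Y α - dY α))
        (Xh' := fun α => (2 * Real.pi * I)⁻¹ * (2 * (cdot α (p τ) * Yh α - dYh α)))
        (fun α hα => ?_) (fun α hα => ?_) β γ).const_mul (I * g)).congr_deriv ?_
      · refine (hflow.hasDerivAt_xker hτ h hα hz1).congr_deriv ?_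
        rw [div_eq_inv_mul]
      · refine ((hflow.hasDerivAt_xker hτ h hα hz2).const_mul 2).congr_deriv ?_
        rw [div_eq_inv_mul, mul_left_comm]
      · simp only [kerMat, Matrix.of_apply]
        split_ifs <;> ring
  · simp only [Mmat_eq hΔ, Matrix.add_apply, Matrix.smul_apply, smul_eq_mul]
    refine HasDerivAt.const_add _ ((hΔ.hasDerivAt_kerMat (fun α hα => ?_)
      (fun α hα => ?_) β γ).const_mul (I * g))
    · exact (hasDerivAt_yker_right h (hreg α hα) hz1).differentiableAt.hasDerivAt
    · have h1 : HasDerivAt (fun w : ℂ => 2 * w) 2 z := by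
        simpa using (hasDerivAt_id z).const_mul (2 : ℂ)
      have h2 := (hasDerivAt_yker_right h (hreg α hα) hz2).differentiableAt.hasDerivAt
      have h3 := h2.comp z h1
      exact h3.congr_deriv (mul_comm _ _)
  · have hP := diagonal_mul_kerMat_sub (Δ := Δ) (p τ) Y Yh
    rw [smul_smul, mul_inv_cancel₀ Complex.two_pi_I_ne_zero, one_smul, Lmat_eq hΔ, Mmat_eq hΔ]
    -- With c = ig, the factor c² = -g² turns the diagonal commutator into the force; the term with
    -- P and D disappears because both are diagonal.
    have hexp : ∀ P D K N : Matrix Δ Δ ℂ, ∀ c : ℂ, D * P = P * D →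
        (P + c • K) * (c • D + c • N) - (c • D + c • N) * (P + c • K) =
          c • (P * N - N * P) + c ^ 2 • (K * (D + N) - (D + N) * K) := by
      intro P D K N c hDP
      simp only [add_mul, mul_add, smul_mul_assoc, mul_smul_comm, hDP, smul_sub, smul_add, smul_smul,
        sq]
      abel
    rw [Dmat_eq]
    have hD' : (Matrix.diagonal fun β : Δ => wp τ (cdot (β : EuclideanSpace ℝ (Fin ℓ)) (q τ)) +
        ∑ γ ∈ Δ with inner ℝ (β : EuclideanSpace ℝ (Fin ℓ)) γ = 1, wp τ (cdot γ (q τ))) *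
        dotMat Δ (p τ) = dotMat Δ (p τ) * Matrix.diagonal fun β : Δ =>
        wp τ (cdot (β : EuclideanSpace ℝ (Fin ℓ)) (q τ)) +
        ∑ γ ∈ Δ with inner ℝ (β : EuclideanSpace ℝ (Fin ℓ)) γ = 1, wp τ (cdot γ (q τ)) := by
      rw [dotMat, Matrix.diagonal_mul_diagonal, Matrix.diagonal_mul_diagonal]
      simp only [mul_comm]
    rw [hexp _ _ _ _ _ hD', hP, hcomm]
    ext β γ
    simp only [Matrix.add_apply, Matrix.smul_apply, smul_eq_mul, mul_pow, I_sq]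
    -- The derivative ∂y/∂z from the heat equation cancels ∂M/∂z. At the argument 2z the chain rule
    -- puts a 2 into ∂M/∂z, matching the coefficient of X₂.
    have hk : kerMat Δ (fun α => cdot α (p τ) * Y α - dY α)
        (fun α => 2 * (cdot α (p τ) * Yh α - dYh α)) β γ + kerMat Δ dY (fun α => 2 * dYh α) β γ =
        kerMat Δ (fun α => cdot α (p τ) * Y α) (fun α => 2 * cdot α (p τ) * Yh α) β γ := by
      simp only [kerMat, Matrix.of_apply]
      split_ifs <;> ring
    rw [← hk]
    by_cases hβ : β = γ
    · subst hβ
      simp only [Matrix.diagonal_apply_eq]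
      ring
    · simp only [Matrix.diagonal_apply_ne _ hβ]
      ring

lemma expQ_mul_diagonal_mul_expQ (v : Fin ℓ → ℂ) (d : Δ → ℂ) :
    expQ Δ 1 v * Matrix.diagonal d * expQ Δ (-1) v = Matrix.diagonal d := by
  rw [expQ_eq, expQ_eq, Matrix.diagonal_mul_diagonal, Matrix.diagonal_mul_diagonal]
  congr 1
  ext β
  rw [mul_right_comm, ← Complex.exp_add, mul_neg, neg_mul, add_neg_cancel, Complex.exp_zero, one_mul]

/-- Conjugation multiplies the entry (β,γ) by e^{2πi(β-γ)·v}: one factor for β - γ = α and two for γ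
= -β, in step with z + τ and 2z + 2τ. -/
lemma expQ_mul_kerMat_mul_expQ (v : Fin ℓ → ℂ) (X Xh : EuclideanSpace ℝ (Fin ℓ) → ℂ) :
    expQ Δ 1 v * kerMat Δ X Xh * expQ Δ (-1) v =
      kerMat Δ (fun α => cexp (2 * Real.pi * I * cdot α v) * X α)
        (fun α => cexp (2 * Real.pi * I * cdot α v) * (cexp (2 * Real.pi * I * cdot α v) * Xh α)) := by
  ext β γ
  rw [expQ_eq, expQ_eq, Matrix.mul_diagonal, Matrix.diagonal_mul, mul_right_comm, ← Complex.exp_add]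
  simp only [kerMat, Matrix.of_apply, mul_add]
  congr 1
  · rw [mul_ite, mul_zero, cdot_sub]
    congr 3
    ring
  · rw [mul_ite, mul_zero]
    split_ifs with hγ
    · rw [← mul_assoc, ← Complex.exp_add, hγ, cdot_neg]
      congr 2
      ring
    · rfl

/-- The behaviour of `L` and `M` under translations by periods. -/
theorem monodromy_LM (hΔ : IsSimplyLacedRootSystem Δ) (hflow : IsFlow Δ g U q p) (hτ : τ ∈ U)
    (h : 0 < τ.im) (z : ℂ) :
      Lmat Δ g q p τ (z + 1) = Lmat Δ g q p τ z ∧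
      Mmat Δ g q τ (z + 1) = Mmat Δ g q τ z ∧
      Lmat Δ g q p τ (z + τ) = expQ Δ 1 (q τ) * Lmat Δ g q p τ z * expQ Δ (-1) (q τ) ∧
      Mmat Δ g q τ (z + τ)
        = expQ Δ 1 (q τ) * (Mmat Δ g q τ z + (2 * Real.pi * I) • Lmat Δ g q p τ z)
            * expQ Δ (-1) (q τ) - (2 * Real.pi * I) • dotMat Δ (p τ) := by
  have hreg := hflow.regular τ hτ
  have e1 : 2 * (z + 1) = 2 * z + 1 + 1 := by ring
  have e2 : 2 * (z + τ) = 2 * z + τ + τ := by ring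
  refine ⟨?_, ?_, ?_, ?_⟩
  · simp only [Lmat_eq hΔ, e1, xker_add_one h]
  · simp only [Mmat_eq hΔ, e1, yker_add_one h]
  · rw [Lmat_eq hΔ, Lmat_eq hΔ, e2, mul_add (expQ Δ 1 (q τ)), add_mul, dotMat, expQ_mul_diagonal_mul_expQ, mul_smul_comm,
      smul_mul_assoc, expQ_mul_kerMat_mul_expQ]
    congr 3
    · ext α
      exact xker_add_tau h _ _
    · ext α
      rw [xker_add_tau h, xker_add_tau h]
      ring
  · rw [Lmat_eq hΔ, Mmat_eq hΔ, Mmat_eq hΔ, e2, Dmat_eq, dotMat, ← Matrix.diagonal_smul]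
    simp only [mul_add (expQ Δ 1 (q τ)), add_mul _ _ (expQ Δ (-1) (q τ)), smul_add]
    rw [← Matrix.diagonal_smul, expQ_mul_diagonal_mul_expQ, expQ_mul_diagonal_mul_expQ]
    simp only [mul_smul_comm, smul_mul_assoc, expQ_mul_kerMat_mul_expQ]
    have key : ∀ A B C D E : Matrix Δ Δ ℂ, B = C + E → A + B = A + C + (D + E) - D := by
      intro A B C D E he; rw [he]; abel
    apply key
    ext ⟨β, hβ⟩ ⟨γ, hγ⟩
    simp only [Matrix.add_apply, Matrix.smul_apply, smul_eq_mul, kerMat, Matrix.of_apply]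
    split_ifs with h1 h2 h2
    · rw [yker_add_tau h (hreg _ (hΔ.sub_mem hβ hγ h1)), yker_add_tau h (hreg _ hβ),
        yker_add_tau h (hreg _ hβ), xker_add_tau h]
      ring
    · rw [yker_add_tau h (hreg _ (hΔ.sub_mem hβ hγ h1))]
      ring
    · rw [yker_add_tau h (hreg _ hβ), yker_add_tau h (hreg _ hβ), xker_add_tau h]
      ring
    · ring

end LaxEquation

/-! ### Functions with at most a simple pole. -/

section PolarForm

/-- `f` has at most a simple pole at `z`, with residue `c`. -/
def HasPolarForm (f : ℂ → ℂ) (z c : ℂ) : Prop :=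
  ∃ φ : ℂ → ℂ, AnalyticAt ℂ φ z ∧ φ z = c ∧ ∀ᶠ w in 𝓝[≠] z, f w = (w - z)⁻¹ * φ w

variable {f f' : ℂ → ℂ} {z c c' : ℂ}

lemma HasPolarForm.add (h : HasPolarForm f z c) (h' : HasPolarForm f' z c') :
    HasPolarForm (fun w => f w + f' w) z (c + c') := by
  obtain ⟨φ, ha, hc, he⟩ := h
  obtain ⟨φ', ha', hc', he'⟩ := h'
  refine ⟨fun w => φ w + φ' w, ha.fun_add ha', by simp only [hc, hc'], ?_⟩
  filter_upwards [he, he'] with w h1 h2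
  rw [h1, h2, mul_add]

lemma HasPolarForm.const_mul (h : HasPolarForm f z c) (a : ℂ) :
    HasPolarForm (fun w => a * f w) z (a * c) := by
  obtain ⟨φ, ha, hc, he⟩ := h
  refine ⟨fun w => a * φ w, analyticAt_const.fun_mul ha, by simp only [hc], ?_⟩
  filter_upwards [he] with w h1
  rw [h1, mul_left_comm]

lemma _root_.AnalyticAt.hasPolarForm (h : AnalyticAt ℂ f z) : HasPolarForm f z 0 := by
  refine ⟨fun w => (w - z) * f w, (analyticAt_id.fun_sub analyticAt_const).fun_mul h, by simp, ?_⟩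
  filter_upwards [self_mem_nhdsWithin] with w hw
  rw [inv_mul_cancel_left₀ (sub_ne_zero.2 hw)]

lemma HasPolarForm.comp_two_mul (h : HasPolarForm f (2 * z) c) :
    HasPolarForm (fun w => f (2 * w)) z (c / 2) := by
  obtain ⟨φ, ha, hc, he⟩ := h
  have h2 : AnalyticAt ℂ (fun w : ℂ => 2 * w) z := analyticAt_const.fun_mul analyticAt_id
  refine ⟨fun w => φ (2 * w) / 2, (ha.fun_comp h2).div_const, by simp only [hc], ?_⟩
  have ht : Tendsto (fun w : ℂ => 2 * w) (𝓝[≠] z) (𝓝[≠] (2 * z)) := by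
    refine tendsto_nhdsWithin_of_tendsto_nhds_of_eventually_within _
      (h2.continuousAt.tendsto.mono_left nhdsWithin_le_nhds) ?_
    filter_upwards [self_mem_nhdsWithin] with w hw
    exact fun he => hw (mul_left_cancel₀ two_ne_zero he)
  filter_upwards [ht.eventually he] with w hw
  rw [hw, ← mul_sub, mul_inv]
  ring

lemma HasPolarForm.meromorphicAt (h : HasPolarForm f z c) : MeromorphicAt f z := by
  obtain ⟨φ, ha, -, he⟩ := h
  have : MeromorphicAt (fun w => (w - z)⁻¹ * φ w) z :=
    ((analyticAt_id.fun_sub analyticAt_const).meromorphicAt.fun_inv).fun_mul ha.meromorphicAt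
  exact this.congr (he.mono fun w hw => hw.symm)

lemma HasPolarForm.meromorphicOrderAt_eq (h : HasPolarForm f z c) (hc : c ≠ 0) :
    meromorphicOrderAt f z = -1 := by
  have hm := h.meromorphicAt
  obtain ⟨φ, ha, hc', he⟩ := h
  refine (meromorphicOrderAt_eq_int_iff (n := -1) hm).2 ⟨φ, ha, by rwa [hc'], ?_⟩
  filter_upwards [he] with w hw
  rw [hw, zpow_neg_one, smul_eq_mul]

lemma HasPolarForm.neg_one_le_meromorphicOrderAt (h : HasPolarForm f z c) :
    -1 ≤ meromorphicOrderAt f z := by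
  obtain ⟨φ, ha, -, he⟩ := h
  have h1 : MeromorphicAt (fun w : ℂ => (w - z)⁻¹) z :=
    (analyticAt_id.fun_sub analyticAt_const).meromorphicAt.fun_inv
  have h2 : HasPolarForm (fun w : ℂ => (w - z)⁻¹) z 1 :=
    ⟨fun _ => 1, analyticAt_const, rfl, Eventually.of_forall fun w => (mul_one _).symm⟩
  rw [meromorphicOrderAt_congr he]
  change -1 ≤ meromorphicOrderAt ((fun w : ℂ => (w - z)⁻¹) * φ) z
  rw [meromorphicOrderAt_mul h1 ha.meromorphicAt, h2.meromorphicOrderAt_eq one_ne_zero]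
  exact le_add_of_nonneg_right ha.meromorphicOrderAt_nonneg

end PolarForm

/-! ### The four regular singular points of L. -/

section Singularities

variable {ℓ : ℕ} {Δ : Finset (EuclideanSpace ℝ (Fin ℓ))} {g : ℂ} {U : Set ℂ}
  {q p : ℂ → Fin ℓ → ℂ} {τ z : ℂ}

lemma even_of_half_mem_periods (h : 0 < τ.im) {s t : ℤ} (hm : (s / 2 + t / 2 * τ : ℂ) ∈ periods τ) :
    Even s ∧ Even t := by
  obtain ⟨m, n, hmn⟩ := hm
  have him := congrArg Complex.im hmn
  have e1 : ((s / 2 + t / 2 * τ : ℂ)) = ((s / 2 : ℝ) : ℂ) + ((t / 2 : ℝ) : ℂ) * τ := by push_cast; ring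
  have e2 : ((m + n * τ : ℂ)) = ((m : ℝ) : ℂ) + ((n : ℝ) : ℂ) * τ := by push_cast; ring
  rw [e1, e2, Complex.add_im, Complex.add_im, Complex.ofReal_im, Complex.ofReal_im,
    Complex.im_ofReal_mul, Complex.im_ofReal_mul, zero_add, zero_add] at him
  have ht : (t / 2 : ℝ) = n := mul_right_cancel₀ h.ne' him
  rw [e1, e2, ht, add_left_inj, Complex.ofReal_inj] at hmn
  refine ⟨⟨m, ?_⟩, ⟨n, ?_⟩⟩
  · have : (s : ℝ) = m + m := by linarith
    exact_mod_cast this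
  · have : (t : ℝ) = n + n := by linarith
    exact_mod_cast this

/-- The four singular points are distinct on the torus. -/
lemma singularPoint_sub_notMem_periods (h : 0 < τ.im) {a b : Fin 4} (hab : a ≠ b) :
    singularPoint τ a - singularPoint τ b ∉ periods τ := by
  have key : ∀ s t : ℤ, ¬ (Even s ∧ Even t) → (s / 2 + t / 2 * τ : ℂ) ∉ periods τ :=
    fun s t hst hm => hst (even_of_half_mem_periods h hm)
  have key' : ∀ s t : ℤ, ¬ (Even s ∧ Even t) →
      singularPoint τ a - singularPoint τ b = s / 2 + t / 2 * τ →
      singularPoint τ a - singularPoint τ b ∉ periods τ := fun s t hst he => by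
    rw [he]; exact key s t hst
  fin_cases a <;> fin_cases b <;> simp only [ne_eq, not_true_eq_false] at hab
  · exact key' (-1) 0 (by decide) (by simp [singularPoint]; ring)
  · exact key' (-1) (-1) (by decide) (by simp [singularPoint]; ring)
  · exact key' 0 (-1) (by decide) (by simp [singularPoint]; ring)
  · exact key' 1 0 (by decide) (by simp [singularPoint])
  · exact key' 0 (-1) (by decide) (by simp [singularPoint]; ring)
  · exact key' 1 (-1) (by decide) (by simp [singularPoint]; ring)
  · exact key' 1 1 (by decide) (by simp [singularPoint]; ring)
  · exact key' 0 1 (by decide) (by simp [singularPoint]; ring)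
  · exact key' 1 0 (by decide) (by simp [singularPoint]; ring)
  · exact key' 0 1 (by decide) (by simp [singularPoint]; ring)
  · exact key' (-1) 1 (by decide) (by simp [singularPoint]; ring)
  · exact key' (-1) 0 (by decide) (by simp [singularPoint]; ring)

/-- The zeros of `θ₁` are simple. -/
lemma thetaD_one_ne_zero_of_mem (h : 0 < τ.im) (hz : z ∈ periods τ) : thetaD 1 τ z ≠ 0 := by
  intro h0
  have h1 : (1 / 2 : ℂ) ∉ periods τ := by
    have := singularPoint_sub_notMem_periods h (show (1 : Fin 4) ≠ 0 by decide)
    simpa [singularPoint] using this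
  have h2 : (1 / 4 : ℂ) ∉ periods τ := fun hm => h1 (by
    have := add_mem_periods hm hm
    rwa [show (1 / 4 + 1 / 4 : ℂ) = 1 / 2 by norm_num] at this)
  -- If θ₁ and θ₁' both vanished at z, the left side would be 0 at (1/4, 1/4, z), whereas the right
  -- side is θ₁'(0) θ₁(1/2) θ₁(1/4+z)² ≠ 0.
  have h3 := thetaD_addition h (1 / 4) (1 / 4) z
  rw [h0, theta1_eq_zero_of_mem τ hz] at h3
  have h4 := theta1_ne_zero h h2
  have h5 := theta1_ne_zero h h1
  have h6 : theta1 τ (1 / 4 + z) ≠ 0 := theta1_ne_zero h fun hm => h2 ((add_mem_periods_iff hz).1 hm)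
  have h7 := thetaD_one_zero_ne_zero h
  rw [show (1 / 4 + 1 / 4 : ℂ) = 1 / 2 by norm_num] at h3
  refine mul_ne_zero (mul_ne_zero (mul_ne_zero h7 h5) h6) h6 ?_
  rw [add_comm z] at h3
  linear_combination -h3

lemma analyticAt_theta1 (h : 0 < τ.im) (u : ℂ) : AnalyticAt ℂ (theta1 τ) u :=
  (differentiable_theta1 h).analyticAt u

lemma analyticAt_xker (h : 0 < τ.im) {u : ℂ} (hu : u ∉ periods τ) (hz : z ∉ periods τ) :
    AnalyticAt ℂ (fun w => xker τ u w) z := by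
  have h1 : AnalyticAt ℂ (fun w => theta1 τ (w - u)) z :=
    ((differentiable_theta1 h).comp (differentiable_id.sub_const u)).analyticAt z
  simp only [xker_eq h]
  exact (h1.fun_mul analyticAt_const).fun_div ((analyticAt_theta1 h z).fun_mul analyticAt_const)
    (mul_ne_zero (theta1_ne_zero h hz) (theta1_ne_zero h hu))

lemma exists_hasPolarForm_xker (h : 0 < τ.im) {u : ℂ} (hu : u ∉ periods τ) (hz : z ∈ periods τ) :
    ∃ c, c ≠ 0 ∧ HasPolarForm (fun w => xker τ u w) z c := by
  set A := dslope (theta1 τ) z with hA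
  have hAa : AnalyticAt ℂ A z := (differentiable_dslope (differentiable_theta1 h) z).analyticAt z
  have hAz : A z ≠ 0 := by
    rw [hA, dslope_same, deriv_theta1 h]
    exact thetaD_one_ne_zero_of_mem h hz
  have hθ : ∀ w, theta1 τ w = (w - z) * A w := fun w => by
    have := sub_smul_dslope (theta1 τ) z w
    rw [theta1_eq_zero_of_mem τ hz, sub_zero, smul_eq_mul] at this
    exact this.symm
  have hzu : z - u ∉ periods τ := fun hm => hu (by
    have := add_mem_periods (neg_mem_periods hm) hz
    simpa using this)
  have h1 : AnalyticAt ℂ (fun w => theta1 τ (w - u)) z :=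
    ((differentiable_theta1 h).comp (differentiable_id.sub_const u)).analyticAt z
  refine ⟨theta1 τ (z - u) * thetaD 1 τ 0 / (A z * theta1 τ u), ?_,
    fun w => theta1 τ (w - u) * thetaD 1 τ 0 / (A w * theta1 τ u), ?_, rfl, ?_⟩
  · exact div_ne_zero (mul_ne_zero (theta1_ne_zero h hzu) (thetaD_one_zero_ne_zero h))
      (mul_ne_zero hAz (theta1_ne_zero h hu))
  · exact (h1.fun_mul analyticAt_const).fun_div (hAa.fun_mul analyticAt_const)
      (mul_ne_zero hAz (theta1_ne_zero h hu))
  · refine Eventually.of_forall fun w => ?_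
    simp only [xker_eq h]
    rw [hθ w, mul_assoc, ← div_eq_inv_mul, div_div, mul_comm (w - z)]

lemma exists_hasPolarForm_xker' (h : 0 < τ.im) {u : ℂ} (hu : u ∉ periods τ) (z : ℂ) :
    ∃ c, HasPolarForm (fun w => xker τ u w) z c := by
  by_cases hz : z ∈ periods τ
  · obtain ⟨c, -, hc⟩ := exists_hasPolarForm_xker h hu hz
    exact ⟨c, hc⟩
  · exact ⟨0, (analyticAt_xker h hu hz).hasPolarForm⟩

lemma analyticAt_Lmat (hΔ : IsSimplyLacedRootSystem Δ) (hflow : IsFlow Δ g U q p) (hτ : τ ∈ U)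
    (h : 0 < τ.im) (hz : ¬ IsSingular τ z) (β γ : Δ) :
    AnalyticAt ℂ (fun w => Lmat Δ g q p τ w β γ) z := by
  obtain ⟨β, hβ⟩ := β
  obtain ⟨γ, hγ⟩ := γ
  have hz2 : 2 * z ∉ periods τ := fun hm => hz (isSingular_iff.2 hm)
  simp only [Lmat_eq hΔ, Matrix.add_apply, Matrix.smul_apply, smul_eq_mul, kerMat, Matrix.of_apply]
  refine analyticAt_const.fun_add (analyticAt_const.fun_mul (AnalyticAt.fun_add ?_ ?_))
  · split_ifs with hi
    · exact analyticAt_xker h (hflow.regular τ hτ _ (hΔ.sub_mem hβ hγ hi))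
        (notMem_periods_of_not_isSingular hz)
    · exact analyticAt_const
  · split_ifs with hi
    · exact analyticAt_const.fun_mul ((analyticAt_xker h (hflow.regular τ hτ _ hβ) hz2).fun_comp
        (analyticAt_const.fun_mul analyticAt_id))
    · exact analyticAt_const

lemma exists_hasPolarForm_Lmat (hΔ : IsSimplyLacedRootSystem Δ) (hflow : IsFlow Δ g U q p)
    (hτ : τ ∈ U) (h : 0 < τ.im) (z : ℂ) (β γ : Δ) :
    ∃ c, HasPolarForm (fun w => Lmat Δ g q p τ w β γ) z c := by
  obtain ⟨β, hβ⟩ := β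
  obtain ⟨γ, hγ⟩ := γ
  have h0 : ∀ a : ℂ, HasPolarForm (fun _ => a) z 0 := fun a => analyticAt_const.hasPolarForm
  obtain ⟨c, hc⟩ : ∃ c, HasPolarForm
      (fun w => if inner ℝ β γ = (1 : ℝ) then xker τ (cdot (β - γ) (q τ)) w else 0) z c := by
    split_ifs with hi
    · exact exists_hasPolarForm_xker' h (hflow.regular τ hτ _ (hΔ.sub_mem hβ hγ hi)) z
    · exact ⟨0, h0 0⟩
  obtain ⟨d, hd⟩ : ∃ c, HasPolarForm
      (fun w => if γ = -β then 2 * xker τ (cdot β (q τ)) (2 * w) else 0) z c := by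
    split_ifs with hi
    · obtain ⟨d, hd⟩ := exists_hasPolarForm_xker' h (hflow.regular τ hτ _ hβ) (2 * z)
      exact ⟨_, hd.comp_two_mul.const_mul 2⟩
    · exact ⟨0, h0 0⟩
  refine ⟨0 + I * g * (c + d), ?_⟩
  simp only [Lmat_eq hΔ, Matrix.add_apply, Matrix.smul_apply, smul_eq_mul, kerMat, Matrix.of_apply]
  exact (h0 _).add ((hc.add hd).const_mul (I * g))

/-- The entry (β, -β) is 2ig x(β·q, 2z) alone, and 2z is a period at each of the four points, so
nothing can cancel its pole. -/
lemma exists_meromorphicOrderAt_Lmat_eq (hΔ : IsSimplyLacedRootSystem Δ)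
    (hflow : IsFlow Δ g U q p) (hτ : τ ∈ U) (h : 0 < τ.im) (hz : IsSingular τ z) (hg : g ≠ 0)
    (hne : Δ.Nonempty) : ∃ β γ, meromorphicOrderAt (fun w => Lmat Δ g q p τ w β γ) z = -1 := by
  obtain ⟨β, hβ⟩ := hne
  have hββ := hΔ.norm_sq β hβ
  obtain ⟨c, hc0, hc⟩ := exists_hasPolarForm_xker h (hflow.regular τ hτ β hβ) (isSingular_iff.1 hz)
  refine ⟨⟨β, hβ⟩, ⟨-β, hΔ.neg_mem hβ⟩, ?_⟩
  have hd : (⟨β, hβ⟩ : Δ) ≠ ⟨-β, hΔ.neg_mem hβ⟩ := fun he => by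
    have := hββ
    nth_rewrite 1 [Subtype.mk.inj he] at this
    rw [inner_neg_left, hββ] at this; norm_num at this
  have h1 : ¬ ((-2 : ℝ) = 1) := by norm_num
  simp only [Lmat_eq hΔ, Matrix.add_apply, Matrix.smul_apply, smul_eq_mul, kerMat, Matrix.of_apply,
    dotMat, Matrix.diagonal_apply_ne _ hd, inner_neg_right, hββ, h1, if_true, if_false, zero_add]
  exact ((hc.comp_two_mul.const_mul 2).const_mul (I * g)).meromorphicOrderAt_eq
    (mul_ne_zero (mul_ne_zero I_ne_zero hg) (mul_ne_zero two_ne_zero (div_ne_zero hc0 two_ne_zero)))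

end Singularities

/-! ### Volterra operators on the unit interval. -/

section Volterra

set_option linter.unusedSectionVars false

variable {𝔸 : Type*} [NormedRing 𝔸] [NormedAlgebra ℂ 𝔸]

/-- A function on the unit interval, extended to `ℝ` by constants. -/
def extendI (f : C(unitInterval, 𝔸)) (t : ℝ) : 𝔸 := f (Set.projIcc 0 1 zero_le_one t)

lemma continuous_extendI (f : C(unitInterval, 𝔸)) : Continuous (extendI f) :=
  f.continuous.comp continuous_projIcc

lemma extendI_coe (f : C(unitInterval, 𝔸)) (s : unitInterval) : extendI f s = f s := by
  rw [extendI, Set.projIcc_val]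

lemma extendI_of_mem (f : C(unitInterval, 𝔸)) {t : ℝ} (ht : t ∈ unitInterval) :
    extendI f t = f ⟨t, ht⟩ := extendI_coe f ⟨t, ht⟩

lemma norm_extendI_le (f : C(unitInterval, 𝔸)) (t : ℝ) : ‖extendI f t‖ ≤ ‖f‖ :=
  f.norm_coe_le_norm _

lemma hasDerivAt_integral_extendI [CompleteSpace 𝔸] (f : C(unitInterval, 𝔸)) (t : ℝ) :
    HasDerivAt (fun s => ∫ u in (0 : ℝ)..s, extendI f u) (extendI f t) t :=
  ((continuous_extendI f).integral_hasStrictDerivAt 0 t).hasDerivAt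

/-- The primitive vanishing at `0`, as a linear operator on continuous functions. -/
def primitiveI [CompleteSpace 𝔸] : C(unitInterval, 𝔸) →L[ℂ] C(unitInterval, 𝔸) :=
  LinearMap.mkContinuous
    { toFun := fun f => ⟨fun s => ∫ u in (0 : ℝ)..s, extendI f u,
        (continuous_iff_continuousAt.2 fun t =>
          (hasDerivAt_integral_extendI f t).continuousAt).comp continuous_subtype_val⟩
      map_add' := fun f g => by
        ext s
        exact intervalIntegral.integral_add ((continuous_extendI f).intervalIntegrable _ _)
          ((continuous_extendI g).intervalIntegrable _ _)
      map_smul' := fun c f => by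
        ext s
        exact intervalIntegral.integral_smul c _ } 1 fun f => by
    rw [one_mul, ContinuousMap.norm_le _ (norm_nonneg f)]
    intro s
    have h1 : ‖∫ u in (0 : ℝ)..s, extendI f u‖ ≤ ‖f‖ * |(s : ℝ) - 0| :=
      intervalIntegral.norm_integral_le_of_norm_le_const fun u _ => norm_extendI_le f u
    rw [sub_zero, abs_of_nonneg s.2.1] at h1
    exact h1.trans (mul_le_of_le_one_right (norm_nonneg f) s.2.2)

variable [CompleteSpace 𝔸]

lemma primitiveI_apply (f : C(unitInterval, 𝔸)) (s : unitInterval) :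
    primitiveI f s = ∫ u in (0 : ℝ)..s, extendI f u := rfl

/-- The Volterra operator `f ↦ ∫ A f`. -/
def volterra : C(unitInterval, 𝔸) →L[ℂ] C(unitInterval, 𝔸) →L[ℂ] C(unitInterval, 𝔸) :=
  (ContinuousLinearMap.compL ℂ _ _ _ primitiveI).comp (ContinuousLinearMap.mul ℂ C(unitInterval, 𝔸))

lemma volterra_apply (A f : C(unitInterval, 𝔸)) : volterra A f = primitiveI (A * f) := rfl

/-- Integrating the bound for the n-th iterate produces the factor sⁿ⁺¹/(n+1)!, the volume of a
simplex. -/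
lemma norm_volterra_pow_apply_le (A f : C(unitInterval, 𝔸)) (n : ℕ) (s : unitInterval) :
    ‖((volterra A) ^ n) f s‖ ≤ ‖A‖ ^ n * (s : ℝ) ^ n / n.factorial * ‖f‖ := by
  induction n generalizing s with
  | zero => simpa using f.norm_coe_le_norm s
  | succ n ih =>
    rw [pow_succ', mul_apply_eq_comp, volterra_apply, primitiveI_apply]
    have h1 : ∀ u ∈ Set.Ioc (0 : ℝ) s, ‖extendI (A * ((volterra A) ^ n) f) u‖ ≤
        ‖A‖ ^ (n + 1) / n.factorial * ‖f‖ * u ^ n := by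
      intro u hu
      rw [extendI_of_mem _ ⟨hu.1.le, hu.2.trans s.2.2⟩, ContinuousMap.mul_apply]
      refine (norm_mul_le _ _).trans ((mul_le_mul (A.norm_coe_le_norm _) (ih _) (norm_nonneg _)
        (norm_nonneg _)).trans (le_of_eq ?_))
      simp only
      ring
    refine (intervalIntegral.norm_integral_le_of_norm_le s.2.1
      (Eventually.of_forall h1)
      ((by fun_prop : Continuous fun u : ℝ => _ * u ^ n).intervalIntegrable _ _)).trans (le_of_eq ?_)
    rw [intervalIntegral.integral_const_mul, integral_pow, Nat.factorial_succ]
    push_cast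
    have : (n.factorial : ℝ) ≠ 0 := by positivity
    field_simp
    ring

/-- The factors of 1 - xⁿ = (1 - x)(1 + x + … + xⁿ⁻¹) commute, so both are units when the product
is. -/
lemma isUnit_one_sub_of_norm_pow_lt_one {R : Type*} [NormedRing R] [CompleteSpace R] {x : R} {n : ℕ}
    (h : ‖x ^ n‖ < 1) : IsUnit (1 - x) := by
  have h3 : IsUnit (1 - x ^ n) := isUnit_one_sub_of_norm_lt_one h
  rw [← mul_neg_geom_sum] at h3
  have hc : Commute (1 - x) (∑ i ∈ Finset.range n, x ^ i) :=
    Commute.sum_right _ _ _ fun i _ => (Commute.one_left _).sub_left ((Commute.refl _).pow_right i)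
  exact (hc.isUnit_mul_iff.1 h3).1

/-- Some power of the operator is a contraction, so the equation is solvable on the whole interval
without smallness of A. -/
lemma isUnit_one_sub_volterra (A : C(unitInterval, 𝔸)) : IsUnit (1 - volterra A) := by
  have h1 := FloorSemiring.tendsto_pow_div_factorial_atTop ‖A‖
  obtain ⟨n, hn⟩ := (h1.eventually (gt_mem_nhds (zero_lt_one' ℝ))).exists
  have h2 : ‖(volterra A) ^ n‖ < 1 := by
    refine lt_of_le_of_lt (ContinuousLinearMap.opNorm_le_bound _ (by positivity) fun f => ?_) hn
    rw [ContinuousMap.norm_le _ (by positivity)]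
    refine fun s => (norm_volterra_pow_apply_le A f n s).trans ?_
    refine mul_le_mul_of_nonneg_right ?_ (norm_nonneg f)
    refine div_le_div_of_nonneg_right ?_ (by positivity)
    exact mul_le_of_le_one_right (by positivity) (pow_le_one₀ s.2.1 s.2.2)
  exact isUnit_one_sub_of_norm_pow_lt_one (R := C(unitInterval, 𝔸) →L[ℂ] C(unitInterval, 𝔸)) h2

end Volterra

/-! ### Linear equations with holomorphic parameters; parallel transport. -/

section ParameterDependence

variable {𝔸 : Type*} [NormedRing 𝔸] [NormedAlgebra ℂ 𝔸] [CompleteSpace 𝔸]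
  {E : Type*} [NormedAddCommGroup E] [NormedSpace ℂ E]

/-- A family of functions on the unit interval that depends holomorphically on a parameter is
differentiable as a map into the space of continuous functions. -/
lemma exists_hasFDerivAt_continuousMap [SecondCountableTopology 𝔸] [FiniteDimensional ℂ E] {X : Set E} (hX : IsOpen X) {a : E → ℂ → 𝔸}
    {Ω : Set (E × ℂ)} (hΩ : IsOpen Ω) (ha : DifferentiableOn ℂ (fun p : E × ℂ => a p.1 p.2) Ω)
    (hXΩ : ∀ x ∈ X, ∀ s : unitInterval, (x, ((s : ℝ) : ℂ)) ∈ Ω) :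
    ∃ A : E → C(unitInterval, 𝔸), (∀ x ∈ X, ∀ s, A x s = a x ((s : ℝ) : ℂ)) ∧
      ∀ x ∈ X, ∃ A' : E →L[ℂ] C(unitInterval, 𝔸), HasFDerivAt A A' x ∧
        ∀ v s, A' v s = fderiv ℂ (fun y => a y ((s : ℝ) : ℂ)) x v := by
  have hι : Continuous fun s : unitInterval => ((s : ℝ) : ℂ) :=
    Complex.continuous_ofReal.comp continuous_subtype_val
  have hcont : ∀ x ∈ X, Continuous fun s : unitInterval => a x ((s : ℝ) : ℂ) := fun x hx =>
    ha.continuousOn.comp_continuous (by fun_prop : Continuous fun s : unitInterval =>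
      (x, ((s : ℝ) : ℂ))) fun s => hXΩ x hx s
  let D : E × ℂ → E →L[ℂ] 𝔸 := fun p =>
    (fderiv ℂ (fun p : E × ℂ => a p.1 p.2) p).comp (ContinuousLinearMap.inl ℂ E ℂ)
  have hD : ∀ p ∈ Ω, HasFDerivAt (fun y => a y p.2) (D p) p.1 := fun p hp =>
    HasFDerivAt.comp (g := fun p : E × ℂ => a p.1 p.2) (f := fun y => (y, p.2)) p.1
      (ha.differentiableAt (hΩ.mem_nhds hp)).hasFDerivAt (hasFDerivAt_prodMk_left p.1 p.2)
  have hDc : ContinuousOn D Ω :=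
    (differentiableOn_fderiv hΩ ha).continuousOn.clm_comp continuousOn_const
  let A : E → C(unitInterval, 𝔸) := fun x =>
    if hx : x ∈ X then ⟨fun s => a x ((s : ℝ) : ℂ), hcont x hx⟩ else 0
  have hA : ∀ x ∈ X, ∀ s, A x s = a x ((s : ℝ) : ℂ) := fun x hx s => by
    simp only [A, dif_pos hx, ContinuousMap.coe_mk]
  refine ⟨A, hA, fun x hx => ?_⟩
  have hDx : Continuous fun s : unitInterval => D (x, ((s : ℝ) : ℂ)) :=
    hDc.comp_continuous (by fun_prop) fun s => hXΩ x hx s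
  let A' : E →L[ℂ] C(unitInterval, 𝔸) := LinearMap.toContinuousLinearMap
    { toFun := fun v => ⟨fun s => D (x, ((s : ℝ) : ℂ)) v, hDx.clm_apply continuous_const⟩
      map_add' := fun v w => by ext s; exact (D (x, ((s : ℝ) : ℂ))).map_add v w
      map_smul' := fun c v => by ext s; exact (D (x, ((s : ℝ) : ℂ))).map_smul c v }
  have hA' : ∀ v s, A' v s = D (x, ((s : ℝ) : ℂ)) v := fun v s => rfl
  refine ⟨A', ?_, fun v s => by rw [hA', (hD _ (hXΩ x hx s)).fderiv]⟩
  rw [hasFDerivAt_iff_isLittleO_nhds_zero, Asymptotics.isLittleO_iff]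
  intro ε hε
  -- Compactness of the interval makes the continuity of the derivative in the parameter uniform in
  -- s; the mean value inequality then bounds the remainder in the supremum norm.
  have h1 : ∀ᶠ y in 𝓝 x, ∀ s ∈ (Set.univ : Set unitInterval),
      ‖D (y, ((s : ℝ) : ℂ)) - D (x, ((s : ℝ) : ℂ))‖ < ε := by
    refine isCompact_univ.eventually_forall_of_forall_eventually
      (P := fun (y : E) (s : unitInterval) => ‖D (y, ((s : ℝ) : ℂ)) - D (x, ((s : ℝ) : ℂ))‖ < ε)
      fun s _ => ?_
    have c1 : ContinuousAt (fun w : E × unitInterval => D (w.1, ((w.2 : ℝ) : ℂ))) (x, s) :=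
      ContinuousAt.comp (g := D) (f := fun w : E × unitInterval => (w.1, ((w.2 : ℝ) : ℂ)))
        (hDc.continuousAt (hΩ.mem_nhds (hXΩ x hx s)))
        (by fun_prop : Continuous fun w : E × unitInterval => (w.1, ((w.2 : ℝ) : ℂ))).continuousAt
    have c2 : ContinuousAt (fun w : E × unitInterval => D (x, ((w.2 : ℝ) : ℂ))) (x, s) :=
      (hDx.comp continuous_snd).continuousAt
    have c3 := (c1.sub c2).norm
    refine c3.eventually (gt_mem_nhds ?_)
    simpa using hε
  obtain ⟨δ, hδ, hball⟩ := Metric.eventually_nhds_iff_ball.1 (h1.and (hX.mem_nhds hx))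
  filter_upwards [Metric.ball_mem_nhds (0 : E) hδ] with v hv
  have hv' : x + v ∈ Metric.ball x δ := by simpa using hv
  rw [ContinuousMap.norm_le _ (by positivity)]
  intro s
  simp only [ContinuousMap.sub_apply]
  rw [hA _ (hball _ hv').2, hA _ hx, hA']
  have := (convex_ball x δ).norm_image_sub_le_of_norm_hasFDerivWithin_le' (𝕜 := ℂ)
    (f := fun y => a y ((s : ℝ) : ℂ)) (f' := fun y => D (y, ((s : ℝ) : ℂ)))
    (φ := D (x, ((s : ℝ) : ℂ))) (C := ε)
    (fun y hy => (hD _ (hXΩ y (hball y hy).2 s)).hasFDerivWithinAt)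
    (fun y hy => ((hball y hy).1 s (Set.mem_univ s)).le) (Metric.mem_ball_self hδ) hv'
  simpa using this

/-- Solutions of linear fixed point equations depend differentiably on parameters. -/
lemma exists_eq_add_apply {Y : Type*} [NormedAddCommGroup Y] [NormedSpace ℂ Y] [CompleteSpace Y]
    (T : Y →L[ℂ] Y →L[ℂ] Y) (A : E → Y) (hA : ∀ x, IsUnit (1 - T (A x))) (c : E → Y) :
    ∃ h : E → Y, (∀ x, h x = c x + T (A x) (h x)) ∧
      ∀ x, DifferentiableAt ℂ A x → DifferentiableAt ℂ c x → DifferentiableAt ℂ h x := by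
  refine ⟨fun x => Ring.inverse (1 - T (A x)) (c x), fun x => ?_, fun x hAx hcx => ?_⟩
  · have h1 := Ring.mul_inverse_cancel _ (hA x)
    have h2 := congrArg (fun T : Y →L[ℂ] Y => T (c x)) h1
    simp only [mul_apply_eq_comp, sub_apply, one_apply_eq_self] at h2
    exact sub_eq_iff_eq_add.1 h2
  · have h2 : DifferentiableAt ℂ (fun y => Ring.inverse (1 - T (A y))) x :=
      DifferentiableAt.comp (f := fun y => 1 - T (A y)) x (differentiableAt_inverse (hA x))
        ((T.differentiableAt.comp x hAx).const_sub 1)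
    exact h2.clm_apply hcx

/-- The solution of the Volterra equation depends differentiably on the parameters, and its
derivative satisfies the linearized equation. -/
lemma exists_volterra_solution (A : E → C(unitInterval, 𝔸)) (G : E → 𝔸) :
    ∃ h : E → C(unitInterval, 𝔸),
      (∀ x s, h x s = G x + ∫ u in (0 : ℝ)..s, extendI (A x * h x) u) ∧
      ∀ (x : E) (A' : E →L[ℂ] C(unitInterval, 𝔸)) (G' : E →L[ℂ] 𝔸), HasFDerivAt A A' x → HasFDerivAt G G' x → ∃ h' : E →L[ℂ] C(unitInterval, 𝔸),
        HasFDerivAt h h' x ∧ ∀ v s, h' v s =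
          G' v + ∫ u in (0 : ℝ)..s, extendI (A x * h' v + A' v * h x) u := by
  let cst : 𝔸 →L[ℂ] C(unitInterval, 𝔸) := ContinuousLinearMap.const ℂ unitInterval
  obtain ⟨h, hh, hhd⟩ := exists_eq_add_apply (volterra (𝔸 := 𝔸)) A
    (fun x => isUnit_one_sub_volterra (A x)) (fun x => cst (G x))
  refine ⟨h, fun x s => congrArg (fun f : C(unitInterval, 𝔸) => f s) (hh x),
    fun x A' G' hA' hG' => ?_⟩
  have hc : HasFDerivAt (fun y => cst (G y)) (cst.comp G') x :=
    HasFDerivAt.comp (f := G) x cst.hasFDerivAt hG'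
  have hhx := (hhd x hA'.differentiableAt hc.differentiableAt).hasFDerivAt
  refine ⟨_, hhx, fun v s => ?_⟩
  set h' := fderiv ℂ h x
  have hm := hA'.fun_mul' hhx
  have hp := HasFDerivAt.comp (f := fun y => A y * h y) x (primitiveI (𝔸 := 𝔸)).hasFDerivAt hm
  have d2 := hhx.unique ((hc.fun_add hp).congr_of_eventuallyEq (Eventually.of_forall hh))
  exact congrArg (fun T : E →L[ℂ] C(unitInterval, 𝔸) => T v s) d2

/-- Parallel transport along a holomorphic family of curves: the solution of `∂h/∂s = a h` with
initial value `G`, evaluated at `s = 1`, is horizontal if the curvature vanishes. -/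
theorem exists_parallel_transport [SecondCountableTopology 𝔸] [FiniteDimensional ℂ E] {X : Set E} (hX : IsOpen X) {a : E → ℂ → 𝔸}
    {Ω : Set (E × ℂ)} (hΩ : IsOpen Ω) (ha : DifferentiableOn ℂ (fun p : E × ℂ => a p.1 p.2) Ω)
    (hXΩ : ∀ x ∈ X, ∀ s : unitInterval, (x, ((s : ℝ) : ℂ)) ∈ Ω) {G : E → 𝔸}
    (hG : DifferentiableOn ℂ G X) {B : E → E → ℝ → 𝔸}
    (hB : ∀ x ∈ X, ∀ v, ∀ s ∈ unitInterval, HasDerivAt (B x v)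
      (fderiv ℂ (fun y => a y s) x v + (a x s * B x v s - B x v s * a x s)) s)
    (hB0 : ∀ x ∈ X, ∀ v, fderiv ℂ G x v = B x v 0 * G x) :
    ∃ F : E → 𝔸, DifferentiableOn ℂ F X ∧ (∀ x ∈ X, ∀ v, fderiv ℂ F x v = B x v 1 * F x) ∧
      ∀ x ∈ X, (∀ s : unitInterval, a x ((s : ℝ) : ℂ) = 0) → F x = G x := by
  obtain ⟨A, hA, hAd⟩ := exists_hasFDerivAt_continuousMap hX hΩ ha hXΩ
  obtain ⟨h, hh, hhd⟩ := exists_volterra_solution A G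
  let ev : C(unitInterval, 𝔸) →L[ℂ] 𝔸 := ContinuousMap.evalCLM ℂ (1 : unitInterval)
  refine ⟨fun x => h x 1, fun x hx => ?_, fun x hx v => ?_, fun x hx h0 => ?_⟩
  · obtain ⟨A', hA', -⟩ := hAd x hx
    obtain ⟨h', hh', -⟩ := hhd x A' _ hA' (hG.differentiableAt (hX.mem_nhds hx)).hasFDerivAt
    exact (HasFDerivAt.comp (f := h) x ev.hasFDerivAt hh').differentiableAt.differentiableWithinAt
  · obtain ⟨A', hA', hA'v⟩ := hAd x hx
    obtain ⟨h', hh', hh'v⟩ := hhd x A' _ hA' (hG.differentiableAt (hX.mem_nhds hx)).hasFDerivAt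
    have e1 : HasFDerivAt (fun x => h x 1) (ev.comp h') x :=
      HasFDerivAt.comp (f := h) x ev.hasFDerivAt hh'
    rw [e1.fderiv]
    let H : ℝ → 𝔸 := fun t => G x + ∫ u in (0 : ℝ)..t, extendI (A x * h x) u
    let H' : ℝ → 𝔸 := fun t =>
      fderiv ℂ G x v + ∫ u in (0 : ℝ)..t, extendI (A x * h' v + A' v * h x) u
    have hH : ∀ s : unitInterval, h x s = H s := hh x
    have hH' : ∀ s : unitInterval, h' v s = H' s := hh'v v
    -- H is the solution, H' its variation in the direction v. By `hB` the defect H' - B H satisfies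
    -- the homogeneous equation with coefficient a; it vanishes at 0, hence everywhere by Gronwall's
    -- inequality.
    have hk : ∀ t ∈ unitInterval, HasDerivAt (fun t => H' t - B x v t * H t)
        (a x t * (H' t - B x v t * H t)) t := fun t ht => by
      have k1 : HasDerivAt H' (extendI (A x * h' v + A' v * h x) t) t :=
        (hasDerivAt_integral_extendI _ t).const_add _
      have k2 : HasDerivAt H (extendI (A x * h x) t) t :=
        (hasDerivAt_integral_extendI _ t).const_add _
      refine (k1.sub ((hB x hx v t ht).mul k2)).congr_deriv ?_
      rw [extendI_of_mem _ ht, extendI_of_mem _ ht]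
      simp only [ContinuousMap.add_apply, ContinuousMap.mul_apply, hA x hx, hA'v, hH, hH']
      noncomm_ring
    have hk0 := eq_zero_of_abs_deriv_le_mul_abs_self_of_eq_zero_right (K := ‖A x‖) (a := 0) (b := 1)
      (f := fun t => H' t - B x v t * H t) (f' := fun t => a x t * (H' t - B x v t * H t))
      (fun t ht => (hk t ht).continuousAt.continuousWithinAt)
      (fun t ht => (hk t ⟨ht.1, ht.2.le⟩).hasDerivWithinAt)
      (by simp [H, H', hB0 x hx v])
      (fun t ht => by
        refine (norm_mul_le _ _).trans (mul_le_mul_of_nonneg_right ?_ (norm_nonneg _))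
        have := (A x).norm_coe_le_norm ⟨t, ht.1, ht.2.le⟩
        rwa [hA x hx] at this)
      1 ⟨zero_le_one, le_rfl⟩
    change h' v 1 = B x v 1 * h x 1
    rw [hH' 1, hH 1]
    exact sub_eq_zero.1 hk0
  · have h1 : A x = 0 := by ext s; rw [hA x hx, h0 s]; rfl
    have h2 : ∀ u, extendI (A x * h x) u = 0 := fun u => by rw [h1, zero_mul]; rfl
    change h x 1 = G x
    rw [hh x 1]
    simp only [h2, intervalIntegral.integral_zero, add_zero]

end ParameterDependence

/-! ### Holomorphic linear equations and flat connections. -/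

section LinearODE

variable {𝔸 : Type*} [NormedRing 𝔸] [NormedAlgebra ℂ 𝔸]

/-- Uniqueness for holomorphic linear differential equations on a connected open set. -/
lemma eq_zero_of_hasDerivAt_mul {V : Set ℂ} (hV : IsOpen V) (hVc : IsPreconnected V) {A f : ℂ → 𝔸}
    (hA : ContinuousOn A V) (hf : ∀ z ∈ V, HasDerivAt f (A z * f z) z) {z₁ : ℂ} (h₁ : z₁ ∈ V)
    (hf₁ : f z₁ = 0) : ∀ z ∈ V, f z = 0 := by
  have hball : ∀ z ∈ V, ∃ r > 0, ∀ w ∈ Metric.ball z r, f w = 0 → ∀ w' ∈ Metric.ball z r, f w' = 0 := by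
    intro z hz
    have hb : ∀ᶠ w in 𝓝 z, ‖A w‖ < ‖A z‖ + 1 :=
      (hA.continuousAt (hV.mem_nhds hz)).norm.eventually (gt_mem_nhds (lt_add_one _))
    obtain ⟨r, hr, hball⟩ := Metric.eventually_nhds_iff_ball.1 (hb.and (hV.mem_nhds hz))
    refine ⟨r, hr, fun w hw hw0 w' hw' => ?_⟩
    have hseg : ∀ t ∈ Set.Icc (0 : ℝ) 1, w + (t : ℂ) * (w' - w) ∈ Metric.ball z r := fun t ht => by
      have := (convex_ball z r).add_smul_sub_mem hw hw' ht
      rwa [Complex.real_smul] at this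
    have hd : ∀ t ∈ Set.Icc (0 : ℝ) 1, HasDerivAt (fun t : ℝ => f (w + (t : ℂ) * (w' - w)))
        ((w' - w) • (A (w + (t : ℂ) * (w' - w)) * f (w + (t : ℂ) * (w' - w)))) t := fun t ht => by
      have h1 : HasDerivAt (fun t : ℝ => w + (t : ℂ) * (w' - w)) (w' - w) t := by
        have := ((hasDerivAt_id t).ofReal_comp.mul_const (w' - w)).const_add w
        simpa using this
      exact (hf _ (hball _ (hseg t ht)).2).scomp t h1
    have := eq_zero_of_abs_deriv_le_mul_abs_self_of_eq_zero_right
      (K := ‖w' - w‖ * (‖A z‖ + 1)) (a := 0) (b := 1)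
      (fun t ht => (hd t ht).continuousAt.continuousWithinAt)
      (fun t ht => (hd t ⟨ht.1, ht.2.le⟩).hasDerivWithinAt) (by simpa using hw0)
      (fun t ht => by
        rw [norm_smul, mul_assoc]
        refine mul_le_mul_of_nonneg_left ((norm_mul_le _ _).trans ?_) (norm_nonneg _)
        exact mul_le_mul_of_nonneg_right (hball _ (hseg t ⟨ht.1, ht.2.le⟩)).1.le (norm_nonneg _))
      1 ⟨zero_le_one, le_rfl⟩
    simpa using this
  -- The set near whose points f vanishes is open and, by the local statement, closed in V.
  have hsub : V ⊆ {z | ∀ᶠ w in 𝓝 z, f w = 0} := by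
    refine hVc.subset_of_closure_inter_subset isOpen_setOfPred_eventually_nhds ⟨z₁, h₁, ?_⟩ ?_
    · obtain ⟨r, hr, h⟩ := hball z₁ h₁
      exact Filter.mem_of_superset (Metric.ball_mem_nhds z₁ hr) fun w hw =>
        h z₁ (Metric.mem_ball_self hr) hf₁ w hw
    · rintro z ⟨hz, hzV⟩
      obtain ⟨r, hr, h⟩ := hball z hzV
      obtain ⟨w, hw, hwz⟩ := Metric.mem_closure_iff.1 hz r hr
      refine Filter.mem_of_superset (Metric.ball_mem_nhds z hr) fun w' hw' =>
        h w (by rwa [Metric.mem_ball, dist_comm]) (show ∀ᶠ y in 𝓝 w, f y = 0 from hw).self_of_nhds w' hw'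
  exact fun z hz => (show ∀ᶠ y in 𝓝 z, f y = 0 from hsub hz).self_of_nhds

variable [CompleteSpace 𝔸] [SecondCountableTopology 𝔸]

/-- Existence for holomorphic linear differential equations on a convex open set. -/
lemma exists_hasDerivAt_mul {V : Set ℂ} (hV : IsOpen V) (hVc : Convex ℝ V) {A : ℂ → 𝔸}
    (hA : DifferentiableOn ℂ A V) {z₀ : ℂ} (h₀ : z₀ ∈ V) (Y₀ : 𝔸) :
    ∃ f : ℂ → 𝔸, f z₀ = Y₀ ∧ ∀ z ∈ V, HasDerivAt f (A z * f z) z := by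
  have hσ : Continuous fun p : ℂ × ℂ => z₀ + p.2 * (p.1 - z₀) := by fun_prop
  have hmem : ∀ x ∈ V, ∀ s : unitInterval, z₀ + ((s : ℝ) : ℂ) * (x - z₀) ∈ V := fun x hx s => by
    have := hVc.add_smul_sub_mem h₀ hx s.2
    rwa [Complex.real_smul] at this
  have hAd : ∀ z ∈ V, HasDerivAt A (deriv A z) z := fun z hz =>
    (hA.differentiableAt (hV.mem_nhds hz)).hasDerivAt
  obtain ⟨F, hF, hF', hF0⟩ := exists_parallel_transport hV
    (a := fun z s => (z - z₀) • A (z₀ + s * (z - z₀))) (hV.preimage hσ)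
    (fun p hp => by
      have h1 : DifferentiableAt ℂ (fun p : ℂ × ℂ => z₀ + p.2 * (p.1 - z₀)) p := by fun_prop
      have h2 : DifferentiableAt ℂ (fun p : ℂ × ℂ => A (z₀ + p.2 * (p.1 - z₀))) p :=
        DifferentiableAt.comp (f := fun p : ℂ × ℂ => z₀ + p.2 * (p.1 - z₀)) p
          (hAd _ hp).differentiableAt h1
      exact ((by fun_prop : DifferentiableAt ℂ (fun p : ℂ × ℂ => p.1 - z₀) p).fun_smul
        h2).differentiableWithinAt)
    hmem (G := fun _ => Y₀) (differentiableOn_const _)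
    -- When the endpoint moves by v, the point z₀ + s(z - z₀) moves by sv; B is the connection form
    -- on that vector.
    (B := fun z v s => (v * s) • A (z₀ + s * (z - z₀)))
    (fun z hz v s hs => by
      have hm := hmem z hz ⟨s, hs⟩
      have e1 : HasDerivAt (fun w : ℂ => (w - z₀) • A (z₀ + s * (w - z₀)))
          ((z - z₀) • ((s : ℂ) • deriv A (z₀ + s * (z - z₀))) + (1 : ℂ) • A (z₀ + s * (z - z₀))) z := by
        have h1 : HasDerivAt (fun w : ℂ => z₀ + (s : ℂ) * (w - z₀)) s z := by
          simpa using (((hasDerivAt_id z).sub_const z₀).const_mul (s : ℂ)).const_add z₀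
        exact ((hasDerivAt_id' z).sub_const z₀).fun_smul ((hAd _ hm).scomp z h1)
      have e2 : HasDerivAt (fun t : ℝ => (v * (t : ℂ)) • A (z₀ + t * (z - z₀)))
          ((v * s) • ((z - z₀) • deriv A (z₀ + s * (z - z₀))) + v • A (z₀ + s * (z - z₀))) s := by
        have h1 : HasDerivAt (fun t : ℝ => z₀ + (t : ℂ) * (z - z₀)) (z - z₀) s := by
          have := ((hasDerivAt_id s).ofReal_comp.mul_const (z - z₀)).const_add z₀
          simpa using this
        have h2 : HasDerivAt (fun t : ℝ => v * (t : ℂ)) v s := by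
          have := (hasDerivAt_id s).ofReal_comp.const_mul v
          simpa using this
        exact h2.fun_smul ((hAd _ hm).scomp s h1)
      refine e2.congr_deriv ?_
      rw [fderiv_eq_smul_deriv, e1.deriv]
      simp only [smul_mul_assoc, mul_smul_comm]
      module)
    (fun z hz v => by simp)
  refine ⟨F, hF0 z₀ h₀ fun s => by simp, fun z hz => ?_⟩
  refine (hF.differentiableAt (hV.mem_nhds hz)).hasDerivAt.congr_deriv ?_
  rw [← fderiv_apply_one_eq_deriv, hF' z hz]
  simp

/-- A flat holomorphic connection `∂F/∂z = L F`, `∂F/∂τ = N F` in two variables: a solution given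
on a line `z = b₁ + b₂ τ` extends along the fibres. -/
lemma exists_horizontal_extension {D W : Set (ℂ × ℂ)} (hD : IsOpen D) (hW : IsOpen W)
    {L N : ℂ × ℂ → 𝔸} (hL : DifferentiableOn ℂ L D) (hN : DifferentiableOn ℂ N D)
    (hflat : ∀ x ∈ D, fderiv ℂ L x (1, 0) - fderiv ℂ N x (0, 1) = N x * L x - L x * N x)
    {b₁ b₂ : ℂ} (hWD : ∀ x ∈ W, ∀ s : unitInterval,
      (x.1, b₁ + b₂ * x.1 + ((s : ℝ) : ℂ) * (x.2 - (b₁ + b₂ * x.1))) ∈ D)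
    {G : ℂ → 𝔸} (hG : ∀ x ∈ W, HasDerivAt G
      ((b₂ • L (x.1, b₁ + b₂ * x.1) + N (x.1, b₁ + b₂ * x.1)) * G x.1) x.1) :
    ∃ F : ℂ × ℂ → 𝔸, DifferentiableOn ℂ F W ∧
      (∀ x ∈ W, ∀ v, fderiv ℂ F x v = (v.2 • L x + v.1 • N x) * F x) ∧
      ∀ t, (t, b₁ + b₂ * t) ∈ W → F (t, b₁ + b₂ * t) = G t := by
  have hσ : Differentiable ℂ fun p : (ℂ × ℂ) × ℂ =>
    (p.1.1, b₁ + b₂ * p.1.1 + p.2 * (p.1.2 - (b₁ + b₂ * p.1.1))) := by fun_prop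
  have hLd : ∀ x ∈ D, HasFDerivAt L (fderiv ℂ L x) x := fun x hx =>
    (hL.differentiableAt (hD.mem_nhds hx)).hasFDerivAt
  have hNd : ∀ x ∈ D, HasFDerivAt N (fderiv ℂ N x) x := fun x hx =>
    (hN.differentiableAt (hD.mem_nhds hx)).hasFDerivAt
  obtain ⟨F, hF, hF', hF0⟩ := exists_parallel_transport hW
    (a := fun x s => (x.2 - (b₁ + b₂ * x.1)) •
      L (x.1, b₁ + b₂ * x.1 + s * (x.2 - (b₁ + b₂ * x.1)))) (hD.preimage hσ.continuous)
    (fun p hp => by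
      have h2 := DifferentiableAt.comp (f := fun p : (ℂ × ℂ) × ℂ =>
        (p.1.1, b₁ + b₂ * p.1.1 + p.2 * (p.1.2 - (b₁ + b₂ * p.1.1)))) p
          (hLd _ hp).differentiableAt (hσ p)
      exact ((by fun_prop : DifferentiableAt ℂ (fun p : (ℂ × ℂ) × ℂ =>
        p.1.2 - (b₁ + b₂ * p.1.1)) p).fun_smul h2).differentiableWithinAt)
    hWD (G := fun x => G x.1)
    (fun x hx => ((hG x hx).differentiableAt.comp x differentiableAt_fst).differentiableWithinAt)
    -- When x moves by v, the point of the segment at parameter s moves by (v₁, b₂v₁ + s(v₂ -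
    -- b₂v₁)). B is the connection form on that vector; its derivative in s is governed by flatness.
    (B := fun x v s => (b₂ * v.1 + s * (v.2 - b₂ * v.1)) •
        L (x.1, b₁ + b₂ * x.1 + s * (x.2 - (b₁ + b₂ * x.1))) +
      v.1 • N (x.1, b₁ + b₂ * x.1 + s * (x.2 - (b₁ + b₂ * x.1))))
    (fun x hx v s hs => by
      have hm := hWD x hx ⟨s, hs⟩
      set ζ := x.2 - (b₁ + b₂ * x.1) with hζ
      set σ : ℂ × ℂ := (x.1, b₁ + b₂ * x.1 + s * ζ) with hσ'
      have c1 : HasDerivAt (fun t : ℝ => b₁ + b₂ * x.1 + (t : ℂ) * ζ) ζ s := by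
        have := ((hasDerivAt_id s).ofReal_comp.mul_const ζ).const_add (b₁ + b₂ * x.1)
        simpa using this
      have c2 : HasDerivAt (fun t : ℝ => (x.1, b₁ + b₂ * x.1 + (t : ℂ) * ζ)) ((0 : ℂ), ζ) s :=
        (hasDerivAt_const s x.1).prodMk c1
      have c3 : HasDerivAt (fun t : ℝ => b₂ * v.1 + (t : ℂ) * (v.2 - b₂ * v.1)) (v.2 - b₂ * v.1) s := by
        have := ((hasDerivAt_id s).ofReal_comp.mul_const (v.2 - b₂ * v.1)).const_add (b₂ * v.1)
        simpa using this
      have dL : HasDerivAt (fun t : ℝ => L (x.1, b₁ + b₂ * x.1 + (t : ℂ) * ζ))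
          (fderiv ℂ L σ (0, ζ)) s :=
        HasFDerivAt.comp_hasDerivAt (f := fun t : ℝ => (x.1, b₁ + b₂ * x.1 + (t : ℂ) * ζ)) s
          ((hLd σ hm).restrictScalars ℝ) c2
      have dN : HasDerivAt (fun t : ℝ => N (x.1, b₁ + b₂ * x.1 + (t : ℂ) * ζ))
          (fderiv ℂ N σ (0, ζ)) s :=
        HasFDerivAt.comp_hasDerivAt (f := fun t : ℝ => (x.1, b₁ + b₂ * x.1 + (t : ℂ) * ζ)) s
          ((hNd σ hm).restrictScalars ℝ) c2
      have k1 : HasFDerivAt (fun y : ℂ × ℂ => y.2 - (b₁ + b₂ * y.1))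
          (ContinuousLinearMap.snd ℂ ℂ ℂ - b₂ • ContinuousLinearMap.fst ℂ ℂ ℂ) x :=
        hasFDerivAt_snd.fun_sub ((hasFDerivAt_fst.const_mul b₂).const_add b₁)
      have k2 : HasFDerivAt (fun y : ℂ × ℂ => b₁ + b₂ * y.1 + (s : ℂ) * (y.2 - (b₁ + b₂ * y.1)))
          (b₂ • ContinuousLinearMap.fst ℂ ℂ ℂ + (s : ℂ) • (ContinuousLinearMap.snd ℂ ℂ ℂ -
            b₂ • ContinuousLinearMap.fst ℂ ℂ ℂ)) x :=
        ((hasFDerivAt_fst.const_mul b₂).const_add b₁).fun_add (k1.const_mul (s : ℂ))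
      have k3 : HasFDerivAt (fun y : ℂ × ℂ =>
          L (y.1, b₁ + b₂ * y.1 + (s : ℂ) * (y.2 - (b₁ + b₂ * y.1)))) _ x :=
        HasFDerivAt.comp (f := fun y : ℂ × ℂ =>
        (y.1, b₁ + b₂ * y.1 + (s : ℂ) * (y.2 - (b₁ + b₂ * y.1)))) x (hLd σ hm)
        (hasFDerivAt_fst.prodMk k2)
      have k4 : fderiv ℂ (fun y : ℂ × ℂ => (y.2 - (b₁ + b₂ * y.1)) •
          L (y.1, b₁ + b₂ * y.1 + (s : ℂ) * (y.2 - (b₁ + b₂ * y.1)))) x v =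
          ζ • fderiv ℂ L σ (v.1, b₂ * v.1 + s * (v.2 - b₂ * v.1)) + (v.2 - b₂ * v.1) • L σ := by
        rw [(k1.fun_smul k3).fderiv]
        rfl
      have l1 : ∀ (T : ℂ × ℂ →L[ℂ] 𝔸) (y w : ℂ), T (y, w) = y • T (1, 0) + w • T (0, 1) :=
        fun T y w => by
          rw [← map_smul, ← map_smul, ← map_add]
          simp
      refine ((c3.fun_smul dL).fun_add (dN.const_smul v.1)).congr_deriv ?_
      rw [k4, l1 _ 0 ζ, l1 _ 0 ζ, l1 _ v.1, sub_eq_iff_eq_add.1 (hflat σ hm)]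
      simp only [smul_mul_assoc, mul_smul_comm, mul_add, add_mul]
      module)
    (fun x hx v => by
      have k1 : HasFDerivAt (fun y : ℂ × ℂ => G y.1) _ x :=
        HasFDerivAt.comp (f := fun y : ℂ × ℂ => y.1) x (hG x hx).hasFDerivAt hasFDerivAt_fst
      have k2 : fderiv ℂ (fun y : ℂ × ℂ => G y.1) x v = v.1 •
          ((b₂ • L (x.1, b₁ + b₂ * x.1) + N (x.1, b₁ + b₂ * x.1)) * G x.1) := by
        rw [k1.fderiv]
        rfl
      rw [k2]
      simp only [Complex.ofReal_zero, zero_mul, add_zero, add_mul, smul_mul_assoc]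
      module)
  refine ⟨F, hF, fun x hx v => ?_, fun t ht => hF0 _ ht fun s => ?_⟩
  · rw [hF' x hx]
    simp only [Complex.ofReal_one, one_mul, add_sub_cancel]
  · simp

end LinearODE

/-! ### Continuation along paths and the monodromy matrix. -/

section Transport

variable {𝔸 : Type*} [NormedRing 𝔸] [NormedAlgebra ℂ 𝔸]

lemma isUnit_of_mul_eq_zero_imp [FiniteDimensional ℂ 𝔸] {a : 𝔸} (h : ∀ b, a * b = 0 → b = 0) :
    IsUnit a := by
  have hinj : Function.Injective (LinearMap.mulLeft ℂ a) :=
    (injective_iff_map_eq_zero _).2 fun b hb => h b hb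
  obtain ⟨b, hb⟩ := (LinearMap.injective_iff_surjective.1 hinj) 1
  rw [LinearMap.mulLeft_apply] at hb
  refine isUnit_iff_exists.2 ⟨b, hb, sub_eq_zero.1 (h _ ?_)⟩
  rw [mul_sub, ← mul_assoc, hb, one_mul, mul_one, sub_self]

/-- If f(z₂)b = 0, then f b solves the same equation with a zero, so f(z₁)b = 0 and b = 0; in finite
dimension this makes f(z₂) a unit. -/
lemma isUnit_of_hasDerivAt_mul [FiniteDimensional ℂ 𝔸] {V : Set ℂ} (hV : IsOpen V)
    (hVc : IsPreconnected V) {A f : ℂ → 𝔸} (hA : ContinuousOn A V)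
    (hf : ∀ z ∈ V, HasDerivAt f (A z * f z) z) {z₁ z₂ : ℂ} (h₁ : z₁ ∈ V) (h₂ : z₂ ∈ V)
    (hu : IsUnit (f z₁)) : IsUnit (f z₂) := by
  refine isUnit_of_mul_eq_zero_imp fun b hb => ?_
  have := eq_zero_of_hasDerivAt_mul (f := fun z => f z * b) hV hVc hA
    (fun z hz => ((hf z hz).mul_const b).congr_deriv (mul_assoc _ _ _)) h₂ hb z₁ h₁
  exact (hu.mul_right_eq_zero).1 this

/-- `F` is a horizontal section at `x` of the connection `∂F/∂z = L F`, `∂F/∂τ = N F`. -/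
def IsHorizontalAt (L N F : ℂ × ℂ → 𝔸) (x : ℂ × ℂ) : Prop :=
  DifferentiableAt ℂ F x ∧ ∀ v : ℂ × ℂ, fderiv ℂ F x v = (v.2 • L x + v.1 • N x) * F x

/-- `Φ` is a horizontal section continued analytically along the path `c`. -/
def IsTransportAlong (L N : ℂ × ℂ → 𝔸) (V : Set ℂ) {b e : ℝ × ℝ} (c : Path b e)
    (Φ : unitInterval → ℂ → 𝔸) : Prop :=
  ∀ s, ∀ τ ∈ V, ∃ F : ℂ × ℂ → 𝔸,
    (∀ᶠ w in 𝓝 (τ, torusPoint (c s) τ), IsHorizontalAt L N F w) ∧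
    ∀ᶠ r in 𝓝 (s, τ), Φ r.1 r.2 = F (r.2, torusPoint (c r.1) r.2)

/-- The condition `flat` is the equality of mixed derivatives of F forced by ∂F/∂z = L F and ∂F/∂τ =
N F. -/
structure IsFlatConnection (L N : ℂ × ℂ → 𝔸) (D : Set (ℂ × ℂ)) : Prop where
  isOpen : IsOpen D
  differentiableOn_left : DifferentiableOn ℂ L D
  differentiableOn_right : DifferentiableOn ℂ N D
  flat : ∀ x ∈ D, fderiv ℂ L x (1, 0) - fderiv ℂ N x (0, 1) = N x * L x - L x * N x

lemma IsHorizontalAt.hasDerivAt_snd {L N F : ℂ × ℂ → 𝔸} {τ z : ℂ}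
    (h : IsHorizontalAt L N F (τ, z)) :
    HasDerivAt (fun w => F (τ, w)) (L (τ, z) * F (τ, z)) z := by
  have h1 : HasDerivAt (fun w : ℂ => (τ, w)) ((0 : ℂ), (1 : ℂ)) z :=
    (hasDerivAt_const z τ).prodMk (hasDerivAt_id z)
  refine (HasFDerivAt.comp_hasDerivAt (f := fun w : ℂ => (τ, w)) z h.1.hasFDerivAt h1).congr_deriv ?_
  rw [h.2]
  simp

lemma IsHorizontalAt.hasDerivAt_fst {L N F : ℂ × ℂ → 𝔸} {τ z : ℂ}
    (h : IsHorizontalAt L N F (τ, z)) :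
    HasDerivAt (fun t => F (t, z)) (N (τ, z) * F (τ, z)) τ := by
  have h1 : HasDerivAt (fun t : ℂ => (t, z)) ((1 : ℂ), (0 : ℂ)) τ :=
    (hasDerivAt_id τ).prodMk (hasDerivAt_const τ z)
  refine (HasFDerivAt.comp_hasDerivAt (f := fun t : ℂ => (t, z)) τ h.1.hasFDerivAt h1).congr_deriv ?_
  rw [h.2]
  simp

lemma hasDerivAt_torusPoint (c : ℝ × ℝ) (τ : ℂ) : HasDerivAt (torusPoint c) (c.2 : ℂ) τ := by
  exact (((hasDerivAt_id τ).const_mul (c.2 : ℂ)).const_add (c.1 : ℂ)).congr_deriv (mul_one _)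

lemma IsHorizontalAt.hasDerivAt_torusPoint {L N F : ℂ × ℂ → 𝔸} {c : ℝ × ℝ} {τ : ℂ}
    (h : IsHorizontalAt L N F (τ, torusPoint c τ)) :
    HasDerivAt (fun t => F (t, torusPoint c t))
      (((c.2 : ℂ) • L (τ, torusPoint c τ) + N (τ, torusPoint c τ)) * F (τ, torusPoint c τ)) τ := by
  have h1 : HasDerivAt (fun t : ℂ => (t, torusPoint c t)) ((1 : ℂ), (c.2 : ℂ)) τ :=
    (hasDerivAt_id τ).prodMk (EllipticCM.hasDerivAt_torusPoint c τ)
  refine (HasFDerivAt.comp_hasDerivAt (f := fun t : ℂ => (t, torusPoint c t)) τ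
    h.1.hasFDerivAt h1).congr_deriv ?_
  rw [h.2]
  simp

lemma continuous_torusPoint : Continuous fun r : (ℝ × ℝ) × ℂ => torusPoint r.1 r.2 := by
  unfold torusPoint
  fun_prop

variable {L N : ℂ × ℂ → 𝔸} {D : Set (ℂ × ℂ)} {V : Set ℂ} {b e : ℝ × ℝ} {c : Path b e}
  {Φ : unitInterval → ℂ → 𝔸}

/-- At fixed s = (a,b) on the path, z = a + bτ moves with velocity b as τ varies, so the coefficient
is bL + N. -/
lemma IsTransportAlong.hasDerivAt (h : IsTransportAlong L N V c Φ) (s : unitInterval) {τ : ℂ}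
    (hτ : τ ∈ V) : HasDerivAt (Φ s) ((((c s).2 : ℂ) • L (τ, torusPoint (c s) τ) +
      N (τ, torusPoint (c s) τ)) * Φ s τ) τ := by
  obtain ⟨F, hF, hΦ⟩ := h s τ hτ
  have h1 : ∀ᶠ t in 𝓝 τ, Φ s t = F (t, torusPoint (c s) t) :=
    (Continuous.tendsto (by fun_prop : Continuous fun t : ℂ => (s, t)) τ).eventually hΦ
  rw [h1.self_of_nhds]
  exact hF.self_of_nhds.hasDerivAt_torusPoint.congr_of_eventuallyEq h1

/-- For fixed τ, invertibility of Φ is locally constant in s, by the linear equation in z, and the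
interval is connected. -/
lemma IsTransportAlong.isUnit [FiniteDimensional ℂ 𝔸] (h : IsTransportAlong L N V c Φ)
    (hL : IsFlatConnection L N D) {τ : ℂ} (hτ : τ ∈ V)
    (hD : ∀ s, (τ, torusPoint (c s) τ) ∈ D) (h0 : IsUnit (Φ 0 τ)) (s : unitInterval) :
    IsUnit (Φ s τ) := by
  have hloc : IsLocallyConstant fun s => IsUnit (Φ s τ) := by
    refine (IsLocallyConstant.iff_eventually_eq _).2 fun s => ?_
    obtain ⟨F, hF, hΦ⟩ := h s τ hτ
    have hz : ∀ᶠ z in 𝓝 (torusPoint (c s) τ), IsHorizontalAt L N F (τ, z) ∧ (τ, z) ∈ D :=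
      (Continuous.tendsto (by fun_prop : Continuous fun z : ℂ => (τ, z)) _).eventually
        (hF.and (hL.isOpen.mem_nhds (hD s)))
    obtain ⟨r, hr, hball⟩ := Metric.eventually_nhds_iff_ball.1 hz
    have hu : ∀ z ∈ Metric.ball (torusPoint (c s) τ) r, ∀ z' ∈ Metric.ball (torusPoint (c s) τ) r,
        IsUnit (F (τ, z)) → IsUnit (F (τ, z')) := fun z hz z' hz' =>
      isUnit_of_hasDerivAt_mul (f := fun z => F (τ, z)) (A := fun z => L (τ, z)) Metric.isOpen_ball
        (convex_ball _ _).isPreconnected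
        (hL.differentiableOn_left.continuousOn.comp (by fun_prop) fun z hz => (hball z hz).2)
        (fun z hz => (hball z hz).1.hasDerivAt_snd) hz hz'
    have hc : Continuous fun s' => torusPoint (c s') τ :=
      continuous_torusPoint.comp (c.continuous.prodMk continuous_const)
    filter_upwards [(Continuous.tendsto (by fun_prop : Continuous fun s' : unitInterval => (s', τ))
      s).eventually hΦ, hc.continuousAt.eventually (Metric.ball_mem_nhds _ hr)] with s' hs' hb
    have hs := hΦ.self_of_nhds
    rw [hs', hs]
    exact propext ⟨hu _ hb _ (Metric.mem_ball_self hr), hu _ (Metric.mem_ball_self hr) _ hb⟩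
  exact (hloc.apply_eq_of_isPreconnected isPreconnected_univ (Set.mem_univ 0) (Set.mem_univ s)).mp h0

/-- Horizontal sections which agree along `z = torusPoint c τ` agree near it. -/
lemma IsFlatConnection.eventually_eq (hL : IsFlatConnection L N D) {F F' : ℂ × ℂ → 𝔸}
    {c : ℝ × ℝ} {τ : ℂ} (hD : (τ, torusPoint c τ) ∈ D)
    (hF : ∀ᶠ w in 𝓝 (τ, torusPoint c τ), IsHorizontalAt L N F w)
    (hF' : ∀ᶠ w in 𝓝 (τ, torusPoint c τ), IsHorizontalAt L N F' w)
    (h : ∀ᶠ t in 𝓝 τ, F (t, torusPoint c t) = F' (t, torusPoint c t)) :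
    ∀ᶠ w in 𝓝 (τ, torusPoint c τ), F w = F' w := by
  obtain ⟨r, hr, hball⟩ := Metric.eventually_nhds_iff_ball.1
    ((hF.and hF').and (hL.isOpen.mem_nhds hD))
  have hc : ∀ᶠ t in 𝓝 τ, torusPoint c t ∈ Metric.ball (torusPoint c τ) r :=
    (EllipticCM.hasDerivAt_torusPoint c τ).continuousAt.eventually (Metric.ball_mem_nhds _ hr)
  have h1 : ∀ᶠ t in 𝓝 τ, t ∈ Metric.ball τ r := Metric.ball_mem_nhds _ hr
  rw [nhds_prod_eq]
  filter_upwards [((h.and hc).and h1).prod_mk (Metric.ball_mem_nhds (torusPoint c τ) hr)]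
  rintro ⟨t, z⟩ ⟨⟨⟨ht, htc⟩, ht1⟩, hz⟩
  have hm : ∀ w ∈ Metric.ball (torusPoint c τ) r, (t, w) ∈ Metric.ball (τ, torusPoint c τ) r :=
    fun w hw => by
      rw [← ball_prod_same]
      exact ⟨ht1, hw⟩
  refine sub_eq_zero.1 (eq_zero_of_hasDerivAt_mul (f := fun w => F (t, w) - F' (t, w))
    (A := fun w => L (t, w)) Metric.isOpen_ball (convex_ball _ _).isPreconnected
    (hL.differentiableOn_left.continuousOn.comp (by fun_prop) fun w hw => (hball _ (hm w hw)).2)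
    (fun w hw => ?_) htc (sub_eq_zero.2 ht) z hz)
  have hw' := (hball _ (hm w hw)).1
  rw [mul_sub]
  exact hw'.1.hasDerivAt_snd.fun_sub hw'.2.hasDerivAt_snd

/-- The monodromy of a horizontal section: if `T` intertwines the connection along the lines
`torusPoint b` and `torusPoint e`, then the two ends differ by a constant. -/
lemma IsTransportAlong.exists_monodromy [FiniteDimensional ℂ 𝔸] (h : IsTransportAlong L N V c Φ)
    (hL : IsFlatConnection L N D) (hV : IsOpen V) (hVc : IsPreconnected V)
    (hD : ∀ s, ∀ τ ∈ V, (τ, torusPoint (c s) τ) ∈ D) (h0 : ∀ τ ∈ V, IsUnit (Φ 0 τ))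
    {T T' : ℂ → 𝔸} (hTu : ∀ τ ∈ V, T' τ * T τ = 1 ∧ T τ * T' τ = 1)
    (hT : ∀ f : ℂ → 𝔸, ∀ τ ∈ V, HasDerivAt f (((e.2 : ℂ) • L (τ, torusPoint e τ) +
      N (τ, torusPoint e τ)) * f τ) τ → HasDerivAt (fun t => T' t * f t)
        (((b.2 : ℂ) • L (τ, torusPoint b τ) + N (τ, torusPoint b τ)) * (T' τ * f τ)) τ) :
    ∃ Γ : 𝔸, IsUnit Γ ∧ ∀ τ ∈ V, Φ 1 τ = T τ * Φ 0 τ * Γ := by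
  rcases V.eq_empty_or_nonempty with rfl | ⟨τ₁, h₁⟩
  · exact ⟨1, isUnit_one, by simp⟩
  obtain ⟨u, hu⟩ := h0 τ₁ h₁
  have hT₁ : IsUnit (T' τ₁) := isUnit_iff_exists.2 ⟨T τ₁, hTu τ₁ h₁⟩
  -- Γ is read off at τ₁. The difference of T'Φ(1) and Φ(0)Γ solves a linear equation in τ and
  -- vanishes at τ₁, so it vanishes on V.
  refine ⟨↑u⁻¹ * (T' τ₁ * Φ 1 τ₁), u⁻¹.isUnit.mul (hT₁.mul
    (h.isUnit hL h₁ (fun s => hD s τ₁ h₁) (h0 τ₁ h₁) 1)), fun τ hτ => ?_⟩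
  have hA : ContinuousOn (fun τ => (b.2 : ℂ) • L (τ, torusPoint b τ) + N (τ, torusPoint b τ)) V := by
    have hb : ContinuousOn (fun τ => (τ, torusPoint b τ)) V := by
      unfold torusPoint
      fun_prop
    have hm : Set.MapsTo (fun τ => (τ, torusPoint b τ)) V D := fun τ hτ => by
      simpa using hD 0 τ hτ
    exact ((hL.differentiableOn_left.continuousOn.comp hb hm).const_smul _).add
      (hL.differentiableOn_right.continuousOn.comp hb hm)
  have key := eq_zero_of_hasDerivAt_mul
    (f := fun τ => T' τ * Φ 1 τ - Φ 0 τ * (↑u⁻¹ * (T' τ₁ * Φ 1 τ₁))) hV hVc hA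
    (fun t ht => by
      have h1 := h.hasDerivAt 1 ht
      have h2 := h.hasDerivAt 0 ht
      rw [c.target] at h1
      rw [c.source] at h2
      rw [mul_sub, ← mul_assoc _ (Φ 0 t)]
      exact (hT _ t ht h1).fun_sub (h2.mul_const _)) h₁ (by
      rw [← hu, Units.mul_inv_cancel_left, sub_self]) τ hτ
  rw [mul_assoc, ← sub_eq_zero.1 key, ← mul_assoc, (hTu τ hτ).2, one_mul]

end Transport

/-! ### Existence of continuations over all of V. -/

section Existence

/-- The real coordinates of `z` with respect to `1, τ`, for `x = (τ, z)`. -/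
def torusCoords (x : ℂ × ℂ) : ℝ × ℝ :=
  (x.2.re - x.2.im / x.1.im * x.1.re, x.2.im / x.1.im)

lemma torusPoint_torusCoords {x : ℂ × ℂ} (hx : 0 < x.1.im) :
    torusPoint (torusCoords x) x.1 = x.2 := by
  apply Complex.ext <;> simp [torusPoint, torusCoords, hx.ne']

lemma torusCoords_torusPoint {τ : ℂ} (hτ : 0 < τ.im) (c : ℝ × ℝ) :
    torusCoords (τ, torusPoint c τ) = c := by
  apply Prod.ext <;> simp [torusPoint, torusCoords, hτ.ne']

lemma isOpen_torusCoords_preimage {V : Set ℂ} (hV : IsOpen V) (him : ∀ τ ∈ V, 0 < τ.im)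
    {B : Set (ℝ × ℝ)} (hB : IsOpen B) : IsOpen {x : ℂ × ℂ | x.1 ∈ V ∧ torusCoords x ∈ B} := by
  have hc : ContinuousOn torusCoords {x : ℂ × ℂ | x.1 ∈ V} := by
    have h1 : ContinuousOn (fun x : ℂ × ℂ => x.2.im / x.1.im) {x : ℂ × ℂ | x.1 ∈ V} :=
      (by fun_prop : Continuous fun x : ℂ × ℂ => x.2.im).continuousOn.div
        (by fun_prop : Continuous fun x : ℂ × ℂ => x.1.im).continuousOn fun x hx => (him _ hx).ne'
    exact ((by fun_prop : Continuous fun x : ℂ × ℂ => x.2.re).continuousOn.sub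
      (h1.mul (by fun_prop : Continuous fun x : ℂ × ℂ => x.1.re).continuousOn)).prodMk h1
  exact hc.isOpen_inter_preimage (hV.preimage continuous_fst) hB

variable {𝔸 : Type*} [NormedRing 𝔸] [NormedAlgebra ℂ 𝔸] [CompleteSpace 𝔸]
  [SecondCountableTopology 𝔸]
variable {L N : ℂ × ℂ → 𝔸} {D : Set (ℂ × ℂ)} {V : Set ℂ}

/-- Convexity of B keeps the segments from b inside B, and for each τ they become segments in z.
Working in real coordinates, V need not be shrunk. -/
lemma IsFlatConnection.exists_extension (hL : IsFlatConnection L N D) (hV : IsOpen V)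
    (him : ∀ τ ∈ V, 0 < τ.im) {B : Set (ℝ × ℝ)} (hB : IsOpen B) (hBc : Convex ℝ B)
    (hBD : ∀ a ∈ B, ∀ τ ∈ V, (τ, torusPoint a τ) ∈ D) {b : ℝ × ℝ} (hb : b ∈ B) {G : ℂ → 𝔸}
    (hG : ∀ τ ∈ V, HasDerivAt G
      (((b.2 : ℂ) • L (τ, torusPoint b τ) + N (τ, torusPoint b τ)) * G τ) τ) :
    ∃ F : ℂ × ℂ → 𝔸, (∀ a ∈ B, ∀ τ ∈ V, ∀ᶠ w in 𝓝 (τ, torusPoint a τ), IsHorizontalAt L N F w) ∧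
      ∀ τ ∈ V, F (τ, torusPoint b τ) = G τ := by
  have hW := isOpen_torusCoords_preimage hV him hB
  have hmem : ∀ a ∈ B, ∀ τ ∈ V,
      (τ, torusPoint a τ) ∈ {x : ℂ × ℂ | x.1 ∈ V ∧ torusCoords x ∈ B} := fun a ha τ hτ =>
    ⟨hτ, by rwa [torusCoords_torusPoint (him τ hτ)]⟩
  obtain ⟨F, hF, hF', hF0⟩ := exists_horizontal_extension hL.isOpen hW hL.differentiableOn_left
    hL.differentiableOn_right hL.flat (b₁ := b.1) (b₂ := b.2) (fun x hx s => by
      have h1 := hBD _ (hBc.add_smul_sub_mem hb hx.2 s.2) x.1 hx.1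
      have h2 : torusPoint (b + (s : ℝ) • (torusCoords x - b)) x.1 =
          b.1 + b.2 * x.1 + ((s : ℝ) : ℂ) * (x.2 - (b.1 + b.2 * x.1)) := by
        rw [← torusPoint_torusCoords (him _ hx.1)]
        simp only [torusPoint, Prod.fst_add, Prod.snd_add, Prod.smul_fst, Prod.smul_snd,
          Prod.fst_sub, Prod.snd_sub, smul_eq_mul]
        push_cast
        ring
      rwa [h2] at h1) (fun x hx => hG x.1 hx.1)
  refine ⟨F, fun a ha τ hτ => ?_, fun τ hτ => hF0 τ (hmem b hb τ hτ)⟩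
  filter_upwards [hW.mem_nhds (hmem a ha τ hτ)] with w hw
  exact ⟨hF.differentiableAt (hW.mem_nhds hw), hF' w hw⟩

lemma continuous_path_torusPoint {b e : ℝ × ℝ} (c : Path b e) :
    Continuous fun r : unitInterval × ℂ => (r.2, torusPoint (c r.1) r.2) :=
  continuous_snd.prodMk (continuous_torusPoint.comp
    ((c.continuous.comp continuous_fst).prodMk continuous_snd))

/-- Continuation along the initial part `[0, t]` of the path `c`. -/
def IsTransportUpTo (L N : ℂ × ℂ → 𝔸) (V : Set ℂ) {b e : ℝ × ℝ} (c : Path b e)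
    (t : unitInterval) (Φ : unitInterval → ℂ → 𝔸) : Prop :=
  ∀ s ≤ t, ∀ τ ∈ V, ∃ F : ℂ × ℂ → 𝔸,
    (∀ᶠ w in 𝓝 (τ, torusPoint (c s) τ), IsHorizontalAt L N F w) ∧
    ∀ᶠ r in 𝓝 (s, τ), r.1 ≤ t → Φ r.1 r.2 = F (r.2, torusPoint (c r.1) r.2)

lemma IsTransportUpTo.extend (hL : IsFlatConnection L N D) (hV : IsOpen V)
    (him : ∀ τ ∈ V, 0 < τ.im) {b e : ℝ × ℝ} {c : Path b e} {t t' : unitInterval} (htt' : t ≤ t')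
    {Φ : unitInterval → ℂ → 𝔸} (h : IsTransportUpTo L N V c t Φ)
    {B : Set (ℝ × ℝ)} (hB : IsOpen B) (hBc : Convex ℝ B)
    (hBD : ∀ a ∈ B, ∀ τ ∈ V, (τ, torusPoint a τ) ∈ D) (hcB : ∀ s ∈ Set.Icc t t', c s ∈ B) :
    ∃ Φ' : unitInterval → ℂ → 𝔸, IsTransportUpTo L N V c t' Φ' ∧ ∀ s ≤ t, Φ' s = Φ s := by
  have hct : c t ∈ B := hcB t ⟨le_rfl, htt'⟩
  obtain ⟨F, hF, hFt⟩ := hL.exists_extension hV him hB hBc hBD hct (G := Φ t) (fun τ hτ => by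
    obtain ⟨F, hF, hΦ⟩ := h t le_rfl τ hτ
    have h1 : ∀ᶠ τ' in 𝓝 τ, Φ t τ' = F (τ', torusPoint (c t) τ') :=
      ((Continuous.tendsto (by fun_prop : Continuous fun τ' : ℂ => (t, τ')) τ).eventually
        hΦ).mono fun τ' hτ' => hτ' le_rfl
    rw [h1.self_of_nhds]
    exact hF.self_of_nhds.hasDerivAt_torusPoint.congr_of_eventuallyEq h1)
  refine ⟨fun s τ => if s ≤ t then Φ s τ else F (τ, torusPoint (c s) τ), fun s hs τ hτ => ?_,
    fun s hs => funext fun τ => if_pos hs⟩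
  -- Only s = t requires gluing: there the old and the new solution agree along one line, hence
  -- nearby by `eventually_eq`.
  rcases lt_trichotomy s t with hst | rfl | hst
  · obtain ⟨F', hF', hΦ'⟩ := h s hst.le τ hτ
    refine ⟨F', hF', ?_⟩
    filter_upwards [hΦ', (isOpen_Iio.preimage continuous_fst).mem_nhds
      (show (s, τ).1 ∈ Set.Iio t from hst)] with r hr hrt _
    rw [if_pos (le_of_lt hrt), hr (le_of_lt hrt)]
  · obtain ⟨F', hF', hΦ'⟩ := h s le_rfl τ hτ
    refine ⟨F', hF', ?_⟩
    have h1 : ∀ᶠ τ' in 𝓝 τ, F' (τ', torusPoint (c s) τ') = F (τ', torusPoint (c s) τ') := by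
      filter_upwards [(Continuous.tendsto (by fun_prop : Continuous fun τ' : ℂ => (s, τ'))
        τ).eventually hΦ', hV.mem_nhds hτ] with τ' hτ' hV'
      rw [hFt τ' hV', ← hτ' le_rfl]
    have h2 := hL.eventually_eq (hBD _ hct τ hτ) hF' (hF _ hct τ hτ) h1
    filter_upwards [hΦ', ((continuous_path_torusPoint c).tendsto (s, τ)).eventually h2] with r hr hr' _
    split_ifs with hrs
    · exact hr hrs
    · exact hr'.symm
  · refine ⟨F, hF _ (hcB s ⟨hst.le, hs⟩) τ hτ, ?_⟩
    filter_upwards [(isOpen_Ioi.preimage continuous_fst).mem_nhds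
      (show (s, τ).1 ∈ Set.Ioi t from hst)] with r hr _
    rw [if_neg (not_le_of_gt hr)]

/-- G solves the induced equation in τ at the base point and is fixed before any path. Each path is
subdivided into pieces lying in convex open subsets of S, and the continuation is extended piece by
piece. -/
lemma IsFlatConnection.exists_transport [FiniteDimensional ℂ 𝔸] (hL : IsFlatConnection L N D)
    (hV : IsOpen V) (hVc : Convex ℝ V) (him : ∀ τ ∈ V, 0 < τ.im) {S : Set (ℝ × ℝ)} (hS : IsOpen S)
    (hSD : ∀ a ∈ S, ∀ τ ∈ V, (τ, torusPoint a τ) ∈ D) {b : ℝ × ℝ} (hb : b ∈ S) {τ₀ : ℂ}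
    (hτ₀ : τ₀ ∈ V) {Y₀ : 𝔸} (hY₀ : IsUnit Y₀) :
    ∃ G : ℂ → 𝔸, G τ₀ = Y₀ ∧ ∀ (e : ℝ × ℝ) (c : Path b e), (∀ s, c s ∈ S) →
      ∃ Φ : unitInterval → ℂ → 𝔸, IsTransportAlong L N V c Φ ∧ (∀ τ ∈ V, Φ 0 τ = G τ) ∧
        ∀ s, ∀ τ ∈ V, IsUnit (Φ s τ) := by
  have hbd : DifferentiableOn ℂ (fun τ => (τ, torusPoint b τ)) V := by
    unfold torusPoint
    fun_prop
  have hA : DifferentiableOn ℂ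
      (fun τ => (b.2 : ℂ) • L (τ, torusPoint b τ) + N (τ, torusPoint b τ)) V := by
    have h1 : DifferentiableOn ℂ (fun τ => L (τ, torusPoint b τ)) V :=
      hL.differentiableOn_left.comp hbd (hSD b hb)
    have h2 : DifferentiableOn ℂ (fun τ => N (τ, torusPoint b τ)) V :=
      hL.differentiableOn_right.comp hbd (hSD b hb)
    exact (h1.fun_const_smul _).fun_add h2
  obtain ⟨G, hG0, hG⟩ := exists_hasDerivAt_mul hV hVc hA hτ₀ Y₀
  have hGu : ∀ τ ∈ V, IsUnit (G τ) := fun τ hτ =>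
    isUnit_of_hasDerivAt_mul hV hVc.isPreconnected hA.continuousOn hG hτ₀ hτ (hG0 ▸ hY₀)
  have hball : ∀ a ∈ S, ∃ r > 0, Metric.ball a r ⊆ S := fun a ha => Metric.isOpen_iff.1 hS a ha
  refine ⟨G, hG0, fun e c hc => ?_⟩
  obtain ⟨tn, ht0, htm, ⟨k₁, hk₁⟩, htc⟩ := exists_monotone_Icc_subset_open_cover_unitInterval
    (c := fun B : {B : Set (ℝ × ℝ) // IsOpen B ∧ Convex ℝ B ∧ B ⊆ S} => c ⁻¹' B.1)
    (fun B => B.2.1.preimage c.continuous) (fun s _ => by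
      obtain ⟨r, hr, h⟩ := hball (c s) (hc s)
      exact Set.mem_iUnion.2 ⟨⟨_, Metric.isOpen_ball, convex_ball _ _, h⟩, Metric.mem_ball_self hr⟩)
  have hind : ∀ k, ∃ Φ : unitInterval → ℂ → 𝔸, IsTransportUpTo L N V c (tn k) Φ ∧
      ∀ τ ∈ V, Φ 0 τ = G τ := by
    intro k
    induction k with
    | zero =>
      obtain ⟨r, hr, hrS⟩ := hball b hb
      obtain ⟨F, hF, hFb⟩ := hL.exists_extension hV him Metric.isOpen_ball (convex_ball b r)
        (fun a ha => hSD a (hrS ha)) (Metric.mem_ball_self hr) hG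
      refine ⟨fun s τ => F (τ, torusPoint (c s) τ), fun s hs τ hτ => ⟨F, ?_, ?_⟩, fun τ hτ => ?_⟩
      · rw [ht0] at hs
        rw [le_antisymm hs unitInterval.nonneg', c.source]
        exact hF b (Metric.mem_ball_self hr) τ hτ
      · exact Eventually.of_forall fun _ _ => rfl
      · simpa only [c.source] using hFb τ hτ
    | succ k ih =>
      obtain ⟨Φ, hΦ, hΦ0⟩ := ih
      obtain ⟨⟨B, hB, hBc, hBS⟩, hsub⟩ := htc k
      obtain ⟨Φ', hΦ', h⟩ := hΦ.extend hL hV him (htm (Nat.le_succ k)) hB hBc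
        (fun a ha => hSD a (hBS ha)) (fun s hs => hsub hs)
      exact ⟨Φ', hΦ', fun τ hτ => by rw [h 0 unitInterval.nonneg', hΦ0 τ hτ]⟩
  obtain ⟨Φ, hΦ, hΦ0⟩ := hind k₁
  have hΦ' : IsTransportAlong L N V c Φ := fun s τ hτ => by
    rw [hk₁ k₁ le_rfl] at hΦ
    obtain ⟨F, hF, h⟩ := hΦ s unitInterval.le_one' τ hτ
    exact ⟨F, hF, h.mono fun r hr => hr unitInterval.le_one'⟩
  exact ⟨Φ, hΦ', hΦ0, fun s τ hτ => hΦ'.isUnit hL hτ (fun s => hSD _ (hc s) τ hτ)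
    (hΦ0 τ hτ ▸ hGu τ hτ) s⟩

end Existence

/-! ### Translation from matrices to a normed algebra of operators. -/

section Operators

variable {ι : Type*} [Fintype ι] [DecidableEq ι]

/-- Matrices as continuous linear maps, with the operator norm. -/
def opEquiv : Matrix ι ι ℂ ≃ₐ[ℂ] ((ι → ℂ) →L[ℂ] (ι → ℂ)) :=
  Matrix.toLinAlgEquiv'.trans (Module.End.toContinuousLinearMap (ι → ℂ))

def opEntry (β γ : ι) : ((ι → ℂ) →L[ℂ] (ι → ℂ)) →L[ℂ] ℂ :=
  (ContinuousLinearMap.proj β).comp (ContinuousLinearMap.apply ℂ (ι → ℂ) (Pi.single γ 1))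

lemma opEntry_opEquiv (A : Matrix ι ι ℂ) (β γ : ι) : opEntry β γ (opEquiv A) = A β γ := by
  change (A.mulVec (Pi.single γ 1)) β = A β γ
  simp

lemma opEquiv_eq_sum (A : Matrix ι ι ℂ) :
    opEquiv A = ∑ β, ∑ γ, A β γ • opEquiv (Matrix.single β γ (1 : ℂ)) := by
  conv_lhs => rw [Matrix.matrix_eq_sum_single A]
  simp only [map_sum, ← map_smul, Matrix.smul_single, smul_eq_mul, mul_one]

lemma hasDerivAt_opEquiv {f : ℂ → Matrix ι ι ℂ} {f' : Matrix ι ι ℂ} {t : ℂ} :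
    HasDerivAt (fun s => opEquiv (f s)) (opEquiv f') t ↔
      ∀ β γ, HasDerivAt (fun s => f s β γ) (f' β γ) t := by
  constructor
  · intro h β γ
    have := HasFDerivAt.comp_hasDerivAt t (opEntry β γ).hasFDerivAt h
    rw [opEntry_opEquiv] at this
    exact this.congr_of_eventuallyEq (Eventually.of_forall fun s => (opEntry_opEquiv _ _ _).symm)
  · intro h
    rw [opEquiv_eq_sum f']
    simp only [opEquiv_eq_sum (f _)]
    exact HasDerivAt.fun_sum fun β _ => HasDerivAt.fun_sum fun γ _ =>
      HasDerivAt.smul_const (F := (ι → ℂ) →L[ℂ] (ι → ℂ)) (h β γ) _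

lemma differentiableAt_opEquiv {E : Type*} [NormedAddCommGroup E] [NormedSpace ℂ E]
    {f : E → Matrix ι ι ℂ} {x : E} : DifferentiableAt ℂ (fun y => opEquiv (f y)) x ↔
      ∀ β γ, DifferentiableAt ℂ (fun y => f y β γ) x := by
  constructor
  · intro h β γ
    have := (opEntry β γ).differentiableAt.comp x h
    exact this.congr_of_eventuallyEq (Eventually.of_forall fun s => (opEntry_opEquiv _ _ _).symm)
  · intro h
    simp only [opEquiv_eq_sum (f _)]
    exact DifferentiableAt.fun_sum fun β _ => DifferentiableAt.fun_sum fun γ _ =>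
      (h β γ).smul_const _

lemma isUnit_opEquiv {A : Matrix ι ι ℂ} : IsUnit (opEquiv A) ↔ IsUnit A :=
  MulEquiv.isUnit_map opEquiv

lemma hasDerivAt_fst_of_differentiableAt {E : Type*} [NormedAddCommGroup E] [NormedSpace ℂ E]
    {f : ℂ × ℂ → E} {τ z : ℂ} (hf : DifferentiableAt ℂ f (τ, z)) :
    HasDerivAt (fun t => f (t, z)) (fderiv ℂ f (τ, z) (1, 0)) τ :=
  HasFDerivAt.comp_hasDerivAt (f := fun t : ℂ => (t, z)) τ hf.hasFDerivAt
    ((hasDerivAt_id τ).prodMk (hasDerivAt_const τ z))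

lemma hasDerivAt_snd_of_differentiableAt {E : Type*} [NormedAddCommGroup E] [NormedSpace ℂ E]
    {f : ℂ × ℂ → E} {τ z : ℂ} (hf : DifferentiableAt ℂ f (τ, z)) :
    HasDerivAt (fun w => f (τ, w)) (fderiv ℂ f (τ, z) (0, 1)) z :=
  HasFDerivAt.comp_hasDerivAt (f := fun w : ℂ => (τ, w)) z hf.hasFDerivAt
    ((hasDerivAt_const z τ).prodMk (hasDerivAt_id z))

/-- The coefficient of `dz` in the connection `dY = L Y dz - (2πi)⁻¹ M Y dτ`. -/
def opLeft (L : ℂ → ℂ → Matrix ι ι ℂ) (x : ℂ × ℂ) : (ι → ℂ) →L[ℂ] (ι → ℂ) := opEquiv (L x.1 x.2)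

/-- The coefficient of `dτ` in the connection `dY = L Y dz - (2πi)⁻¹ M Y dτ`. -/
def opRight (M : ℂ → ℂ → Matrix ι ι ℂ) (x : ℂ × ℂ) : (ι → ℂ) →L[ℂ] (ι → ℂ) :=
  opEquiv (-(2 * Real.pi * I)⁻¹ • M x.1 x.2)

/-- The entrywise system becomes horizontality in a complete normed algebra, where the transport
results apply. -/
lemma solvesAt_iff {L M F : ℂ → ℂ → Matrix ι ι ℂ} {τ z : ℂ} : SolvesAt L M F τ z ↔
    IsHorizontalAt (opLeft L) (opRight M) (fun x => opEquiv (F x.1 x.2)) (τ, z) := by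
  have e1 : ∀ a b : ℂ, 2 * Real.pi * I * a + b = 0 ↔ a = -(2 * Real.pi * I)⁻¹ * b := fun a b => by
    have := Complex.two_pi_I_ne_zero
    rw [← mul_right_inj' this (b := a), ← mul_assoc, mul_neg, mul_inv_cancel₀ this, neg_one_mul,
      eq_neg_iff_add_eq_zero]
  constructor
  · intro h
    have hd : DifferentiableAt ℂ (fun x : ℂ × ℂ => opEquiv (F x.1 x.2)) (τ, z) :=
      differentiableAt_opEquiv.2 fun β γ => (h β γ).1
    have hz : HasDerivAt (fun w => opEquiv (F τ w)) (opEquiv (L τ z * F τ z)) z :=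
      hasDerivAt_opEquiv.2 fun β γ => by
        rw [← (h β γ).2.1]
        exact (hasDerivAt_snd_of_differentiableAt (h β γ).1).differentiableAt.hasDerivAt
    have ht : HasDerivAt (fun t => opEquiv (F t z))
        (opEquiv ((-(2 * Real.pi * I)⁻¹ • M τ z) * F τ z)) τ :=
      hasDerivAt_opEquiv.2 fun β γ => by
        rw [Matrix.smul_mul, Matrix.smul_apply, smul_eq_mul, ← (e1 _ _).1 (h β γ).2.2]
        exact (hasDerivAt_fst_of_differentiableAt (h β γ).1).differentiableAt.hasDerivAt
    refine ⟨hd, fun v => ?_⟩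
    have hv : v = v.1 • ((1 : ℂ), (0 : ℂ)) + v.2 • ((0 : ℂ), (1 : ℂ)) := by simp
    conv_lhs => rw [hv]
    rw [map_add, map_smul, map_smul, (hasDerivAt_fst_of_differentiableAt hd).unique ht,
      (hasDerivAt_snd_of_differentiableAt hd).unique hz, map_mul, map_mul, add_mul, smul_mul_assoc,
      smul_mul_assoc, add_comm]
    rfl
  · intro h β γ
    have hz := h.hasDerivAt_snd
    have ht := h.hasDerivAt_fst
    simp only [opLeft, opRight, ← map_mul] at hz ht
    refine ⟨differentiableAt_opEquiv.1 h.1 β γ, (hasDerivAt_opEquiv.1 hz β γ).deriv, ?_⟩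
    rw [e1, (hasDerivAt_opEquiv.1 ht β γ).deriv, Matrix.smul_mul, Matrix.smul_apply, smul_eq_mul]

lemma isContinuationAlong_iff {L M : ℂ → ℂ → Matrix ι ι ℂ} {V : Set ℂ} {b e : ℝ × ℝ}
    {c : Path b e} {Φ : unitInterval → ℂ → Matrix ι ι ℂ} : IsContinuationAlong L M V c Φ ↔
      IsTransportAlong (opLeft L) (opRight M) V c (fun s τ => opEquiv (Φ s τ)) := by
  refine forall_congr' fun s => forall₂_congr fun τ _ => ⟨?_, ?_⟩
  · rintro ⟨F, hF, hΦ⟩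
    exact ⟨fun x => opEquiv (F x.1 x.2), hF.mono fun w hw => solvesAt_iff.1 hw,
      hΦ.mono fun r hr => congrArg opEquiv hr⟩
  · rintro ⟨F, hF, hΦ⟩
    refine ⟨fun t z => opEquiv.symm (F (t, z)), hF.mono fun w hw => solvesAt_iff.2 ?_,
      hΦ.mono fun r hr => ?_⟩
    · simpa only [AlgEquiv.apply_symm_apply] using hw
    · simp only [← hr, AlgEquiv.symm_apply_apply]

end Operators

/-! ### The Lax pair as a flat connection. -/

section LaxConnection

variable {ℓ : ℕ} {Δ : Finset (EuclideanSpace ℝ (Fin ℓ))} {g : ℂ} {U : Set ℂ}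
  {q p : ℂ → Fin ℓ → ℂ} {τ z : ℂ}

lemma IsSimplyLacedRootSystem.differentiableAt_kerMat {E : Type*} [NormedAddCommGroup E]
    [NormedSpace ℂ E] (hΔ : IsSimplyLacedRootSystem Δ)
    {X Xh : E → EuclideanSpace ℝ (Fin ℓ) → ℂ} {x : E}
    (h : ∀ α ∈ Δ, DifferentiableAt ℂ (fun s => X s α) x)
    (hh : ∀ α ∈ Δ, DifferentiableAt ℂ (fun s => Xh s α) x) (β γ : Δ) :
    DifferentiableAt ℂ (fun s => kerMat Δ (X s) (Xh s) β γ) x := by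
  obtain ⟨β, hβ⟩ := β
  obtain ⟨γ, hγ⟩ := γ
  simp only [kerMat, Matrix.of_apply]
  refine DifferentiableAt.fun_add ?_ ?_
  · split_ifs with hb
    · exact h _ (hΔ.sub_mem hβ hγ hb)
    · exact differentiableAt_const _
  · split_ifs with hb
    · exact hh _ hβ
    · exact differentiableAt_const _

lemma differentiableAt_diagonal {E : Type*} [NormedAddCommGroup E] [NormedSpace ℂ E]
    {d : E → Δ → ℂ} {x : E} (h : ∀ β, DifferentiableAt ℂ (fun s => d s β) x) (β γ : Δ) :
    DifferentiableAt ℂ (fun s => Matrix.diagonal (d s) β γ) x := by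
  by_cases hb : β = γ
  · subst hb
    simpa only [Matrix.diagonal_apply_eq] using h β
  · simp only [Matrix.diagonal_apply_ne _ hb]
    exact differentiableAt_const _

lemma IsFlow.differentiableAt_cdot_q_fst (hflow : IsFlow Δ g U q p) (hτ : τ ∈ U)
    (α : EuclideanSpace ℝ (Fin ℓ)) :
    DifferentiableAt ℂ (fun x : ℂ × ℂ => cdot α (q x.1)) (τ, z) :=
  DifferentiableAt.comp (f := fun x : ℂ × ℂ => x.1) (g := fun t => cdot α (q t)) (τ, z)
    (hflow.hasDerivAt_cdot_q hτ α).differentiableAt differentiableAt_fst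

lemma differentiableAt_Lmat (hΔ : IsSimplyLacedRootSystem Δ) (hflow : IsFlow Δ g U q p) (hτ : τ ∈ U)
    (h : 0 < τ.im) (hz : ¬ IsSingular τ z) (β γ : Δ) :
    DifferentiableAt ℂ (fun x : ℂ × ℂ => Lmat Δ g q p x.1 x.2 β γ) (τ, z) := by
  have hz1 := notMem_periods_of_not_isSingular hz
  have hz2 : 2 * z ∉ periods τ := fun hm => hz (isSingular_iff.2 hm)
  have hreg := hflow.regular τ hτ
  have hq := fun α => hflow.differentiableAt_cdot_q_fst (z := z) hτ α
  simp only [Lmat_eq hΔ, Matrix.add_apply, Matrix.smul_apply, smul_eq_mul, dotMat]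
  refine DifferentiableAt.fun_add (differentiableAt_diagonal (fun β' => ?_) β γ)
    (DifferentiableAt.const_mul (hΔ.differentiableAt_kerMat (fun α hα => ?_) (fun α hα => ?_) β γ) _)
  · exact DifferentiableAt.comp (f := fun x : ℂ × ℂ => x.1) (g := fun t => cdot _ (p t)) (τ, z)
      (hflow.hasDerivAt_cdot_p hτ β').differentiableAt differentiableAt_fst
  · exact differentiableAt_comp_xker differentiableAt_fst (hq α) differentiableAt_snd h
      (hreg α hα) hz1
  · exact (differentiableAt_comp_xker differentiableAt_fst (hq α)
      (differentiableAt_snd.const_mul 2) h (hreg α hα) hz2).const_mul 2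

lemma differentiableAt_Mmat (hΔ : IsSimplyLacedRootSystem Δ) (hflow : IsFlow Δ g U q p) (hτ : τ ∈ U)
    (h : 0 < τ.im) (hz : ¬ IsSingular τ z) (β γ : Δ) :
    DifferentiableAt ℂ (fun x : ℂ × ℂ => Mmat Δ g q x.1 x.2 β γ) (τ, z) := by
  have hz1 := notMem_periods_of_not_isSingular hz
  have hz2 : 2 * z ∉ periods τ := fun hm => hz (isSingular_iff.2 hm)
  have hreg := hflow.regular τ hτ
  have hq := fun α => hflow.differentiableAt_cdot_q_fst (z := z) hτ α
  have hwp : ∀ α ∈ Δ, DifferentiableAt ℂ (fun x : ℂ × ℂ => wp x.1 (cdot α (q x.1))) (τ, z) :=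
    fun α hα => differentiableAt_comp_wp differentiableAt_fst (hq α) h (hreg α hα)
  simp only [Mmat_eq hΔ, Dmat_eq, Matrix.add_apply, Matrix.smul_apply, smul_eq_mul]
  refine DifferentiableAt.fun_add
    (DifferentiableAt.const_mul (differentiableAt_diagonal (fun β' => ?_) β γ) _)
    (DifferentiableAt.const_mul (hΔ.differentiableAt_kerMat (fun α hα => ?_) (fun α hα => ?_) β γ) _)
  · exact (hwp β' β'.2).fun_add (DifferentiableAt.fun_sum fun α hα =>
      hwp α (Finset.mem_filter.1 hα).1)
  · exact differentiableAt_comp_yker differentiableAt_fst (hq α) differentiableAt_snd h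
      (hreg α hα) hz1
  · exact differentiableAt_comp_yker differentiableAt_fst (hq α)
      (differentiableAt_snd.const_mul 2) h (hreg α hα) hz2

/-- With N = -(2πi)⁻¹M, zero curvature is the Lax equation divided by 2πi. -/
lemma isFlatConnection_lax (hΔ : IsSimplyLacedRootSystem Δ) (hU : IsOpen U)
    (hUim : ∀ τ ∈ U, 0 < τ.im) (hflow : IsFlow Δ g U q p) :
    IsFlatConnection (opLeft (Lmat Δ g q p)) (opRight (Mmat Δ g q))
      {x | x.1 ∈ U ∧ ¬ IsSingular x.1 x.2} := by
  have hdL : ∀ x ∈ {x : ℂ × ℂ | x.1 ∈ U ∧ ¬ IsSingular x.1 x.2},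
      DifferentiableAt ℂ (opLeft (Lmat Δ g q p)) x := fun x hx =>
    differentiableAt_opEquiv.2 fun β γ => differentiableAt_Lmat hΔ hflow hx.1 (hUim _ hx.1) hx.2 β γ
  have hdM : ∀ x ∈ {x : ℂ × ℂ | x.1 ∈ U ∧ ¬ IsSingular x.1 x.2},
      DifferentiableAt ℂ (opRight (Mmat Δ g q)) x := fun x hx =>
    differentiableAt_opEquiv.2 fun β γ => by
      simp only [Matrix.smul_apply, smul_eq_mul]
      exact (differentiableAt_Mmat hΔ hflow hx.1 (hUim _ hx.1) hx.2 β γ).const_mul _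
  refine ⟨isOpen_iff_mem_nhds.2 fun x hx => ?_, fun x hx => (hdL x hx).differentiableWithinAt,
    fun x hx => (hdM x hx).differentiableWithinAt, ?_⟩
  · simp only [isSingular_iff, Set.mem_ofPred_eq] at hx ⊢
    filter_upwards [(hU.preimage continuous_fst).mem_nhds hx.1,
      eventually_comp_notMem_periods (τ := fun x : ℂ × ℂ => x.1) (u := fun x => 2 * x.2)
        differentiableAt_fst (differentiableAt_snd.const_mul 2) (hUim _ hx.1) hx.2] with y h1 h2
    exact ⟨h1, h2⟩
  · rintro ⟨τ, z⟩ hx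
    obtain ⟨Lτ, Mz, h1, h2, h3⟩ := lax_equation hΔ hflow hx.1 (hUim _ hx.1) hx.2
    have k1 : HasDerivAt (fun t => opLeft (Lmat Δ g q p) (t, z)) (opEquiv Lτ) τ :=
      hasDerivAt_opEquiv.2 h1
    have k2 : HasDerivAt (fun w => opRight (Mmat Δ g q) (τ, w))
        (opEquiv (-(2 * Real.pi * I : ℂ)⁻¹ • Mz)) z :=
      hasDerivAt_opEquiv.2 fun β γ => by
        simp only [Matrix.smul_apply, smul_eq_mul]
        exact (h2 β γ).const_mul _
    rw [(hasDerivAt_fst_of_differentiableAt (hdL _ hx)).unique k1,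
      (hasDerivAt_snd_of_differentiableAt (hdM _ hx)).unique k2]
    simp only [opLeft, opRight, ← map_mul, ← map_sub]
    congr 1
    have h4 : Lτ = (2 * Real.pi * I : ℂ)⁻¹ • ((2 * Real.pi * I : ℂ) • Lτ) := by
      rw [smul_smul, inv_mul_cancel₀ Complex.two_pi_I_ne_zero, one_smul]
    rw [h4, eq_sub_iff_add_eq.2 h3, Matrix.smul_mul, Matrix.mul_smul]
    module

end LaxConnection

/-- In the coordinates (a,b) singularity means that 2a and 2b are integers, a condition free of τ.
-/
lemma isSingular_torusPoint_iff {τ : ℂ} (h : 0 < τ.im) {c : ℝ × ℝ} :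
    IsSingular τ (torusPoint c τ) ↔ 2 * c.1 ∈ Set.range ((↑) : ℤ → ℝ) ∧
      2 * c.2 ∈ Set.range ((↑) : ℤ → ℝ) := by
  rw [isSingular_iff]
  have e1 : 2 * torusPoint c τ = torusPoint (2 * c.1, 2 * c.2) τ := by
    simp only [torusPoint]
    push_cast
    ring
  rw [e1]
  constructor
  · rintro ⟨m, n, hmn⟩
    have e2 : torusPoint (2 * c.1, 2 * c.2) τ = torusPoint ((m : ℝ), (n : ℝ)) τ := by
      rw [hmn]
      simp [torusPoint]
    have e3 := congrArg (fun z => torusCoords (τ, z)) e2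
    simp only [torusCoords_torusPoint h, Prod.mk.injEq] at e3
    exact ⟨⟨m, e3.1.symm⟩, ⟨n, e3.2.symm⟩⟩
  · rintro ⟨⟨m, hm⟩, ⟨n, hn⟩⟩
    refine ⟨m, n, ?_⟩
    rw [← hm, ← hn]
    simp [torusPoint]

lemma isOpen_nonsingular_coords : IsOpen {c : ℝ × ℝ | ¬ (2 * c.1 ∈ Set.range ((↑) : ℤ → ℝ) ∧
    2 * c.2 ∈ Set.range ((↑) : ℤ → ℝ))} := by
  have hZ : IsClosed (Set.range ((↑) : ℤ → ℝ)) := Int.isClosedEmbedding_coe_real.isClosed_range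
  exact ((hZ.preimage (by fun_prop : Continuous fun c : ℝ × ℝ => 2 * c.1)).inter
    (hZ.preimage (by fun_prop : Continuous fun c : ℝ × ℝ => 2 * c.2))).isOpen_compl

/-- The scalar form of iterating the translation by τ: l, m, P are entries of L, M and P, and E =
e^{2πi(β-γ)·q}. Since P is diagonal, E P = P, so the inhomogeneous terms simply add up. -/
lemma zpow_iterate {l m : ℤ → ℂ} {E k P : ℂ} (hE : E ≠ 0) (hl : ∀ n, l (n + 1) = E * l n)
    (hm : ∀ n, m (n + 1) = E * (m n + k * l n) - k * P) (hP : E * P = P) (n : ℤ) :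
    l n = E ^ n * l 0 ∧ m n = E ^ n * (m 0 + n * k * l 0) - n * k * P := by
  induction n using Int.induction_on with
  | zero => simp
  | succ i ih =>
    rw [hl, hm, ih.1, ih.2, zpow_add_one₀ hE]
    refine ⟨by ring, ?_⟩
    push_cast
    linear_combination (-i * k) * hP
  | pred i ih =>
    have h1 := hl (-(i : ℤ) - 1)
    have h2 := hm (-(i : ℤ) - 1)
    rw [sub_add_cancel] at h1 h2
    rw [ih.1] at h1
    rw [ih.2] at h2
    have h3 : l (-(i : ℤ) - 1) = E ^ (-(i : ℤ) - 1) * l 0 := by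
      refine mul_left_cancel₀ hE ?_
      rw [← h1, zpow_sub_one₀ hE]
      field_simp
    refine ⟨h3, mul_left_cancel₀ hE ?_⟩
    rw [h3] at h2
    have h4 : E ^ (-(i : ℤ)) = E * E ^ (-(i : ℤ) - 1) := by
      rw [zpow_sub_one₀ hE]
      field_simp
    rw [h4] at h2
    push_cast at h2 ⊢
    linear_combination -h2 + (-i - 1) * k * hP

/-! ### Integer translations and the intertwining by e^{2πinQ}. -/

section Monodromy

variable {ℓ : ℕ} {Δ : Finset (EuclideanSpace ℝ (Fin ℓ))} {g : ℂ} {U : Set ℂ}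
  {q p : ℂ → Fin ℓ → ℂ} {τ z : ℂ}

lemma expQ_mul_expQ (k l : ℂ) (v : Fin ℓ → ℂ) :
    expQ Δ k v * expQ Δ l v = expQ Δ (k + l) v := by
  rw [expQ_eq, expQ_eq, expQ_eq, Matrix.diagonal_mul_diagonal]
  congr 1
  ext β
  rw [← Complex.exp_add]
  ring_nf

lemma expQ_zero (v : Fin ℓ → ℂ) : expQ Δ 0 v = 1 := by
  simp [expQ_eq]

lemma expQ_mul_expQ_neg (k : ℂ) (v : Fin ℓ → ℂ) : expQ Δ k v * expQ Δ (-k) v = 1 := by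
  rw [expQ_mul_expQ, add_neg_cancel, expQ_zero]

lemma expQ_neg_mul_expQ (k : ℂ) (v : Fin ℓ → ℂ) : expQ Δ (-k) v * expQ Δ k v = 1 := by
  rw [expQ_mul_expQ, neg_add_cancel, expQ_zero]

lemma commute_expQ_dotMat (k : ℂ) (v w : Fin ℓ → ℂ) : expQ Δ k v * dotMat Δ w = dotMat Δ w * expQ Δ k v := by
  rw [expQ_eq, dotMat, Matrix.diagonal_mul_diagonal, Matrix.diagonal_mul_diagonal]
  simp only [mul_comm]

lemma expQ_mul_mul_expQ_apply (k : ℂ) (v : Fin ℓ → ℂ) (A : Matrix Δ Δ ℂ) (β γ : Δ) :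
    (expQ Δ k v * A * expQ Δ (-k) v) β γ = cexp (2 * Real.pi * I * k *
      (cdot (β : EuclideanSpace ℝ (Fin ℓ)) v - cdot (γ : EuclideanSpace ℝ (Fin ℓ)) v)) * A β γ := by
  rw [expQ_eq, expQ_eq, Matrix.mul_diagonal, Matrix.diagonal_mul, mul_right_comm, ← Complex.exp_add]
  ring_nf

lemma IsFlow.hasDerivAt_expQ (hflow : IsFlow Δ g U q p) (hτ : τ ∈ U) (k : ℂ) :
    HasDerivAt (fun t => opEquiv (expQ Δ k (q t)))
      (opEquiv (k • (dotMat Δ (p τ) * expQ Δ k (q τ)))) τ := by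
  refine hasDerivAt_opEquiv.2 fun β γ => ?_
  simp only [expQ_eq, dotMat, Matrix.diagonal_mul_diagonal, Matrix.smul_apply, smul_eq_mul]
  by_cases hb : β = γ
  · subst hb
    simp only [Matrix.diagonal_apply_eq]
    refine ((hflow.hasDerivAt_cdot_q hτ β).const_mul (2 * Real.pi * I * k)).cexp.congr_deriv ?_
    have := Complex.two_pi_I_ne_zero
    field_simp
  · simp only [Matrix.diagonal_apply_ne _ hb, mul_zero]
    exact hasDerivAt_const _ _

lemma monodromy_LM_int (hΔ : IsSimplyLacedRootSystem Δ) (hflow : IsFlow Δ g U q p) (hτ : τ ∈ U)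
    (h : 0 < τ.im) (z : ℂ) (m n : ℤ) :
    Lmat Δ g q p τ (z + m + n * τ) = expQ Δ n (q τ) * Lmat Δ g q p τ z * expQ Δ (-n) (q τ) ∧
    Mmat Δ g q τ (z + m + n * τ) =
      expQ Δ n (q τ) * (Mmat Δ g q τ z + (2 * Real.pi * I * n) • Lmat Δ g q p τ z) *
        expQ Δ (-n) (q τ) - (2 * Real.pi * I * n) • dotMat Δ (p τ) := by
  have hL1 : Function.Periodic (Lmat Δ g q p τ) 1 := fun z => (monodromy_LM hΔ hflow hτ h z).1
  have hM1 : Function.Periodic (Mmat Δ g q τ) 1 := fun z => (monodromy_LM hΔ hflow hτ h z).2.1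
  have e1 : z + m + n * τ = z + n * τ + m * (1 : ℂ) := by ring
  rw [e1, hL1.int_mul, hM1.int_mul]
  have key : ∀ β γ : Δ, _ := fun β γ => zpow_iterate (l := fun n => Lmat Δ g q p τ (z + n * τ) β γ)
    (m := fun n => Mmat Δ g q τ (z + n * τ) β γ) (k := 2 * Real.pi * I) (P := dotMat Δ (p τ) β γ)
    (Complex.exp_ne_zero (2 * Real.pi * I * 1 * (cdot (β : EuclideanSpace ℝ (Fin ℓ)) (q τ) -
      cdot (γ : EuclideanSpace ℝ (Fin ℓ)) (q τ))))
    (fun n => by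
      have e2 : z + ((n + 1 : ℤ) : ℂ) * τ = z + n * τ + τ := by push_cast; ring
      rw [e2, (monodromy_LM hΔ hflow hτ h _).2.2.1, expQ_mul_mul_expQ_apply])
    (fun n => by
      have e2 : z + ((n + 1 : ℤ) : ℂ) * τ = z + n * τ + τ := by push_cast; ring
      rw [e2, (monodromy_LM hΔ hflow hτ h _).2.2.2, Matrix.sub_apply, expQ_mul_mul_expQ_apply]
      rfl)
    (by
      by_cases hb : β = γ
      · simp [hb]
      · simp [dotMat, Matrix.diagonal_apply_ne _ hb]) n
  constructor
  · ext β γ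
    have := (key β γ).1
    rw [expQ_mul_mul_expQ_apply, this, ← Complex.exp_int_mul, Int.cast_zero, zero_mul, add_zero]
    ring_nf
  · ext β γ
    have := (key β γ).2
    rw [Matrix.sub_apply, expQ_mul_mul_expQ_apply, this, ← Complex.exp_int_mul, Int.cast_zero,
      zero_mul, add_zero]
    simp only [Matrix.add_apply, Matrix.smul_apply, smul_eq_mul]
    ring_nf

/-- Conjugation by `e^{2πi n Q}` intertwines the connection along the lines `z` and `z + m + n τ`. -/
lemma hasDerivAt_expQ_neg_mul (hΔ : IsSimplyLacedRootSystem Δ) (hflow : IsFlow Δ g U q p)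
    (hτ : τ ∈ U) (h : 0 < τ.im) (b : ℝ × ℝ) (m n : ℤ) {f : ℂ → (Δ → ℂ) →L[ℂ] (Δ → ℂ)}
    (hf : HasDerivAt f (((((b.1 + m, b.2 + n) : ℝ × ℝ).2 : ℂ) •
        opLeft (Lmat Δ g q p) (τ, torusPoint (b.1 + m, b.2 + n) τ) +
      opRight (Mmat Δ g q) (τ, torusPoint (b.1 + m, b.2 + n) τ)) * f τ) τ) :
    HasDerivAt (fun t => opEquiv (expQ Δ (-n) (q t)) * f t)
      (((b.2 : ℂ) • opLeft (Lmat Δ g q p) (τ, torusPoint b τ) +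
        opRight (Mmat Δ g q) (τ, torusPoint b τ)) * (opEquiv (expQ Δ (-n) (q τ)) * f τ)) τ := by
  refine ((hflow.hasDerivAt_expQ hτ (-n)).fun_mul hf).congr_deriv ?_
  have e1 : torusPoint (b.1 + m, b.2 + n) τ = torusPoint b τ + m + n * τ := by
    simp only [torusPoint]
    push_cast
    ring
  obtain ⟨hL, hM⟩ := monodromy_LM_int hΔ hflow hτ h (torusPoint b τ) m n
  have hT := expQ_neg_mul_expQ (Δ := Δ) (n : ℂ) (q τ)
  have hP := commute_expQ_dotMat (Δ := Δ) (-(n : ℂ)) (q τ) (p τ)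
  simp only [e1, opLeft, opRight, hL, hM]
  set T := expQ Δ (n : ℂ) (q τ)
  set T' := expQ Δ (-(n : ℂ)) (q τ)
  set L := Lmat Δ g q p τ (torusPoint b τ)
  set M := Mmat Δ g q τ (torusPoint b τ)
  set P := dotMat Δ (p τ)
  rw [← mul_assoc, ← mul_assoc, ← add_mul]
  congr 1
  rw [← map_smul, ← map_smul, ← map_add, ← map_add, ← map_mul, ← map_mul, ← map_add]
  congr 1
  -- After removing the conjugation, the summand 2πin L in M turns the slope b₂ + n back into b₂,
  -- and -2πin P cancels the derivative of e^{-2πinQ}.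
  have k1 : ∀ A : Matrix Δ Δ ℂ, T' * (T * A * T') = A * T' := fun A => by
    rw [← mul_assoc, ← mul_assoc, hT, one_mul]
  rw [mul_add, Matrix.mul_smul, Matrix.mul_smul, mul_sub, k1, k1, Matrix.mul_smul, hP]
  simp only [add_mul, Matrix.smul_mul, smul_add, smul_sub, smul_smul]
  have := Complex.two_pi_I_ne_zero
  have k2 : -(2 * Real.pi * I : ℂ)⁻¹ * (2 * Real.pi * I * n) = -n := by
    field_simp
  rw [k2]
  push_cast
  module

end Monodromy

end EllipticCM

end

open EllipticCM
theorem mainTheorem4 {ℓ : ℕ} (Δ : Finset (EuclideanSpace ℝ (Fin ℓ)))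
    (hΔ : IsSimplyLacedRootSystem Δ) (g : ℂ)
    (U : Set ℂ) (hU : IsOpen U) (hUim : ∀ τ ∈ U, 0 < τ.im)
    (q p : ℂ → Fin ℓ → ℂ) (hflow : IsFlow Δ g U q p) :
    -- 1. the isomonodromic Lax equation
    (∀ τ ∈ U, ∀ z, ¬ IsSingular τ z → ∃ Lτ Mz : Matrix Δ Δ ℂ,
      (∀ β γ, HasDerivAt (fun t => Lmat Δ g q p t z β γ) (Lτ β γ) τ) ∧
      (∀ β γ, HasDerivAt (fun w => Mmat Δ g q τ w β γ) (Mz β γ) z) ∧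
      (2 * Real.pi * I) • Lτ + Mz
        = Lmat Δ g q p τ z * Mmat Δ g q τ z - Mmat Δ g q τ z * Lmat Δ g q p τ z) ∧
    -- 2. the monodromy of `L` and `M`
    (∀ τ ∈ U, ∀ z, ¬ IsSingular τ z →
      Lmat Δ g q p τ (z + 1) = Lmat Δ g q p τ z ∧
      Mmat Δ g q τ (z + 1) = Mmat Δ g q τ z ∧
      Lmat Δ g q p τ (z + τ) = expQ Δ 1 (q τ) * Lmat Δ g q p τ z * expQ Δ (-1) (q τ) ∧
      Mmat Δ g q τ (z + τ)
        = expQ Δ 1 (q τ) * (Mmat Δ g q τ z + (2 * Real.pi * I) • Lmat Δ g q p τ z)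
            * expQ Δ (-1) (q τ) - (2 * Real.pi * I) • dotMat Δ (p τ)) ∧
    -- 3a. `dY/dz = L Y` has exactly the four (regular) singular points `0, ω₁, ω₂, ω₃` on the torus
    (∀ τ ∈ U,
      (∀ a b, a ≠ b → singularPoint τ a - singularPoint τ b ∉ periods τ) ∧
      (∀ z, ¬ IsSingular τ z → ∀ β γ, AnalyticAt ℂ (fun w => Lmat Δ g q p τ w β γ) z) ∧
      (∀ z, IsSingular τ z →
        (∀ β γ, MeromorphicAt (fun w => Lmat Δ g q p τ w β γ) z ∧
          -1 ≤ meromorphicOrderAt (fun w => Lmat Δ g q p τ w β γ) z) ∧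
        (g ≠ 0 → Δ.Nonempty →
          ∃ β γ, meromorphicOrderAt (fun w => Lmat Δ g q p τ w β γ) z = -1))) ∧
    -- 3b. existence of (multivalued) joint fundamental solutions of
    -- `∂Y/∂z = L Y`, `2πi ∂Y/∂τ + M Y = 0` with prescribed initial value
    (∀ V ⊆ U, IsOpen V → Convex ℝ V → ∀ τ₀ ∈ V, ∀ b : ℝ × ℝ,
      ∀ Y₀ : Matrix Δ Δ ℂ, IsUnit Y₀ → ∃ G : ℂ → Matrix Δ Δ ℂ, G τ₀ = Y₀ ∧
        ∀ (e : ℝ × ℝ) (c : Path b e), AvoidsSingular V c →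
          ∃ Φ : unitInterval → ℂ → Matrix Δ Δ ℂ,
            IsContinuationAlong (Lmat Δ g q p) (Mmat Δ g q) V c Φ ∧
            (∀ τ ∈ V, Φ 0 τ = G τ) ∧ ∀ s, ∀ τ ∈ V, IsUnit (Φ s τ)) ∧
    -- 3c. the monodromy matrix `Γ` in `Y(z + m + nτ) = e^{2πi n Q} Y(z) Γ` along any
    -- path from `z` to `z + m + nτ` avoiding the singular points is independent of `τ`
    -- (`m = n = 0` with loops around the four singular points: `Γ₀, Γ₁, Γ₂, Γ₃`;
    -- `(m, n) = (1, 0)` and `(0, 1)`: the two global ones)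
    (∀ V ⊆ U, IsOpen V → IsPreconnected V → ∀ (b : ℝ × ℝ) (m n : ℤ)
      (c : Path b (b.1 + m, b.2 + n)), AvoidsSingular V c →
      ∀ Φ : unitInterval → ℂ → Matrix Δ Δ ℂ,
        IsContinuationAlong (Lmat Δ g q p) (Mmat Δ g q) V c Φ →
        (∀ τ ∈ V, IsUnit (Φ 0 τ)) →
        ∃ Γ : Matrix Δ Δ ℂ, IsUnit Γ ∧
          ∀ τ ∈ V, Φ 1 τ = expQ Δ n (q τ) * Φ 0 τ * Γ) := by

  have hflat := isFlatConnection_lax hΔ hU hUim hflow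
  refine ⟨fun τ hτ z hz => lax_equation hΔ hflow hτ (hUim τ hτ) hz,
    fun τ hτ z _ => monodromy_LM hΔ hflow hτ (hUim τ hτ) z,
    fun τ hτ => ⟨fun a b hab => singularPoint_sub_notMem_periods (hUim τ hτ) hab,
      fun z hz β γ => analyticAt_Lmat hΔ hflow hτ (hUim τ hτ) hz β γ,
      fun z hz => ⟨fun β γ => ?_, fun hg hne =>
        exists_meromorphicOrderAt_Lmat_eq hΔ hflow hτ (hUim τ hτ) hz hg hne⟩⟩, ?_, ?_⟩
  · obtain ⟨c, hc⟩ := exists_hasPolarForm_Lmat hΔ hflow hτ (hUim τ hτ) z β γ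
    exact ⟨hc.meromorphicAt, hc.neg_one_le_meromorphicOrderAt⟩
  · intro V hVU hV hVc τ₀ hτ₀ b Y₀ hY₀
    have him : ∀ τ ∈ V, 0 < τ.im := fun τ hτ => hUim τ (hVU hτ)
    -- From a singular base point no admissible path starts, so any G with the prescribed value will
    -- do.
    by_cases hb : 2 * b.1 ∈ Set.range ((↑) : ℤ → ℝ) ∧ 2 * b.2 ∈ Set.range ((↑) : ℤ → ℝ)
    · refine ⟨fun _ => Y₀, rfl, fun e c hc => absurd ?_ (hc 0 τ₀ hτ₀)⟩
      rw [c.source]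
      exact (isSingular_torusPoint_iff (him τ₀ hτ₀)).2 hb
    obtain ⟨G, hG₀, hG⟩ := hflat.exists_transport hV hVc him isOpen_nonsingular_coords
      (fun a ha τ hτ => ⟨hVU hτ, fun hs => ha ((isSingular_torusPoint_iff (him τ hτ)).1 hs)⟩)
      hb hτ₀ (isUnit_opEquiv.2 hY₀)
    refine ⟨fun τ => opEquiv.symm (G τ), by simp only [hG₀, AlgEquiv.symm_apply_apply], fun e c hc => ?_⟩
    -- Avoidance at the single value τ₀ suffices, since the singular coordinates do not depend on τ.
    obtain ⟨Φ, hΦ, hΦ0, hΦu⟩ := hG e c fun s hs =>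
      hc s τ₀ hτ₀ ((isSingular_torusPoint_iff (him τ₀ hτ₀)).2 hs)
    refine ⟨fun s τ => opEquiv.symm (Φ s τ), isContinuationAlong_iff.2 ?_,
      fun τ hτ => congrArg opEquiv.symm (hΦ0 τ hτ), fun s τ hτ => ?_⟩
    · simpa only [AlgEquiv.apply_symm_apply] using hΦ
    · rw [← isUnit_opEquiv, AlgEquiv.apply_symm_apply]
      exact hΦu s τ hτ
  · intro V hVU hV hVc b m n c hc Φ hΦ hΦ0
    obtain ⟨Γ, hΓ, h⟩ := (isContinuationAlong_iff.1 hΦ).exists_monodromy hflat hV hVc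
      (fun s τ hτ => ⟨hVU hτ, hc s τ hτ⟩) (fun τ hτ => isUnit_opEquiv.2 (hΦ0 τ hτ))
      (T := fun τ => opEquiv (expQ Δ n (q τ))) (T' := fun τ => opEquiv (expQ Δ (-n) (q τ)))
      (fun τ _ => by
        rw [← map_mul, ← map_mul, expQ_neg_mul_expQ, expQ_mul_expQ_neg, map_one]
        exact ⟨rfl, rfl⟩)
      (fun f τ hτ hf => hasDerivAt_expQ_neg_mul hΔ hflow (hVU hτ) (hUim τ (hVU hτ)) b m n hf)
    refine ⟨opEquiv.symm Γ, ?_, fun τ hτ => opEquiv.injective ?_⟩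
    · rwa [← isUnit_opEquiv, AlgEquiv.apply_symm_apply]
    · rw [h τ hτ, map_mul, map_mul, AlgEquiv.apply_symm_apply]
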